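/- **Setting.** There are $K\ge 1$ arms, $T$ rounds, and preference matrices $P_t\in[0,1]^{K\times K}$ with $P_t(a,a')+P_t(a',a)=1$, fixed in advance and unknown. In round $t$ the learner plays $(i_t,j_t)$ and observes $O_t\sim\mathrm{Ber}(P_t(i_t,j_t))$. For a known weight $w\in\Delta^K$ let $b_t(a,w)=\sum_{a'}(P_t(a,a')-\tfrac12)w^{a'}$, $\delta^w_t(a)=\max_{a'}b_t(a',w)-b_t(a,w)$ and $$\mathrm{Regret}(w)=\sum_{t=1}^T\tfrac12\bigl(2\max_a b_t(a,w)-b_t(i_t,w)-b_t(j_t,w)\bigr).$$ **Phases (SKW).** Arm $a$ has significant regret over $[s_1,s_2]$, $s_1<s_2$, if $\sum_{s=s_1}^{s_2}\delta_s^w(a)\ge K^{1/3}(s_2-s_1)^{2/3}$. Put $\tau_0=1$, and let $\tau_{i+1}$ be the smallest $t\in(\tau_i,T]$ such that every arm has significant regret over some $[s_1,s_2]\subseteq[\tau_i,t]$ with $s_1<s_2$. If no such $t$ exists, put $L=i$ and $\tau_{L+1}=T+1$. **Algorithm.** The inputs are $K$, $T$, $w$, an eviction constant $c$ and a cap $\kappa\in(0,1]$;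 nothing is known about the $P_t$ or $\tau_i$. Let $\gamma_n=\min\{K^{1/3}n^{-1/3},\kappa\}$ and $\gamma_0=\kappa$. * *Episodes and replays.* An episode starts at $t_\ell$ (with $t_1=1$) by launching a base algorithm that lasts for the whole episode. At each later round $t$ of the episode, independent $B_{t,m}\sim\mathrm{Ber}(m^{-1/3}(t-t_\ell)^{-2/3})$ are drawn for $m=2,4,\dots,2^{\lceil\log_2T\rceil}$. If some $B_{t,m}=1$, a replay with the largest such $m$ is launched; it is scheduled for the rounds $t,\dots,t+m$ and interrupts whatever is running. The base algorithm active at round $t$ is the most recently launched one whose scheduled rounds are not over; let $s$ be its first round. * *Playing.* Set $\eta_t=\gamma_{t-s}$. Draw $i_t,j_t$ independently from $q_t=\eta_t\,w+(1-\eta_t)\,\mathrm{Unif}(\mathcal A_t)$, where the active set $\mathcal A_t$ consists of the arms not evicted over any $[s_1,s_2]\subseteq[s,t)$. Set $$\hat b_t(a)=\sum_{a'}\frac{\mathbf 1\{i_t=a,j_t=a'\}(O_t-\frac12)}{q_t(a)q_t(a')}w^{a'}.$$ * *Eviction.* Arm $a$ is evicted over $[s_1,s_2]$, $s_1<s_2$,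 if for some arm $a'$ both $a$ and $a'$ lie in $\mathcal A_s$ for all $s\in[s_1,s_2]$, and $\sum_{s=s_1}^{s_2}(\hat b_s(a')-\hat b_s(a))>c\log(T)\,F([s_1,s_2])$, where $$F([s_1,s_2])=\max\Bigl\{K^{1/3}(s_2-s_1)^{2/3},\ \sqrt{K\textstyle\sum_{s=s_1}^{s_2}\eta_s^{-1}}+K\max_{s\in[s_1,s_2]}\eta_s^{-1}\Bigr\}.$$ * *Restart.* A new episode starts at round $t$ as soon as every arm has been evicted over some $[s_1,s_2]\subseteq[t_\ell,t)$. **Theorem.** There is an absolute exponent $p$ such that the following two statements hold. 1. For every cap $\kappa\in(0,1)$ there is $c_0>0$ such that for every $c\ge c_0$ there is $C>0$ with $$\mathbb E[\mathrm{Regret}(w)]\le C\,(1+\log T)^p\sum_{i=0}^{L}K^{1/3}(\tau_{i+1}-\tau_i)^{2/3}$$ for all $K$, all $T$, all environments $(P_t)$ and all $w\in\Delta^K$. 2. With the cap $\kappa=1$ the same bound holds for weights that put mass of order $1/K$ on each arm: for every $\alpha>0$ there is $c_0>0$ such that for every $c\ge c_0$ there is $C>0$ such that the bound holds for all $K$,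 $T$, $(P_t)$ and all $w\in\Delta^K$ with $w^a\ge\alpha/K$ for every arm $a$. -/

import Mathlib

open scoped BigOperators ENNReal

noncomputable section

namespace WeightedBorda

/-! ### The environment, weighted Borda scores and significant winner switches -/

/-- A non-stationary dueling bandit environment on `K` arms: `pref t a a'` is the probability that
`a` beats `a'` at round `t`. It is fixed in advance (oblivious). Rounds are numbered from `1`. -/
structure Environment (K : ℕ) where
  pref : ℕ → Fin K → Fin K → ℝ
  pref_nonneg : ∀ t a a', 0 ≤ pref t a a'
  pref_add_swap : ∀ t a a', pref t a a' + pref t a' a = 1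

variable {K : ℕ}

/-- The weighted Borda score `b_t(a, w) = ∑_{a'} (P_t(a,a') - 1/2) w^{a'}`; a weight in the simplex
`Δ^K` is a probability mass function on the arms. -/
def score (P : Environment K) (w : PMF (Fin K)) (t : ℕ) (a : Fin K) : ℝ :=
  ∑ a', (P.pref t a a' - 1 / 2) * (w a').toReal

/-- The gap `δ_t^w(a) = max_{a'} (b_t(a', w) - b_t(a, w))`. -/
def gap (P : Environment K) (w : PMF (Fin K)) (t : ℕ) (a : Fin K) : ℝ :=
  ⨆ a', (score P w t a' - score P w t a)

/-- Arm `a` has significant weighted Borda regret over the rounds `s₁, …, s₂`. -/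
def SignificantRegret (P : Environment K) (w : PMF (Fin K)) (a : Fin K) (s₁ s₂ : ℕ) : Prop :=
  (K : ℝ) ^ (1 / 3 : ℝ) * ((s₂ : ℝ) - s₁) ^ (2 / 3 : ℝ) ≤ ∑ s ∈ Finset.Icc s₁ s₂, gap P w s a

/-- Every arm has significant regret over some interval `[s₁, s₂] ⊆ [τ, t]` with `s₁ < s₂`. -/
def AllArmsUnsafe (P : Environment K) (w : PMF (Fin K)) (τ t : ℕ) : Prop :=
  ∀ a : Fin K, ∃ s₁ s₂ : ℕ, τ ≤ s₁ ∧ s₁ < s₂ ∧ s₂ ≤ t ∧ SignificantRegret P w a s₁ s₂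

open Classical in
/-- The first significant winner switch after `τ` within the horizon `T`, or `T + 1` if there is
none. -/
def nextSwitch (P : Environment K) (w : PMF (Fin K)) (T τ : ℕ) : ℕ :=
  if h : ∃ t, τ < t ∧ t ≤ T ∧ AllArmsUnsafe P w τ t then Nat.find h else T + 1

/-- The significant winner switches `τ_0 = 1 < τ_1 < τ_2 < …` for the known weight `w`. -/
def switch (P : Environment K) (w : PMF (Fin K)) (T : ℕ) : ℕ → ℕ
  | 0 => 1
  | i + 1 => nextSwitch P w T (switch P w T i)

/-- The number of switches `τ_i`, `i ≥ 1`, that occur by round `T`. The last phase is number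
`numSwitches`, and it ends with `T + 1`. -/
def numSwitches (P : Environment K) (w : PMF (Fin K)) (T : ℕ) : ℕ :=
  ((Finset.Icc 1 T).filter fun i => switch P w T i ≤ T).card

/-- `∑_{i=0}^{L} K^{1/3} (τ_{i+1} - τ_i)^{2/3}`. -/
def phaseRate (P : Environment K) (w : PMF (Fin K)) (T : ℕ) : ℝ :=
  ∑ i ∈ Finset.range (numSwitches P w T + 1),
    (K : ℝ) ^ (1 / 3 : ℝ) *
      ((switch P w T (i + 1) : ℝ) - (switch P w T i : ℝ)) ^ (2 / 3 : ℝ)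

/-! ### The algorithm

The learner knows only the number of arms, the horizon `T`, the weight `w` and two numerical
constants: `c`, the constant in front of the eviction threshold, and `κ`, the cap on the learning
rate. No definition in this part mentions the environment. -/

/-- The learning rate `γ_n = min {K^{1/3} n^{-1/3}, κ}`, with `γ_0 = κ`. -/
def learningRate (K : ℕ) (κ : ℝ) (n : ℕ) : ℝ :=
  if n = 0 then κ else min ((K : ℝ) ^ (1 / 3 : ℝ) * (n : ℝ) ^ (-(1 / 3) : ℝ)) κ

/-- What the algorithm remembers of an elapsed round: the active arms `𝒜_t`, the global learning
rate `η_t`, and the score estimates. -/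
structure RoundLog (K : ℕ) where
  active : Finset (Fin K)
  rate : ℝ
  estimate : Fin K → ℝ

/-- The eviction threshold
`F([s₁,s₂]) = K^{1/3} (s₂-s₁)^{2/3} ∨ (√(K ∑ η_s⁻¹) + K max η_s⁻¹)`. -/
def threshold (log : ℕ → RoundLog K) (s₁ s₂ : ℕ) : ℝ :=
  max ((K : ℝ) ^ (1 / 3 : ℝ) * ((s₂ : ℝ) - s₁) ^ (2 / 3 : ℝ))
    (Real.sqrt (K * ∑ s ∈ Finset.Icc s₁ s₂, (log s).rate⁻¹)
      + K * ⨆ s : Set.Icc s₁ s₂, (log s).rate⁻¹)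

/-- The eviction criterion for arm `a` over `[s₁, s₂]`: `a` and some competitor `a'` were active
throughout `[s₁, s₂]`, and the estimated aggregate gap exceeds `c log(T) F([s₁,s₂])`. -/
def Evicts (c : ℝ) (T : ℕ) (log : ℕ → RoundLog K) (a : Fin K) (s₁ s₂ : ℕ) : Prop :=
  ∃ a' : Fin K,
    (∀ s ∈ Finset.Icc s₁ s₂, a ∈ (log s).active ∧ a' ∈ (log s).active) ∧
    c * Real.log T * threshold log s₁ s₂
      < ∑ s ∈ Finset.Icc s₁ s₂, ((log s).estimate a' - (log s).estimate a)

open Classical in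
/-- The arms retained at the start of round `t` when evictions over all `[s₁, s₂] ⊆ [start, t)` are
carried out. With `start` the first round of a base algorithm this is its active set; with `start`
the first round of the episode it is the global set of arms. -/
def retained (c : ℝ) (T : ℕ) (log : ℕ → RoundLog K) (start t : ℕ) : Finset (Fin K) :=
  Finset.univ.filter fun a =>
    ∀ s₁ s₂ : ℕ, start ≤ s₁ → s₁ < s₂ → s₂ < t → ¬ Evicts c T log a s₁ s₂

/-- The number of dyadic replay durations `2, 4, …, 2^⌈log₂ T⌉`. -/
abbrev numScales (T : ℕ) : ℕ := Nat.clog 2 T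

/-- The replay duration with index `e`. -/
def duration {N : ℕ} (e : Fin N) : ℕ := 2 ^ ((e : ℕ) + 1)

/-- The randomness of a round: the schedulers `B_{t,m}` of the replays that may start there, the two
arms played `i_t, j_t`, and the outcome of the duel (`true` if `i_t` wins). -/
abbrev Round (K T : ℕ) : Type := (Fin (numScales T) → Bool) × Fin K × Fin K × Bool

/-- The state at the start of round `t = round`: the first round of the current episode, the replays
(start, duration) launched in this episode with the latest first, and the log of elapsed rounds. -/
structure State (K : ℕ) where
  round : ℕ
  epStart : ℕ
  replays : List (ℕ × ℕ)
  log : ℕ → RoundLog K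

/-- The state before the first round. -/
def initState (K : ℕ) : State K := ⟨1, 1, [], fun _ => ⟨∅, 0, fun _ => 0⟩⟩

/-- The replays launched in the episode including the one, if any, that starts in this round: if
some `B_{t,m} = 1`, the longest such replay starts and interrupts whatever was running. -/
def launched {T : ℕ} (σ : State K) (B : Fin (numScales T) → Bool) : List (ℕ × ℕ) :=
  if ∃ e, B e = true then
    (σ.round, (Finset.univ.filter fun e => B e = true).sup duration) :: σ.replays
  else σ.replays

/-- The starting round of the base algorithm that plays the current round: the latest replay
`(s, m)` that is not finished (it runs for the rounds `s, …, s + m`), and otherwise the base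
algorithm that started the episode. -/
def currentStart {T : ℕ} (σ : State K) (B : Fin (numScales T) → Bool) : ℕ :=
  (((launched σ B).find? fun b => decide (σ.round ≤ b.1 + b.2)).map Prod.fst).getD σ.epStart

/-- The active set `𝒜_t`. -/
def activeSet (c : ℝ) {T : ℕ} (σ : State K) (B : Fin (numScales T) → Bool) : Finset (Fin K) :=
  retained c T σ.log (currentStart σ B) σ.round

/-- The global learning rate `η_t`. -/
def currentRate (κ : ℝ) {T : ℕ} (σ : State K) (B : Fin (numScales T) → Bool) : ℝ :=
  learningRate K κ (σ.round - currentStart σ B)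

/-- The Bernoulli law with parameter `x` (clipped to `[0, 1]`; every use has `x ∈ [0, 1]`). -/
def coin (x : ℝ) : PMF Bool :=
  PMF.ofFintype (fun b => if b then ENNReal.ofReal (min x 1) else 1 - ENNReal.ofReal (min x 1)) (by
    simp)

/-- The play distribution `q_t`: with probability `η` an arm drawn from `w`, with probability
`1 - η` a uniformly random arm of `A`. (The active set is never empty; the law `w` in that case is
a placeholder.) -/
def playLaw (w : PMF (Fin K)) (η : ℝ) (A : Finset (Fin K)) : PMF (Fin K) :=
  (coin η).bind fun explore =>
    if explore then w else if h : A.Nonempty then PMF.uniformOfFinset A h else w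

/-- The law of the schedulers: the `B_{t,m}` are independent, Bernoulli with parameter
`m^{-1/3} (t - t_ℓ)^{-2/3}`; none fires in the first round `t_ℓ` of an episode. -/
def scheduleLaw (T : ℕ) (σ : State K) : PMF (Fin (numScales T) → Bool) :=
  PMF.ofFintype
    (fun B => ∏ e, coin (if σ.round ≤ σ.epStart then 0 else
      (duration e : ℝ) ^ (-(1 / 3) : ℝ) * ((σ.round : ℝ) - σ.epStart) ^ (-(2 / 3) : ℝ)) (B e))
    (by
      rw [← Fintype.prod_sum]
      refine Finset.prod_eq_one fun e _ => ?_
      have h := PMF.tsum_coe (coin (if σ.round ≤ σ.epStart then 0 else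
        (duration e : ℝ) ^ (-(1 / 3) : ℝ) * ((σ.round : ℝ) - σ.epStart) ^ (-(2 / 3) : ℝ)))
      rwa [tsum_fintype] at h)

/-- The importance-weighted estimate of the score of arm `a` from one duel `(i, j, o)` of arms drawn
independently from `q`: `∑_{a'} 1{i = a, j = a'} (o - 1/2) w^{a'} / (q(a) q(a'))`. -/
def estimateScore (w q : PMF (Fin K)) (i j : Fin K) (o : Bool) (a : Fin K) : ℝ :=
  ∑ a', if i = a ∧ j = a' then
    ((if o then (1 : ℝ) else 0) - 1 / 2) / ((q a).toReal * (q a').toReal) * (w a').toReal else 0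

/-- One round of the meta-algorithm. If every arm has been evicted from the global set, a new
episode starts with the next round. -/
def nextState (c κ : ℝ) (T : ℕ) (w : PMF (Fin K)) (σ : State K) (r : Round K T) : State K :=
  let A := activeSet c σ r.1
  let η := currentRate κ σ r.1
  let log' := Function.update σ.log σ.round
    ⟨A, η, estimateScore w (playLaw w η A) r.2.1 r.2.2.1 r.2.2.2⟩
  if retained c T log' σ.epStart (σ.round + 1) = ∅ then
    ⟨σ.round + 1, σ.round + 1, [], log'⟩
  else
    ⟨σ.round + 1, σ.epStart, launched σ r.1, log'⟩

/-- The state at the start of round `n + 1`, as a function of the first `n` rounds. -/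
def stateAfter (c κ : ℝ) (T : ℕ) (w : PMF (Fin K)) : (n : ℕ) → (Fin n → Round K T) → State K
  | 0, _ => initState K
  | n + 1, h => nextState c κ T w (stateAfter c κ T w n (Fin.init h)) (h (Fin.last n))

/-! ### The interaction of the algorithm with an environment, and the regret -/

/-- The law of a round in state `σ`: replays are scheduled, `i_t` and `j_t` are drawn independently
from `q_t`, and `i_t` wins with probability `P_t(i_t, j_t)`. -/
def roundLaw (P : Environment K) (c κ : ℝ) (T : ℕ) (w : PMF (Fin K)) (σ : State K) :
    PMF (Round K T) :=
  (scheduleLaw T σ).bind fun B =>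
    let q := playLaw w (currentRate κ σ B) (activeSet c σ B)
    q.bind fun i => q.bind fun j => (coin (P.pref σ.round i j)).map fun o => (B, i, j, o)

/-- The law of the first `n` rounds. -/
def historyLaw (P : Environment K) (c κ : ℝ) (T : ℕ) (w : PMF (Fin K)) :
    (n : ℕ) → PMF (Fin n → Round K T)
  | 0 => PMF.pure Fin.elim0
  | n + 1 => (historyLaw P c κ T w n).bind fun h =>
      (roundLaw P c κ T w (stateAfter c κ T w n h)).map fun r =>
        Fin.snoc (α := fun _ => Round K T) h r

/-- The dynamic regret `∑_t (1/2) (2 max_a b_t(a,w) - b_t(i_t,w) - b_t(j_t,w))` of a run; round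
`t = n + 1` has index `n`. -/
def regret (P : Environment K) (w : PMF (Fin K)) {T : ℕ} (h : Fin T → Round K T) : ℝ :=
  ∑ n : Fin T, (1 / 2 : ℝ) * (2 * (⨆ a, score P w ((n : ℕ) + 1) a)
    - score P w ((n : ℕ) + 1) (h n).2.1 - score P w ((n : ℕ) + 1) (h n).2.2.1)

/-- The expected dynamic regret over `T` rounds of the meta-algorithm with the fixed weight
specification for `w`. -/
def expectedRegret (P : Environment K) (c κ : ℝ) (T : ℕ) (w : PMF (Fin K)) : ℝ :=
  ∑ h : Fin T → Round K T, (historyLaw P c κ T w T h).toReal * regret P w h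

end WeightedBorda

end

open scoped BigOperators ENNReal

noncomputable section

namespace WeightedBorda

/-! ### Expectations with respect to probability mass functions on finite types -/

/-! The proof separates probability from a deterministic argument about single runs.

Probability. A product over the rounds of nonnegative factors with conditional mean at most one has
mean at most one (`ev_prod_le_one`). Three families of exponential factors, `O(T ^ 7)` in number for
fixed constants, control the estimates, the number of replays that fire, and the total probability
of chosen schedulers none of which fires. If all products stay below `T ^ 8`, the run satisfies
`IsGood`. Otherwise the regret, being at most `T`, is at most `T ^ (-7)` times the sum of the
products, whose mean is then bounded (`expectedRegret_le_episodeCoef`). An estimate has variance of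
order `K / η` as soon as active arms are played with probability of order `1 / K` (`PlaysActive`); a
cap below one, or a weight of order `1 / K` on every arm, guarantees this.

Good runs. An eviction certifies significant regret (`significantRegret_of_evicts`), so a finished
episode contains a switch, and each phase is charged at most twice (`IsTrace.regret_before_le`). In
an episode, fix an arm `b` retained up to its last round. The regret of a round is at most the
exploration rate, plus the mean score difference from `b` to the active arms, plus the gap of `b`.

The second term is delicate because replays interrupt each other while eviction tests concern
intervals. An arm retained by an older base algorithm is active in every base algorithm launched
later (`IsTrace.retained_subset_active`), so its tests reach across interruptions. Telescoping along
nested replays (`eq_add_sum_outlasts`) then writes the mean over the current active set as a sum of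
differences, each living on an interval (`IsTrace.sum_meanDiff_cs_le`).

For the gap of `b`, the episode is cut into segments that end when the regret of `b` becomes large
or the phase changes. A long replay in the first half of a segment of large regret would keep the
safe arm of the phase active and evict `b` (`IsTrace.not_long_replay`), so none fired there. In an
episode of `n` rounds, a segment of length `d` carries firing probability of order `(d / n) ^ (2 /
3)`, and on a good run these sum to `O(log T)` (`IsTrace.sum_gap_retained_le`). Subadditivity of `x
^ (2 / 3)` turns all bounds into sums over phases. -/

/-- The expectation of a real function under a probability mass function on a finite type. -/
def ev {α : Type*} [Fintype α] (p : PMF α) (f : α → ℝ) : ℝ := ∑ x, (p x).toReal * f x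

section Expectation

variable {α β : Type*} [Fintype α] [Fintype β]

lemma sum_toReal_pmf (p : PMF α) : ∑ x, (p x).toReal = 1 := by
  rw [← ENNReal.toReal_sum (fun x _ => p.apply_ne_top x), ← tsum_fintype (L := .unconditional α),
    p.tsum_coe, ENNReal.toReal_one]

lemma ev_const (p : PMF α) (c : ℝ) : ev p (fun _ => c) = c := by
  simp [ev, ← Finset.sum_mul, sum_toReal_pmf]

lemma ev_mono (p : PMF α) {f g : α → ℝ} (h : ∀ x, f x ≤ g x) : ev p f ≤ ev p g :=
  Finset.sum_le_sum fun x _ => mul_le_mul_of_nonneg_left (h x) ENNReal.toReal_nonneg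

lemma ev_add (p : PMF α) (f g : α → ℝ) : ev p (fun x => f x + g x) = ev p f + ev p g := by
  simp [ev, mul_add, Finset.sum_add_distrib]

lemma ev_sub (p : PMF α) (f g : α → ℝ) : ev p (fun x => f x - g x) = ev p f - ev p g := by
  simp [ev, mul_sub, Finset.sum_sub_distrib]

lemma ev_mul_left (p : PMF α) (c : ℝ) (f : α → ℝ) : ev p (fun x => c * f x) = c * ev p f := by
  simp only [ev, Finset.mul_sum]
  exact Finset.sum_congr rfl fun x _ => by ring

lemma ev_mul_right (p : PMF α) (c : ℝ) (f : α → ℝ) : ev p (fun x => f x * c) = ev p f * c := by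
  simp only [ev, Finset.sum_mul]
  exact Finset.sum_congr rfl fun x _ => by ring

lemma ev_finset_sum {ι : Type*} (p : PMF α) (s : Finset ι) (f : ι → α → ℝ) :
    ev p (fun x => ∑ i ∈ s, f i x) = ∑ i ∈ s, ev p (f i) := by
  simp only [ev, Finset.mul_sum]
  exact Finset.sum_comm

lemma ev_pure (x : α) (f : α → ℝ) : ev (PMF.pure x) f = f x := by
  classical
  rw [ev, Finset.sum_eq_single x]
  · simp
  · intro y _ hy
    simp [PMF.pure_apply, hy]
  · simp

lemma ev_bind (p : PMF α) (q : α → PMF β) (f : β → ℝ) :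
    ev (p.bind q) f = ev p fun x => ev (q x) f := by
  simp only [ev, Finset.mul_sum]
  rw [Finset.sum_comm]
  refine Finset.sum_congr rfl fun y _ => ?_
  rw [PMF.bind_apply, tsum_fintype, ENNReal.toReal_sum
    (fun x _ => ENNReal.mul_ne_top (p.apply_ne_top x) ((q x).apply_ne_top y)), Finset.sum_mul]
  exact Finset.sum_congr rfl fun x _ => by rw [ENNReal.toReal_mul]; ring

lemma ev_map (p : PMF α) (g : α → β) (f : β → ℝ) : ev (p.map g) f = ev p fun x => f (g x) := by
  rw [← PMF.bind_pure_comp, ev_bind]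
  simp [ev_pure]

end Expectation

lemma ev_coin (x : ℝ) (hx : 0 ≤ x) (f : Bool → ℝ) :
    ev (coin x) f = min x 1 * f true + (1 - min x 1) * f false := by
  have h0 : 0 ≤ min x 1 := le_min hx zero_le_one
  have h1 : ENNReal.ofReal (min x 1) ≤ 1 := ENNReal.ofReal_le_one.2 (min_le_right _ _)
  simp only [ev, coin, PMF.ofFintype_apply, Fintype.sum_bool, if_true, Bool.false_eq_true,
    if_false, ENNReal.toReal_sub_of_le h1 ENNReal.one_ne_top, ENNReal.toReal_ofReal h0,
    ENNReal.toReal_one]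

variable {K : ℕ}

lemma ev_playLaw (w : PMF (Fin K)) {η : ℝ} (h0 : 0 ≤ η) (h1 : η ≤ 1) {A : Finset (Fin K)}
    (hA : A.Nonempty) (f : Fin K → ℝ) :
    ev (playLaw w η A) f = η * ev w f + (1 - η) * ((A.card : ℝ)⁻¹ * ∑ a ∈ A, f a) := by
  rw [playLaw, ev_bind, ev_coin η h0, min_eq_left h1]
  simp only [if_true, Bool.false_eq_true, if_false, dif_pos hA]
  congr 2
  simp only [ev, PMF.uniformOfFinset_apply, Finset.mul_sum]
  rw [← Finset.sum_filter_add_sum_filter_not Finset.univ (· ∈ A)]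
  rw [Finset.sum_eq_zero (s := Finset.univ.filter fun a => a ∉ A), add_zero]
  · refine Finset.sum_congr (by ext; simp) fun a ha => ?_
    simp [ha]
  · intro a ha
    simp at ha
    simp [ha]

lemma playLaw_toReal (w : PMF (Fin K)) {η : ℝ} (h0 : 0 ≤ η) (h1 : η ≤ 1) {A : Finset (Fin K)}
    (hA : A.Nonempty) (a : Fin K) :
    (playLaw w η A a).toReal
      = η * (w a).toReal + (1 - η) * (if a ∈ A then (A.card : ℝ)⁻¹ else 0) := by
  classical
  have h := ev_playLaw w h0 h1 hA (fun b => if b = a then 1 else 0)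
  simpa [ev] using h

/-- The law is a product, so the coordinates other than `e` sum to one. -/
lemma ev_scheduleLaw (T : ℕ) (σ : State K) (e : Fin (numScales T)) (g : Bool → ℝ) :
    ev (scheduleLaw T σ) (fun B => g (B e)) =
      ev (coin (if σ.round ≤ σ.epStart then 0 else
        (duration e : ℝ) ^ (-(1 / 3) : ℝ) * ((σ.round : ℝ) - σ.epStart) ^ (-(2 / 3) : ℝ))) g := by
  classical
  set c : Fin (numScales T) → PMF Bool := fun e => coin (if σ.round ≤ σ.epStart then 0 else
        (duration e : ℝ) ^ (-(1 / 3) : ℝ) * ((σ.round : ℝ) - σ.epStart) ^ (-(2 / 3) : ℝ)) with hc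
  have h1 : ∀ B : Fin (numScales T) → Bool, (scheduleLaw T σ B).toReal * g (B e) =
      ∏ e', ((c e' (B e')).toReal * if e' = e then g (B e') else 1) := by
    intro B
    rw [Finset.prod_mul_distrib, Finset.prod_ite_eq' Finset.univ e, if_pos (Finset.mem_univ e)]
    congr 1
    rw [scheduleLaw, PMF.ofFintype_apply, ENNReal.toReal_prod]
  rw [ev, Finset.sum_congr rfl fun B _ => h1 B,
    ← Fintype.prod_sum fun e' b => (c e' b).toReal * if e' = e then g b else 1,
    Finset.prod_eq_single e]
  · simp [ev, hc]
  · intro e' _ he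
    simp only [he, if_false, mul_one]
    exact sum_toReal_pmf _
  · simp

lemma ev_roundLaw (P : Environment K) (c κ : ℝ) (T : ℕ) (w : PMF (Fin K)) (σ : State K)
    (f : Round K T → ℝ) :
    ev (roundLaw P c κ T w σ) f = ev (scheduleLaw T σ) fun B =>
      ev (playLaw w (currentRate κ σ B) (activeSet c σ B)) fun i =>
      ev (playLaw w (currentRate κ σ B) (activeSet c σ B)) fun j =>
      ev (coin (P.pref σ.round i j)) fun o => f (B, i, j, o) := by
  simp only [roundLaw, ev_bind, ev_map]

/-! ### Runs of the algorithm along an infinite sequence of rounds -/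

/-- The state at the start of round `n + 1` along a sequence of rounds. -/
def run (c κ : ℝ) (T : ℕ) (w : PMF (Fin K)) (H : ℕ → Round K T) : ℕ → State K
  | 0 => initState K
  | n + 1 => nextState c κ T w (run c κ T w H n) (H n)

/-- The extension of a finite history by a fixed round. -/
def extend {T n : ℕ} (r₀ : Round K T) (h : Fin n → Round K T) (k : ℕ) : Round K T :=
  if hk : k < n then h ⟨k, hk⟩ else r₀

lemma run_congr (c κ : ℝ) (T : ℕ) (w : PMF (Fin K)) {H H' : ℕ → Round K T} {n : ℕ}
    (h : ∀ k < n, H k = H' k) : run c κ T w H n = run c κ T w H' n := by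
  induction n with
  | zero => rfl
  | succ n ih =>
    rw [run, run, ih fun k hk => h k (by omega), h n (by omega)]

lemma extend_snoc_lt {T n : ℕ} (r₀ : Round K T) (h : Fin n → Round K T) (r : Round K T) {k : ℕ}
    (hk : k < n) : extend r₀ (Fin.snoc (α := fun _ => Round K T) h r) k = extend r₀ h k := by
  have h1 : k < n + 1 := by omega
  simp only [extend, h1, hk, dif_pos]
  exact Fin.snoc_castSucc (α := fun _ => Round K T) r h ⟨k, hk⟩

lemma extend_snoc_self {T n : ℕ} (r₀ : Round K T) (h : Fin n → Round K T) (r : Round K T) :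
    extend r₀ (Fin.snoc (α := fun _ => Round K T) h r) n = r := by
  have h1 : n < n + 1 := by omega
  simp only [extend, h1, dif_pos]
  exact Fin.snoc_last (α := fun _ => Round K T) r h

lemma run_extend_snoc (c κ : ℝ) {T n : ℕ} (w : PMF (Fin K)) (r₀ : Round K T)
    (h : Fin n → Round K T) (r : Round K T) {k : ℕ} (hk : k ≤ n) :
    run c κ T w (extend r₀ (Fin.snoc (α := fun _ => Round K T) h r)) k
      = run c κ T w (extend r₀ h) k :=
  run_congr c κ T w fun i hi => extend_snoc_lt r₀ h r (by omega)

lemma stateAfter_eq_run (c κ : ℝ) (T : ℕ) (w : PMF (Fin K)) (r₀ : Round K T) (n : ℕ)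
    (h : Fin n → Round K T) : stateAfter c κ T w n h = run c κ T w (extend r₀ h) n := by
  induction n with
  | zero => rfl
  | succ n ih =>
    rw [stateAfter, run, ih (Fin.init h)]
    congr 1
    · refine run_congr c κ T w fun k hk => ?_
      have h1 : k < n + 1 := by omega
      simp only [extend, hk, h1, dif_pos]
      rfl
    · simp only [extend, Nat.lt_succ_self, dif_pos]
      rfl

lemma ev_historyLaw_succ (P : Environment K) (c κ : ℝ) (T : ℕ) (w : PMF (Fin K))
    (r₀ : Round K T) (n : ℕ) (f : (Fin (n + 1) → Round K T) → ℝ) :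
    ev (historyLaw P c κ T w (n + 1)) f = ev (historyLaw P c κ T w n) fun h =>
      ev (roundLaw P c κ T w (run c κ T w (extend r₀ h) n)) fun r =>
        f (Fin.snoc (α := fun _ => Round K T) h r) := by
  rw [historyLaw, ev_bind]
  simp only [ev_map, stateAfter_eq_run c κ T w r₀ n]

/-- A product of factors with conditional expectation at most one has expectation at most one. -/
lemma ev_prod_le_one (P : Environment K) (c κ : ℝ) (T : ℕ) (w : PMF (Fin K)) (r₀ : Round K T)
    (f : State K → Round K T → ℝ) (hf : ∀ σ r, 0 ≤ f σ r)
    (hf1 : ∀ σ, ev (roundLaw P c κ T w σ) (f σ) ≤ 1) (n : ℕ) :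
    ev (historyLaw P c κ T w n) (fun h => ∏ k ∈ Finset.range n,
      f (run c κ T w (extend r₀ h) k) (extend r₀ h k)) ≤ 1 := by
  induction n with
  | zero => simp [ev_const]
  | succ n ih =>
    rw [ev_historyLaw_succ P c κ T w r₀]
    refine le_trans (ev_mono _ fun h => ?_) ih
    have : ∀ r, (∏ k ∈ Finset.range (n + 1),
        f (run c κ T w (extend r₀ (Fin.snoc (α := fun _ => Round K T) h r)) k)
          (extend r₀ (Fin.snoc (α := fun _ => Round K T) h r) k)) =
        (∏ k ∈ Finset.range n, f (run c κ T w (extend r₀ h) k) (extend r₀ h k))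
          * f (run c κ T w (extend r₀ h) n) r := by
      intro r
      rw [Finset.prod_range_succ, run_extend_snoc c κ w r₀ h r le_rfl, extend_snoc_self]
      congr 1
      refine Finset.prod_congr rfl fun k hk => ?_
      have hk := Finset.mem_range.1 hk
      rw [run_extend_snoc c κ w r₀ h r hk.le, extend_snoc_lt r₀ h r hk]
    -- The earlier factors do not involve the last round and leave its conditional expectation.
    simp only [this, ev_mul_left]
    exact mul_le_of_le_one_right (Finset.prod_nonneg fun k _ => hf _ _) (hf1 _)

/-- The expectation of a sum over rounds may be computed by conditional expectations. -/
lemma ev_sum_eq (P : Environment K) (c κ : ℝ) (T : ℕ) (w : PMF (Fin K)) (r₀ : Round K T)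
    (f g : State K → Round K T → ℝ)
    (hfg : ∀ σ, ev (roundLaw P c κ T w σ) (f σ) = ev (roundLaw P c κ T w σ) (g σ)) (n : ℕ) :
    ev (historyLaw P c κ T w n) (fun h => ∑ k ∈ Finset.range n,
      f (run c κ T w (extend r₀ h) k) (extend r₀ h k)) =
    ev (historyLaw P c κ T w n) (fun h => ∑ k ∈ Finset.range n,
      g (run c κ T w (extend r₀ h) k) (extend r₀ h k)) := by
  -- Tower property for the last summand; the earlier summands do not see the last round.
  have key : ∀ (f : State K → Round K T → ℝ) (n : ℕ),
      ev (historyLaw P c κ T w (n + 1)) (fun h => ∑ k ∈ Finset.range (n + 1),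
        f (run c κ T w (extend r₀ h) k) (extend r₀ h k)) =
      ev (historyLaw P c κ T w n) (fun h => ∑ k ∈ Finset.range n,
        f (run c κ T w (extend r₀ h) k) (extend r₀ h k)) +
      ev (historyLaw P c κ T w n) (fun h =>
        ev (roundLaw P c κ T w (run c κ T w (extend r₀ h) n))
          (f (run c κ T w (extend r₀ h) n))) := by
    intro f n
    rw [ev_historyLaw_succ P c κ T w r₀, ← ev_add]
    congr 1
    funext h
    conv_rhs => rw [← ev_const (roundLaw P c κ T w (run c κ T w (extend r₀ h) n))
      (∑ k ∈ Finset.range n, f (run c κ T w (extend r₀ h) k) (extend r₀ h k)), ← ev_add]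
    congr 1
    funext r
    rw [Finset.sum_range_succ, run_extend_snoc c κ w r₀ h r le_rfl, extend_snoc_self]
    congr 1
    refine Finset.sum_congr rfl fun k hk => ?_
    have hk := Finset.mem_range.1 hk
    rw [run_extend_snoc c κ w r₀ h r hk.le, extend_snoc_lt r₀ h r hk]
  induction n with
  | zero => simp
  | succ n ih => simp only [key, ih, hfg]


/-! ### Exponential moments of the schedulers -/

/-- With success probability `p` the moment is `1 + p (e ^ lam - 1) ≤ exp (p (e ^ lam - 1))`, which
the compensator cancels. Both signs of `lam` are used: `1` for counts from above, `-1` for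
schedulers that stay silent. -/
lemma ev_coin_exp_le_one {x : ℝ} (hx : 0 ≤ x) (lam : ℝ) :
    ev (coin x) (fun b => Real.exp (lam * (if b then 1 else 0) - (Real.exp lam - 1) * min x 1))
      ≤ 1 := by
  rw [ev_coin x hx]
  simp only [if_true, Bool.false_eq_true, if_false, mul_one, mul_zero, zero_sub]
  set p := min x 1
  have h1 := Real.add_one_le_exp (p * (Real.exp lam - 1))
  have h2 : Real.exp (lam - (Real.exp lam - 1) * p)
      = Real.exp lam * Real.exp (-((Real.exp lam - 1) * p)) := by
    rw [← Real.exp_add]; ring_nf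
  have h3 : Real.exp (p * (Real.exp lam - 1)) * Real.exp (-((Real.exp lam - 1) * p)) = 1 := by
    rw [← Real.exp_add]; ring_nf; simp
  rw [h2]
  calc _ = (p * (Real.exp lam - 1) + 1) * Real.exp (-((Real.exp lam - 1) * p)) := by ring
    _ ≤ Real.exp (p * (Real.exp lam - 1)) * Real.exp (-((Real.exp lam - 1) * p)) :=
        mul_le_mul_of_nonneg_right h1 (Real.exp_pos _).le
    _ = 1 := h3

/-- The probability that the replay with duration index `e` is scheduled at round `t` of an episode
that starts at `t₀`. -/
def scheduleProb {N : ℕ} (t₀ t : ℕ) (e : Fin N) : ℝ :=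
  min (if t ≤ t₀ then 0 else
    (duration e : ℝ) ^ (-(1 / 3) : ℝ) * ((t : ℝ) - t₀) ^ (-(2 / 3) : ℝ)) 1

lemma scheduleProb_nonneg {N : ℕ} (t₀ t : ℕ) (e : Fin N) : 0 ≤ scheduleProb t₀ t e := by
  refine le_min ?_ zero_le_one
  split_ifs with h
  · exact le_rfl
  · have : (0 : ℝ) ≤ (t : ℝ) - t₀ := by
      rw [sub_nonneg]; exact_mod_cast (not_le.1 h).le
    positivity

lemma elim_scheduleProb_nonneg {N : ℕ} (ch : Option (Fin N)) (t₀ t : ℕ) :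
    0 ≤ ch.elim 0 (scheduleProb t₀ t) := by
  cases ch
  · simp
  · exact scheduleProb_nonneg t₀ t _

/-- The exponential factor that tracks how often chosen schedulers fire in an episode that starts at
`t₀`, up to round `t₁`. -/
def scheduleFactor (lam : ℝ) {T : ℕ} (t₀ t₁ : ℕ) (ch : ℕ → Option (Fin (numScales T)))
    (σ : State K) (r : Round K T) : ℝ :=
  -- Being one elsewhere, the factor singles out a random stretch of rounds, so a product over all
  -- rounds replaces a stopping time.
  if σ.epStart = t₀ ∧ σ.round ≤ t₁ then
    (ch σ.round).elim 1 fun e => Real.exp (lam * (if r.1 e then 1 else 0)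
      - (Real.exp lam - 1) * scheduleProb t₀ σ.round e)
  else 1

lemma scheduleFactor_nonneg (lam : ℝ) {T : ℕ} (t₀ t₁ : ℕ) (ch : ℕ → Option (Fin (numScales T)))
    (σ : State K) (r : Round K T) : 0 ≤ scheduleFactor lam t₀ t₁ ch σ r := by
  unfold scheduleFactor
  split_ifs
  · cases ch σ.round
    · simp
    · exact (Real.exp_pos _).le
  · exact zero_le_one

/-- The episode start and the round are known before the schedulers are drawn, and only one marginal
enters. -/
lemma ev_scheduleFactor_le_one (P : Environment K) (c κ : ℝ) (w : PMF (Fin K)) (lam : ℝ) {T : ℕ}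
    (t₀ t₁ : ℕ) (ch : ℕ → Option (Fin (numScales T))) (σ : State K) :
    ev (roundLaw P c κ T w σ) (scheduleFactor lam t₀ t₁ ch σ) ≤ 1 := by
  rw [ev_roundLaw]
  by_cases h : σ.epStart = t₀ ∧ σ.round ≤ t₁
  · cases hc : ch σ.round with
    | none => simp [scheduleFactor, h, hc, ev_const]
    | some e =>
      have h0 : (0 : ℝ) ≤ if σ.round ≤ σ.epStart then 0 else
          (duration e : ℝ) ^ (-(1 / 3) : ℝ) * ((σ.round : ℝ) - σ.epStart) ^ (-(2 / 3) : ℝ) := by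
        split_ifs with h1
        · exact le_rfl
        · have : (0 : ℝ) ≤ (σ.round : ℝ) - σ.epStart := by
            rw [sub_nonneg]; exact_mod_cast (not_le.1 h1).le
          positivity
      simp only [scheduleFactor, h, hc, and_self, if_true, Option.elim_some]
      have h2 := ev_scheduleLaw T σ e fun b => Real.exp (lam * (if b then 1 else 0)
        - (Real.exp lam - 1) * scheduleProb σ.epStart σ.round e)
      rw [← h.1]
      change ev (scheduleLaw T σ) (fun B =>
        ev (playLaw w (currentRate κ σ B) (activeSet c σ B)) fun i =>
        ev (playLaw w (currentRate κ σ B) (activeSet c σ B)) fun j =>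
        ev (coin (P.pref σ.round i j)) fun _ => Real.exp (lam * (if B e then 1 else 0)
        - (Real.exp lam - 1) * scheduleProb σ.epStart σ.round e)) ≤ 1
      simp only [ev_const]
      rw [h2]
      exact ev_coin_exp_le_one h0 lam
  · simp [scheduleFactor, h, ev_const]

/-! ### The importance-weighted estimates -/

/-- The law of the two arms drawn from `q` and of the outcome of their duel. -/
def duelLaw (P : Environment K) (t : ℕ) (q : PMF (Fin K)) : PMF (Fin K × Fin K × Bool) :=
  q.bind fun i => q.bind fun j => (coin (P.pref t i j)).map fun o => (i, j, o)

lemma ev_duelLaw (P : Environment K) (t : ℕ) (q : PMF (Fin K)) (f : Fin K × Fin K × Bool → ℝ) :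
    ev (duelLaw P t q) f = ev q fun i => ev q fun j => ev (coin (P.pref t i j)) fun o =>
      f (i, j, o) := by
  simp only [duelLaw, ev_bind, ev_map]

lemma pref_le_one (P : Environment K) (t : ℕ) (a a' : Fin K) : P.pref t a a' ≤ 1 := by
  linarith [P.pref_add_swap t a a', P.pref_nonneg t a' a]

lemma estimateScore_eq (w q : PMF (Fin K)) (i j : Fin K) (o : Bool) (a : Fin K) :
    estimateScore w q i j o a = if i = a then
      ((if o then (1 : ℝ) else 0) - 1 / 2) / ((q a).toReal * (q j).toReal) * (w j).toReal
      else 0 := by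
  unfold estimateScore
  by_cases h : i = a
  · simp [h]
  · simp [h]

/-- The importance weights cancel the play probabilities. Opponents that are never played are lost,
which is harmless because `hw` makes their weight zero. -/
lemma ev_estimateScore (P : Environment K) (w q : PMF (Fin K)) (t : ℕ) (a : Fin K)
    (ha : 0 < (q a).toReal) (hw : ∀ j, (q j).toReal = 0 → (w j).toReal = 0) :
    ev (duelLaw P t q) (fun x => estimateScore w q x.1 x.2.1 x.2.2 a) = score P w t a := by
  rw [ev_duelLaw]
  simp only [estimateScore_eq]
  rw [ev, Finset.sum_eq_single a]
  · simp only [if_true, score]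
    simp only [ev, Finset.mul_sum]
    refine Finset.sum_congr rfl fun j _ => ?_
    have h := ev_coin (P.pref t a j) (P.pref_nonneg t a j) (fun o =>
      ((if o then (1 : ℝ) else 0) - 1 / 2) / ((q a).toReal * (q j).toReal) * (w j).toReal)
    rw [ev] at h
    rw [← Finset.mul_sum, ← Finset.mul_sum, h, min_eq_left (pref_le_one P t a j)]
    by_cases hj : (q j).toReal = 0
    · simp [hw j hj]
    · simp only [if_true, Bool.false_eq_true, if_false]
      field_simp
      ring
  · intro b _ hb
    simp [hb, ev_const]
  · simp

/-- Only the first arm costs a full inverse probability: since `q ≥ η w`, the ratio `w j / q j` is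
at most `1 / η`, and averaging over the opponent leaves `1 / (q a * η)`. This saving over a squared
inverse is what yields the factor `K ^ (1 / 3)`. -/
lemma ev_estimateScore_sq_le (P : Environment K) (w q : PMF (Fin K)) (t : ℕ) (a : Fin K) {η : ℝ}
    (hη : 0 < η) (ha : 0 < (q a).toReal) (hw : ∀ j, η * (w j).toReal ≤ (q j).toReal) :
    ev (duelLaw P t q) (fun x => estimateScore w q x.1 x.2.1 x.2.2 a ^ 2)
      ≤ 1 / (4 * (q a).toReal * η) := by
  rw [ev_duelLaw]
  simp only [estimateScore_eq]
  rw [ev, Finset.sum_eq_single a]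
  · simp only [if_true]
    have h1 : ∀ (j : Fin K) (o : Bool),
        (((if o then (1 : ℝ) else 0) - 1 / 2) / ((q a).toReal * (q j).toReal) * (w j).toReal) ^ 2
          = 1 / 4 * ((w j).toReal / ((q a).toReal * (q j).toReal)) ^ 2 := by
      intro j o
      cases o <;> simp <;> ring
    simp only [h1, ev_const]
    calc (q a).toReal * ev q (fun j => 1 / 4 * ((w j).toReal / ((q a).toReal * (q j).toReal)) ^ 2)
        ≤ (q a).toReal * ∑ j, 1 / (4 * (q a).toReal ^ 2 * η) * (w j).toReal := by
          refine mul_le_mul_of_nonneg_left (Finset.sum_le_sum fun j _ => ?_) ha.le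
          have hwj : 0 ≤ (w j).toReal := ENNReal.toReal_nonneg
          rcases (ENNReal.toReal_nonneg (a := q j)).eq_or_lt with h0 | h0
          · rw [← h0, zero_mul]; positivity
          · have h2 : η * (w j).toReal / (q j).toReal ≤ 1 := by
              rw [div_le_one h0]; exact hw j
            calc _ = 1 / (4 * (q a).toReal ^ 2 * η) * (w j).toReal
                    * (η * (w j).toReal / (q j).toReal) := by field_simp
              _ ≤ _ := mul_le_of_le_one_right (by positivity) h2
      _ = _ := by
          rw [← Finset.mul_sum, sum_toReal_pmf]
          field_simp
  · intro b _ hb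
    simp [hb, ev_const]
  · simp

lemma abs_estimateScore_le (w q : PMF (Fin K)) (a i j : Fin K) (o : Bool) {η : ℝ}
    (hη : 0 < η) (ha : 0 < (q a).toReal) (hw : ∀ j, η * (w j).toReal ≤ (q j).toReal) :
    |estimateScore w q i j o a| ≤ 1 / (2 * (q a).toReal * η) := by
  rw [estimateScore_eq]
  by_cases h : i = a
  · rw [if_pos h]
    have hwj : 0 ≤ (w j).toReal := ENNReal.toReal_nonneg
    have ho : |(if o then (1 : ℝ) else 0) - 1 / 2| = 1 / 2 := by
      cases o <;> norm_num [abs_of_pos]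
    rw [abs_mul, abs_div, ho, abs_of_nonneg hwj]
    rcases (ENNReal.toReal_nonneg (a := q j)).eq_or_lt with h0 | h0
    · rw [← h0, mul_zero, abs_zero, div_zero, zero_mul]; positivity
    · have h2 : η * (w j).toReal / (q j).toReal ≤ 1 := by
        rw [div_le_one h0]; exact hw j
      rw [abs_of_pos (by positivity)]
      calc _ = 1 / (2 * (q a).toReal * η) * (η * (w j).toReal / (q j).toReal) := by field_simp
        _ ≤ _ := mul_le_of_le_one_right (by positivity) h2
  · rw [if_neg h, abs_zero]; positivity

/-- An exponential moment bound for a bounded random variable. -/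
lemma ev_exp_le_one {Ω : Type*} [Fintype Ω] (p : PMF Ω) (Y : Ω → ℝ) {V lam : ℝ} (hlam : 0 ≤ lam)
    (hV : lam * V ≤ 1) (hY : ∀ x, |Y x| ≤ V) (hY2 : ev p (fun x => Y x ^ 2) ≤ V) :
    ev p (fun x => Real.exp (lam * (Y x - ev p Y) - lam ^ 2 * V)) ≤ 1 := by
  -- The elementary bound `e ^ y ≤ 1 + y + y ^ 2` for `|y| ≤ 1`.
  have h1 : ∀ x, Real.exp (lam * Y x) ≤ 1 + lam * Y x + lam ^ 2 * Y x ^ 2 := by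
    intro x
    have h : |lam * Y x| ≤ 1 := by
      rw [abs_mul, abs_of_nonneg hlam]
      exact (mul_le_mul_of_nonneg_left (hY x) hlam).trans hV
    have := (abs_le.1 (Real.abs_exp_sub_one_sub_id_le h)).2
    nlinarith
  have h2 : ev p (fun x => Real.exp (lam * Y x)) ≤ Real.exp (lam * ev p Y + lam ^ 2 * V) := by
    calc _ ≤ ev p (fun x => 1 + lam * Y x + lam ^ 2 * Y x ^ 2) := ev_mono p h1
      _ = 1 + lam * ev p Y + lam ^ 2 * ev p (fun x => Y x ^ 2) := by
        rw [ev_add, ev_add, ev_const, ev_mul_left, ev_mul_left]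
      _ ≤ (lam * ev p Y + lam ^ 2 * V) + 1 := by nlinarith [sq_nonneg lam]
      _ ≤ _ := Real.add_one_le_exp _
  have h3 : ∀ x, Real.exp (lam * (Y x - ev p Y) - lam ^ 2 * V)
      = Real.exp (lam * Y x) * Real.exp (-(lam * ev p Y + lam ^ 2 * V)) := by
    intro x; rw [← Real.exp_add]; ring_nf
  simp only [h3, ev_mul_right]
  calc _ ≤ Real.exp (lam * ev p Y + lam ^ 2 * V) * Real.exp (-(lam * ev p Y + lam ^ 2 * V)) :=
        mul_le_mul_of_nonneg_right h2 (Real.exp_pos _).le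
    _ = 1 := by rw [← Real.exp_add]; simp

/-! ### Deviation of the estimates for arms that are active. -/

lemma pos_of_pmf (w : PMF (Fin K)) : 0 < K := by
  obtain ⟨a, -⟩ := w.support_nonempty
  exact a.pos

lemma learningRate_pos (hK : 0 < K) {κ : ℝ} (hκ : 0 < κ) (n : ℕ) : 0 < learningRate K κ n := by
  unfold learningRate
  split_ifs with h
  · exact hκ
  · have : (0 : ℝ) < n := by exact_mod_cast Nat.pos_of_ne_zero h
    have : (0 : ℝ) < K := by exact_mod_cast hK
    exact lt_min (by positivity) hκ

lemma learningRate_le (K : ℕ) (κ : ℝ) (n : ℕ) : learningRate K κ n ≤ κ := by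
  unfold learningRate
  split_ifs
  · exact le_rfl
  · exact min_le_right _ _

/-- Arms of the active set are played with probability at least `β / K`. -/
def PlaysActive (w : PMF (Fin K)) (κ β : ℝ) : Prop :=
  ∀ η : ℝ, 0 < η → η ≤ κ → ∀ A : Finset (Fin K), ∀ a ∈ A, β / K ≤ (playLaw w η A a).toReal

/-- The single number `V = K / (β η)` bounds both range and second moment: each estimate is at most
`V / 2` in size with second moment at most `V / 4`, and the square of the difference is at most
twice the sum of the squares. -/
lemma ev_exp_estimate_le_one (P : Environment K) (w : PMF (Fin K)) {κ β η lam : ℝ} (t : ℕ)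
    (hκ1 : κ ≤ 1) (hβ : 0 < β) (hq : PlaysActive w κ β) (hη : 0 < η) (hηκ : η ≤ κ)
    (A : Finset (Fin K)) {a a' : Fin K} (ha : a ∈ A) (ha' : a' ∈ A) (hlam : 0 ≤ lam)
    (hV : lam * (K / (β * η)) ≤ 1) :
    ev (duelLaw P t (playLaw w η A)) (fun x => Real.exp
      (lam * (estimateScore w (playLaw w η A) x.1 x.2.1 x.2.2 a'
        - estimateScore w (playLaw w η A) x.1 x.2.1 x.2.2 a
        - (score P w t a' - score P w t a)) - lam ^ 2 * (K / (β * η)))) ≤ 1 := by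
  set q := playLaw w η A with hqdef
  have hK : (0 : ℝ) < K := by exact_mod_cast pos_of_pmf w
  have hqa : ∀ b ∈ A, β / K ≤ (q b).toReal := hq η hη hηκ A
  have hpos : ∀ b ∈ A, 0 < (q b).toReal := fun b hb => lt_of_lt_of_le (by positivity) (hqa b hb)
  have hw : ∀ j, η * (w j).toReal ≤ (q j).toReal := by
    intro j
    rw [hqdef, playLaw_toReal w hη.le (hηκ.trans hκ1) ⟨a, ha⟩]
    have : 0 ≤ (1 - η) * (if j ∈ A then (A.card : ℝ)⁻¹ else 0) := by
      refine mul_nonneg (by linarith) ?_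
      split_ifs <;> positivity
    linarith
  have hw0 : ∀ j, (q j).toReal = 0 → (w j).toReal = 0 := by
    intro j hj
    have h1 := hw j
    have h2 : 0 ≤ (w j).toReal := ENNReal.toReal_nonneg
    rw [hj] at h1
    by_contra h3
    have : 0 < (w j).toReal := lt_of_le_of_ne h2 (Ne.symm h3)
    nlinarith
  have hinv : ∀ b ∈ A, 1 / (q b).toReal ≤ K / β := by
    intro b hb
    rw [div_le_div_iff₀ (hpos b hb) hβ]
    have := hqa b hb
    rw [div_le_iff₀ hK] at this
    linarith
  set Y : Fin K × Fin K × Bool → ℝ := fun x => estimateScore w q x.1 x.2.1 x.2.2 a'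
        - estimateScore w q x.1 x.2.1 x.2.2 a with hYdef
  have hmean : ev (duelLaw P t q) Y = score P w t a' - score P w t a := by
    rw [hYdef, ev_sub, ev_estimateScore P w q t a' (hpos a' ha') hw0,
      ev_estimateScore P w q t a (hpos a ha) hw0]
  have hb : ∀ b ∈ A, ∀ x : Fin K × Fin K × Bool,
      |estimateScore w q x.1 x.2.1 x.2.2 b| ≤ 1 / 2 * (K / (β * η)) := by
    intro b hb x
    refine (abs_estimateScore_le w q b x.1 x.2.1 x.2.2 hη (hpos b hb) hw).trans ?_
    calc 1 / (2 * (q b).toReal * η) = 1 / (q b).toReal * (1 / (2 * η)) := by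
          have := hpos b hb; field_simp
      _ ≤ K / β * (1 / (2 * η)) := mul_le_mul_of_nonneg_right (hinv b hb) (by positivity)
      _ = _ := by field_simp
  have hs : ∀ b ∈ A, ev (duelLaw P t q) (fun x => estimateScore w q x.1 x.2.1 x.2.2 b ^ 2)
      ≤ 1 / 4 * (K / (β * η)) := by
    intro b hb
    refine (ev_estimateScore_sq_le P w q t b hη (hpos b hb) hw).trans ?_
    calc 1 / (4 * (q b).toReal * η) = 1 / (q b).toReal * (1 / (4 * η)) := by
          have := hpos b hb; field_simp
      _ ≤ K / β * (1 / (4 * η)) := mul_le_mul_of_nonneg_right (hinv b hb) (by positivity)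
      _ = _ := by field_simp
  have key := ev_exp_le_one (duelLaw P t q) Y hlam hV
    (fun x => by
      have h1 := abs_le.1 (hb a ha x)
      have h2 := abs_le.1 (hb a' ha' x)
      rw [hYdef, abs_le]
      constructor <;> simp only <;> linarith [h1.1, h1.2, h2.1, h2.2])
    (by
      calc ev (duelLaw P t q) (fun x => Y x ^ 2)
          ≤ ev (duelLaw P t q) (fun x => 2 * estimateScore w q x.1 x.2.1 x.2.2 a' ^ 2
              + 2 * estimateScore w q x.1 x.2.1 x.2.2 a ^ 2) := by
            refine ev_mono _ fun x => ?_
            rw [hYdef]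
            nlinarith [sq_nonneg (estimateScore w q x.1 x.2.1 x.2.2 a'
              + estimateScore w q x.1 x.2.1 x.2.2 a)]
        _ ≤ _ := by
            rw [ev_add, ev_mul_left, ev_mul_left]
            linarith [hs a ha, hs a' ha'])
  rw [hmean] at key
  exact key

open Classical in
/-- The exponential factor that tracks the deviation of the estimated gap of `a` to `a'` over the
rounds `s₁, …, s₂` in which both arms are active. -/
def deviationFactor (P : Environment K) (c κ β : ℝ) {T : ℕ} (w : PMF (Fin K)) (s₁ s₂ : ℕ)
    (a a' : Fin K) (N : ℕ) (σ : State K) (r : Round K T) : ℝ :=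
  -- All conditions are decided by the state and the schedulers, before the duel. The last one is
  -- `lam * V ≤ 1` for `lam = 1 / N`.
  if s₁ ≤ σ.round ∧ σ.round ≤ s₂ ∧ a ∈ activeSet c σ r.1 ∧ a' ∈ activeSet c σ r.1
      ∧ K / (β * currentRate κ σ r.1) ≤ N then
    Real.exp ((N : ℝ)⁻¹ * (estimateScore w (playLaw w (currentRate κ σ r.1) (activeSet c σ r.1))
        r.2.1 r.2.2.1 r.2.2.2 a'
      - estimateScore w (playLaw w (currentRate κ σ r.1) (activeSet c σ r.1))
        r.2.1 r.2.2.1 r.2.2.2 a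
      - (score P w σ.round a' - score P w σ.round a))
      - (N : ℝ)⁻¹ ^ 2 * (K / (β * currentRate κ σ r.1)))
  else 1

lemma deviationFactor_nonneg (P : Environment K) (c κ β : ℝ) {T : ℕ} (w : PMF (Fin K)) (s₁ s₂ : ℕ)
    (a a' : Fin K) (N : ℕ) (σ : State K) (r : Round K T) :
    0 ≤ deviationFactor P c κ β w s₁ s₂ a a' N σ r := by
  unfold deviationFactor
  split_ifs
  · exact (Real.exp_pos _).le
  · exact zero_le_one

lemma ev_roundLaw_eq_duelLaw (P : Environment K) (c κ : ℝ) (T : ℕ) (w : PMF (Fin K)) (σ : State K)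
    (f : Round K T → ℝ) :
    ev (roundLaw P c κ T w σ) f = ev (scheduleLaw T σ) fun B =>
      ev (duelLaw P σ.round (playLaw w (currentRate κ σ B) (activeSet c σ B))) fun x =>
        f (B, x) := by
  simp only [ev_roundLaw, ev_duelLaw]

lemma ev_deviationFactor_le_one (P : Environment K) (c : ℝ) {κ β : ℝ} {T : ℕ} (w : PMF (Fin K))
    (hκ : 0 < κ) (hκ1 : κ ≤ 1) (hβ : 0 < β) (hq : PlaysActive w κ β) (s₁ s₂ : ℕ)
    (a a' : Fin K) (N : ℕ) (σ : State K) :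
    ev (roundLaw P c κ T w σ) (deviationFactor P c κ β w s₁ s₂ a a' N σ) ≤ 1 := by
  rw [ev_roundLaw_eq_duelLaw, ← ev_const (scheduleLaw T σ) 1]
  refine ev_mono _ fun B => ?_
  unfold deviationFactor
  dsimp only
  by_cases h : s₁ ≤ σ.round ∧ σ.round ≤ s₂ ∧ a ∈ activeSet c σ B ∧ a' ∈ activeSet c σ B
      ∧ K / (β * currentRate κ σ B) ≤ N
  · refine (congrArg (ev _) (funext fun x => if_pos h)).trans_le ?_
    obtain ⟨-, -, h1, h2, h3⟩ := h
    refine ev_exp_estimate_le_one P w σ.round hκ1 hβ hq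
      (learningRate_pos (pos_of_pmf w) hκ _) (learningRate_le K κ _) _ h1 h2 (by positivity) ?_
    rw [inv_mul_eq_div]
    exact div_le_one_of_le₀ h3 (by positivity)
  · exact ((congrArg (ev _) (funext fun x => if_neg h)).trans (ev_const _ _)).le

/-! ### Gaps and the conditional regret -/

lemma abs_score_le (P : Environment K) (w : PMF (Fin K)) (t : ℕ) (a : Fin K) :
    |score P w t a| ≤ 1 / 2 := by
  unfold score
  calc _ ≤ ∑ a', |(P.pref t a a' - 1 / 2) * (w a').toReal| := Finset.abs_sum_le_sum_abs _ _
    _ ≤ ∑ a', 1 / 2 * (w a').toReal := by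
        refine Finset.sum_le_sum fun a' _ => ?_
        rw [abs_mul, abs_of_nonneg (ENNReal.toReal_nonneg (a := w a'))]
        refine mul_le_mul_of_nonneg_right ?_ ENNReal.toReal_nonneg
        rw [abs_le]
        constructor <;> linarith [P.pref_nonneg t a a', pref_le_one P t a a']
    _ = 1 / 2 := by rw [← Finset.mul_sum, sum_toReal_pmf, mul_one]

lemma score_sub_le_gap (P : Environment K) (w : PMF (Fin K)) (t : ℕ) (a a' : Fin K) :
    score P w t a' - score P w t a ≤ gap P w t a :=
  le_ciSup (f := fun a' => score P w t a' - score P w t a) (Set.finite_range _).bddAbove a'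

lemma gap_nonneg (P : Environment K) (w : PMF (Fin K)) (t : ℕ) (a : Fin K) : 0 ≤ gap P w t a := by
  simpa using score_sub_le_gap P w t a a

lemma gap_eq (P : Environment K) (w : PMF (Fin K)) (t : ℕ) (a : Fin K) :
    gap P w t a = (⨆ a', score P w t a') - score P w t a := by
  have : Nonempty (Fin K) := ⟨a⟩
  unfold gap
  rw [ciSup_sub (Set.finite_range _).bddAbove]

lemma gap_le_one (P : Environment K) (w : PMF (Fin K)) (t : ℕ) (a : Fin K) : gap P w t a ≤ 1 := by
  have : Nonempty (Fin K) := ⟨a⟩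
  refine ciSup_le fun a' => ?_
  linarith [abs_le.1 (abs_score_le P w t a), abs_le.1 (abs_score_le P w t a')]

lemma gap_sub_gap (P : Environment K) (w : PMF (Fin K)) (t : ℕ) (a a' : Fin K) :
    gap P w t a - gap P w t a' = score P w t a' - score P w t a := by
  rw [gap_eq, gap_eq]; ring

/-- The expected regret of a round given the past and the schedulers. -/
def meanGap (P : Environment K) (c κ : ℝ) {T : ℕ} (w : PMF (Fin K)) (σ : State K)
    (r : Round K T) : ℝ :=
  ev (playLaw w (currentRate κ σ r.1) (activeSet c σ r.1)) (gap P w σ.round)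

lemma meanGap_le_one (P : Environment K) (c κ : ℝ) {T : ℕ} (w : PMF (Fin K)) (σ : State K)
    (r : Round K T) : meanGap P c κ w σ r ≤ 1 := by
  refine (ev_mono _ fun a => gap_le_one P w _ a).trans (ev_const _ _).le

/-- Both arms of the duel are drawn from the same law, so each half contributes the same mean gap.
-/
lemma ev_roundRegret (P : Environment K) (c κ : ℝ) (T : ℕ) (w : PMF (Fin K)) (σ : State K) :
    ev (roundLaw P c κ T w σ) (fun r => (1 / 2 : ℝ) * (2 * (⨆ a, score P w σ.round a)
      - score P w σ.round r.2.1 - score P w σ.round r.2.2.1)) =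
    ev (roundLaw P c κ T w σ) (meanGap P c κ w σ) := by
  rw [ev_roundLaw, ev_roundLaw]
  congr 1
  funext B
  have h : ∀ i j, (1 / 2 : ℝ) * (2 * (⨆ a, score P w σ.round a)
      - score P w σ.round i - score P w σ.round j)
      = 1 / 2 * gap P w σ.round i + 1 / 2 * gap P w σ.round j := by
    intro i j
    rw [gap_eq, gap_eq]; ring
  simp only [h, ev_const, ev_add, ev_mul_left, meanGap]
  ring

lemma run_round (c κ : ℝ) (T : ℕ) (w : PMF (Fin K)) (H : ℕ → Round K T) (n : ℕ) :
    (run c κ T w H n).round = n + 1 := by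
  induction n with
  | zero => rfl
  | succ n ih =>
    rw [run, nextState]
    split_ifs <;> simp [ih]

/-- This removes the played arms: only the active sets and rates remain, so the regret becomes a
function of the log. The round `r₀` is mere padding beyond the history. -/
lemma expectedRegret_eq (P : Environment K) (c κ : ℝ) (T : ℕ) (w : PMF (Fin K))
    (r₀ : Round K T) :
    expectedRegret P c κ T w = ev (historyLaw P c κ T w T) fun h => ∑ k ∈ Finset.range T,
      meanGap P c κ w (run c κ T w (extend r₀ h) k) (extend r₀ h k) := by
  rw [← ev_sum_eq P c κ T w r₀ (fun σ r => (1 / 2 : ℝ) * (2 * (⨆ a, score P w σ.round a)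
      - score P w σ.round r.2.1 - score P w σ.round r.2.2.1)) (meanGap P c κ w)
      (ev_roundRegret P c κ T w) T]
  rw [expectedRegret, ev]
  refine Finset.sum_congr rfl fun h _ => ?_
  congr 1
  rw [regret, ← Fin.sum_univ_eq_sum_range (fun k => (1 / 2 : ℝ) *
    (2 * (⨆ a, score P w (run c κ T w (extend r₀ h) k).round a)
      - score P w (run c κ T w (extend r₀ h) k).round (extend r₀ h k).2.1
      - score P w (run c κ T w (extend r₀ h) k).round (extend r₀ h k).2.2.1)) T]
  refine Finset.sum_congr rfl fun k _ => ?_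
  simp only [run_round, extend, k.isLt, dif_pos]

/-! ### The trace of a run -/

/-- The deterministic relations between the log of a run, the first round `ep t` of the episode and
the first round `cs t` of the base algorithm that is active at round `t`, and the duration `dur t`
of the replay launched at round `t` (zero if there is none). -/
structure IsTrace (c κ : ℝ) (T : ℕ) (log : ℕ → RoundLog K) (ep cs dur : ℕ → ℕ) : Prop where
  ep_one : ep 1 = 1
  ep_succ : ∀ t, 1 ≤ t → (ep (t + 1) = ep t ∧ (retained c T log (ep t) (t + 1)).Nonempty) ∨
    (ep (t + 1) = t + 1 ∧ retained c T log (ep t) (t + 1) = ∅)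
  cs_le : ∀ t, 1 ≤ t → cs t ≤ t
  le_cs : ∀ t, 1 ≤ t → ep t ≤ cs t
  cs_alive : ∀ t, 1 ≤ t → cs t = ep t ∨ (t ≤ cs t + dur (cs t) ∧ 0 < dur (cs t))
  cs_max : ∀ t, 1 ≤ t → ∀ u, ep t ≤ u → u ≤ t → 0 < dur u → t ≤ u + dur u → u ≤ cs t
  active_eq : ∀ t, 1 ≤ t → (log t).active = retained c T log (cs t) t
  rate_eq : ∀ t, 1 ≤ t → (log t).rate = learningRate K κ (t - cs t)

/-- The test reads the log only inside `[s₁, s₂]`; this lets the completed log of a run replace the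
partial logs of its states. -/
lemma evicts_congr (c : ℝ) (T : ℕ) {log log' : ℕ → RoundLog K} {s₁ s₂ : ℕ}
    (h : ∀ s, s₁ ≤ s → s ≤ s₂ → log s = log' s) (a : Fin K) :
    Evicts c T log a s₁ s₂ ↔ Evicts c T log' a s₁ s₂ := by
  have h1 : ∀ s ∈ Finset.Icc s₁ s₂, log s = log' s := fun s hs =>
    h s (Finset.mem_Icc.1 hs).1 (Finset.mem_Icc.1 hs).2
  have h2 : threshold log s₁ s₂ = threshold log' s₁ s₂ := by
    unfold threshold
    rw [Finset.sum_congr rfl fun s hs => by rw [h1 s hs]]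
    have : (fun s : Set.Icc s₁ s₂ => (log s).rate⁻¹) = fun s : Set.Icc s₁ s₂ => (log' s).rate⁻¹ := by
      funext s
      rw [h s s.2.1 s.2.2]
    rw [this]
  unfold Evicts
  refine exists_congr fun a' => ?_
  rw [h2, Finset.sum_congr rfl fun s hs => by rw [h1 s hs]]
  refine and_congr_left fun _ => forall₂_congr fun s hs => ?_
  rw [h1 s hs]

lemma retained_congr (c : ℝ) (T : ℕ) {log log' : ℕ → RoundLog K} {start t : ℕ}
    (h : ∀ s, start ≤ s → s < t → log s = log' s) :
    retained c T log start t = retained c T log' start t := by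
  ext a
  simp only [retained, Finset.mem_filter, Finset.mem_univ, true_and]
  refine forall_congr' fun s₁ => forall_congr' fun s₂ => forall_congr' fun h1 =>
    forall_congr' fun _ => forall_congr' fun h3 => ?_
  rw [evicts_congr c T (fun s hs hs' => h s (h1.trans hs) (hs'.trans_lt h3))]

lemma mem_retained {c : ℝ} {T : ℕ} {log : ℕ → RoundLog K} {start t : ℕ} {a : Fin K} :
    a ∈ retained c T log start t ↔
      ∀ s₁ s₂ : ℕ, start ≤ s₁ → s₁ < s₂ → s₂ < t → ¬ Evicts c T log a s₁ s₂ := by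
  simp [retained]

lemma retained_subset (c : ℝ) (T : ℕ) (log : ℕ → RoundLog K) {start start' t t' : ℕ}
    (hs : start ≤ start') (ht : t' ≤ t) : retained c T log start t ⊆ retained c T log start' t' := by
  intro a ha
  rw [mem_retained] at ha ⊢
  exact fun s₁ s₂ h1 h2 h3 => ha s₁ s₂ (hs.trans h1) h2 (h3.trans_le ht)

section Trace

variable (c κ : ℝ) {T : ℕ} (w : PMF (Fin K)) (H : ℕ → Round K T)

/-- The log of a run: its entry at round `t`, once that round has elapsed. -/
def runLog (t : ℕ) : RoundLog K := (run c κ T w H t).log t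

/-- The first round of the episode of round `t`. -/
def runEp (t : ℕ) : ℕ := (run c κ T w H (t - 1)).epStart

/-- The first round of the base algorithm active at round `t`. -/
def runCs (t : ℕ) : ℕ := currentStart (run c κ T w H (t - 1)) (H (t - 1)).1

/-- The duration of the replay launched at round `t`, zero if there is none. -/
def runDur (t : ℕ) : ℕ := (Finset.univ.filter fun e => (H (t - 1)).1 e = true).sup duration

lemma run_log_update (n : ℕ) : (run c κ T w H (n + 1)).log =
    Function.update (run c κ T w H n).log (n + 1)
      ⟨activeSet c (run c κ T w H n) (H n).1, currentRate κ (run c κ T w H n) (H n).1,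
        estimateScore w (playLaw w (currentRate κ (run c κ T w H n) (H n).1)
          (activeSet c (run c κ T w H n) (H n).1)) (H n).2.1 (H n).2.2.1 (H n).2.2.2⟩ := by
  rw [run, nextState]
  split_ifs <;> simp [run_round]

lemma run_log_eq {s n : ℕ} (h : s ≤ n) : (run c κ T w H n).log s = runLog c κ w H s := by
  induction n, h using Nat.le_induction with
  | base => rfl
  | succ n hn ih =>
    rw [run_log_update, Function.update_of_ne (by omega), ih]

lemma runLog_succ (n : ℕ) : runLog c κ w H (n + 1) =
      ⟨activeSet c (run c κ T w H n) (H n).1, currentRate κ (run c κ T w H n) (H n).1,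
        estimateScore w (playLaw w (currentRate κ (run c κ T w H n) (H n).1)
          (activeSet c (run c κ T w H n) (H n).1)) (H n).2.1 (H n).2.2.1 (H n).2.2.2⟩ := by
  rw [runLog, run_log_update, Function.update_self]

lemma runDur_pos_iff (n : ℕ) : 0 < runDur H (n + 1) ↔ ∃ e, (H n).1 e = true := by
  unfold runDur
  rw [Nat.add_sub_cancel, Finset.lt_sup_iff]
  simp only [Finset.mem_filter, Finset.mem_univ, true_and]
  refine exists_congr fun e => and_iff_left ?_
  unfold duration
  positivity

lemma run_succ_eq (n : ℕ) : run c κ T w H (n + 1) =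
    if retained c T (runLog c κ w H) (run c κ T w H n).epStart (n + 2) = ∅ then
      ⟨n + 2, n + 2, [], (run c κ T w H (n + 1)).log⟩
    else ⟨n + 2, (run c κ T w H n).epStart, launched (run c κ T w H n) (H n).1,
      (run c κ T w H (n + 1)).log⟩ := by
  have h : retained c T (runLog c κ w H) (run c κ T w H n).epStart (n + 2) =
      retained c T (run c κ T w H (n + 1)).log (run c κ T w H n).epStart (n + 2) :=
    retained_congr c T fun s _ hs => (run_log_eq c κ w H (by omega)).symm
  rw [h, run_log_update]
  conv_lhs => rw [run, nextState]
  simp only [run_round]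

lemma run_epStart_le (n : ℕ) : (run c κ T w H n).epStart ≤ n + 1 := by
  induction n with
  | zero => exact le_rfl
  | succ n ih =>
    rw [run_succ_eq]
    split_ifs
    · exact le_rfl
    · exact ih.trans (by omega)

/-- A list of replays that starts with the latest and consists of all those launched in the rounds
`t₀, …, t`. -/
def IsReplayList (dur : ℕ → ℕ) (t₀ t : ℕ) (L : List (ℕ × ℕ)) : Prop :=
  (∀ b ∈ L, t₀ ≤ b.1 ∧ b.1 ≤ t ∧ b.2 = dur b.1 ∧ 0 < dur b.1) ∧
  (∀ u, t₀ ≤ u → u ≤ t → 0 < dur u → (u, dur u) ∈ L) ∧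
  L.Pairwise fun b b' => b'.1 < b.1

lemma isReplayList_launched_of {n : ℕ}
    (h : IsReplayList (runDur H) (run c κ T w H n).epStart n (run c κ T w H n).replays) :
    IsReplayList (runDur H) (run c κ T w H n).epStart (n + 1)
      (launched (run c κ T w H n) (H n).1) := by
  have hle := run_epStart_le c κ w H n
  obtain ⟨h1, h2, h3⟩ := h
  have hd := runDur_pos_iff H n
  unfold launched
  split_ifs with hB
  · refine ⟨?_, ?_, ?_⟩
    · intro b hb
      rcases List.mem_cons.1 hb with rfl | hb
      · rw [run_round]
        exact ⟨hle, le_rfl, rfl, hd.2 hB⟩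
      · obtain ⟨x1, x2, x3, x4⟩ := h1 b hb
        exact ⟨x1, by omega, x3, x4⟩
    · intro u hu1 hu2 hu3
      rcases Nat.lt_or_ge n u with h | h
      · obtain rfl : u = n + 1 := by omega
        rw [run_round]
        exact List.mem_cons_self
      · exact List.mem_cons_of_mem _ (h2 u hu1 h hu3)
    · refine List.pairwise_cons.2 ⟨fun b hb => ?_, h3⟩
      rw [run_round]
      have := (h1 b hb).2.1
      simp only
      omega
  · refine ⟨fun b hb => ?_, fun u hu1 hu2 hu3 => ?_, h3⟩
    · obtain ⟨x1, x2, x3, x4⟩ := h1 b hb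
      exact ⟨x1, by omega, x3, x4⟩
    · rcases Nat.lt_or_ge n u with h | h
      · obtain rfl : u = n + 1 := by omega
        exact absurd (hd.1 hu3) hB
      · exact h2 u hu1 h hu3

lemma isReplayList_run (n : ℕ) :
    IsReplayList (runDur H) (run c κ T w H n).epStart n (run c κ T w H n).replays := by
  induction n with
  | zero =>
    refine ⟨?_, ?_, ?_⟩
    · simp [run, initState]
    · simp only [run, initState]
      intro u h1 h2
      omega
    · simp [run, initState]
  | succ n ih =>
    rw [run_succ_eq]
    split_ifs
    · refine ⟨by simp, ?_, by simp⟩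
      intro u h1 h2
      simp only at h1
      omega
    · exact isReplayList_launched_of c κ w H ih

lemma isReplayList_launched (n : ℕ) :
    IsReplayList (runDur H) (run c κ T w H n).epStart (n + 1)
      (launched (run c κ T w H n) (H n).1) :=
  isReplayList_launched_of c κ w H (isReplayList_run c κ w H n)

/-- The list has the latest replay first, so the first unfinished entry found is also the unfinished
one with the latest start. -/
lemma currentStart_cases (n : ℕ) :
    (∃ m, (currentStart (run c κ T w H n) (H n).1, m) ∈ launched (run c κ T w H n) (H n).1 ∧
      n + 1 ≤ currentStart (run c κ T w H n) (H n).1 + m ∧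
      ∀ b ∈ launched (run c κ T w H n) (H n).1, n + 1 ≤ b.1 + b.2 →
        b.1 ≤ currentStart (run c κ T w H n) (H n).1) ∨
    (currentStart (run c κ T w H n) (H n).1 = (run c κ T w H n).epStart ∧
      ∀ b ∈ launched (run c κ T w H n) (H n).1, ¬ n + 1 ≤ b.1 + b.2) := by
  unfold currentStart
  rw [run_round]
  obtain ⟨-, -, h3⟩ := isReplayList_launched c κ w H n
  cases hf : (launched (run c κ T w H n) (H n).1).find? fun b => decide (n + 1 ≤ b.1 + b.2) with
  | none =>
    right
    refine ⟨rfl, fun b hb => ?_⟩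
    have := List.find?_eq_none.1 hf b hb
    simpa using this
  | some b =>
    left
    obtain ⟨hb, as, bs, hl, has⟩ := List.find?_eq_some_iff_append.1 hf
    refine ⟨b.2, ?_, by simpa using hb, ?_⟩
    · rw [hl]; simp
    · intro b' hb' hal
      simp only [Option.map_some, Option.getD_some]
      rw [hl] at hb' h3
      rcases List.mem_append.1 hb' with h | h
      · have := has b' h
        simp at this
        omega
      · rcases List.mem_cons.1 h with rfl | h
        · exact le_rfl
        · have := (List.pairwise_append.1 h3).2.1
          exact ((List.pairwise_cons.1 this).1 b' h).le

/-- Bridge from the state machine to the deterministic analysis, which uses nothing about replay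
lists beyond these relations. -/
lemma isTrace_run :
    IsTrace c κ T (runLog c κ w H) (runEp c κ w H) (runCs c κ w H) (runDur H) := by
  have hcs : ∀ n, runCs c κ w H (n + 1) = currentStart (run c κ T w H n) (H n).1 := fun n => rfl
  have hep : ∀ n, runEp c κ w H (n + 1) = (run c κ T w H n).epStart := fun n => rfl
  refine ⟨rfl, ?_, ?_, ?_, ?_, ?_, ?_, ?_⟩
  · intro t ht
    obtain ⟨n, rfl⟩ := Nat.exists_eq_add_of_le' ht
    rw [hep, hep, run_succ_eq]
    split_ifs with h
    · exact Or.inr ⟨rfl, h⟩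
    · exact Or.inl ⟨rfl, Finset.nonempty_iff_ne_empty.2 h⟩
  · intro t ht
    obtain ⟨n, rfl⟩ := Nat.exists_eq_add_of_le' ht
    rw [hcs]
    rcases currentStart_cases c κ w H n with ⟨m, h1, -⟩ | ⟨h1, -⟩
    · exact ((isReplayList_launched c κ w H n).1 _ h1).2.1
    · rw [h1]; exact run_epStart_le c κ w H n
  · intro t ht
    obtain ⟨n, rfl⟩ := Nat.exists_eq_add_of_le' ht
    rw [hcs, hep]
    rcases currentStart_cases c κ w H n with ⟨m, h1, -⟩ | ⟨h1, -⟩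
    · exact ((isReplayList_launched c κ w H n).1 _ h1).1
    · rw [h1]
  · intro t ht
    obtain ⟨n, rfl⟩ := Nat.exists_eq_add_of_le' ht
    rw [hcs, hep]
    rcases currentStart_cases c κ w H n with ⟨m, h1, h2, -⟩ | ⟨h1, -⟩
    · right
      obtain ⟨-, -, h3, h4⟩ := (isReplayList_launched c κ w H n).1 _ h1
      simp only at h3 h4
      exact ⟨h3 ▸ h2, h4⟩
    · exact Or.inl h1
  · intro t ht u hu1 hu2 hu3 hu4
    obtain ⟨n, rfl⟩ := Nat.exists_eq_add_of_le' ht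
    have hm := (isReplayList_launched c κ w H n).2.1 u hu1 hu2 hu3
    rw [hcs]
    rcases currentStart_cases c κ w H n with ⟨m, -, -, h3⟩ | ⟨-, h1⟩
    · exact h3 _ hm hu4
    · exact absurd hu4 (h1 _ hm)
  · intro t ht
    obtain ⟨n, rfl⟩ := Nat.exists_eq_add_of_le' ht
    rw [runLog_succ, hcs]
    simp only [activeSet, run_round]
    exact retained_congr c T fun s _ hs => run_log_eq c κ w H (by omega)
  · intro t ht
    obtain ⟨n, rfl⟩ := Nat.exists_eq_add_of_le' ht
    rw [runLog_succ, hcs]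
    simp only [currentRate, run_round]

end Trace

/-! ### Consequences of bounds on the exponential factors -/

lemma prod_range_ite_exp (g : ℕ → ℝ) {s₁ s₂ T : ℕ} (h1 : 1 ≤ s₁) (h2 : s₂ ≤ T) :
    ∏ k ∈ Finset.range T, (if s₁ ≤ k + 1 ∧ k + 1 ≤ s₂ then Real.exp (g (k + 1)) else 1) =
      Real.exp (∑ s ∈ Finset.Icc s₁ s₂, g s) := by
  rw [← Finset.prod_filter, ← Real.exp_sum]
  congr 1
  refine Finset.sum_bij (fun k _ => k + 1) ?_ ?_ ?_ ?_
  · intro k hk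
    simp only [Finset.mem_filter, Finset.mem_range] at hk
    exact Finset.mem_Icc.2 hk.2
  · intro a _ b _ h
    omega
  · intro b hb
    rw [Finset.mem_Icc] at hb
    exact ⟨b - 1, by simp only [Finset.mem_filter, Finset.mem_range]; omega, by omega⟩
  · intro k _
    rfl

/-- Estimated aggregate gaps between active arms concentrate around the true ones. -/
def Concentrates (P : Environment K) (w : PMF (Fin K)) (c₁ : ℝ) (T : ℕ) (log : ℕ → RoundLog K) :
    Prop :=
  ∀ s₁ s₂ : ℕ, 1 ≤ s₁ → s₁ < s₂ → s₂ ≤ T → ∀ a a' : Fin K,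
    (∀ s ∈ Finset.Icc s₁ s₂, a ∈ (log s).active ∧ a' ∈ (log s).active) →
    ∑ s ∈ Finset.Icc s₁ s₂, ((log s).estimate a' - (log s).estimate a)
      - ∑ s ∈ Finset.Icc s₁ s₂, (score P w s a' - score P w s a)
      ≤ c₁ * Real.log T * threshold log s₁ s₂

lemma le_ciSup_Icc (f : ℕ → ℝ) {s₁ s₂ s : ℕ} (hs : s ∈ Finset.Icc s₁ s₂) :
    f s ≤ ⨆ s : Set.Icc s₁ s₂, f s :=
  le_ciSup (f := fun s : Set.Icc s₁ s₂ => f s) (Set.finite_range _).bddAbove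
    ⟨s, Finset.mem_Icc.1 hs⟩

lemma ciSup_Icc_le (f : ℕ → ℝ) {s₁ s₂ : ℕ} (h : s₁ ≤ s₂) {b : ℝ}
    (hf : ∀ s, s₁ ≤ s → s ≤ s₂ → f s ≤ b) : ⨆ s : Set.Icc s₁ s₂, f s ≤ b := by
  have : Nonempty (Set.Icc s₁ s₂) := ⟨⟨s₁, le_rfl, h⟩⟩
  exact ciSup_le fun s => hf s s.2.1 s.2.2

lemma half_le_log {T : ℕ} (hT : 2 ≤ T) : 1 / 2 ≤ Real.log T := by
  have h1 : Real.log 2 ≤ Real.log T := Real.log_le_log (by norm_num) (by exact_mod_cast hT)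
  linarith [Real.log_two_gt_d9]

/-- A crude bound, needed only to keep the number of deviation indices polynomial in `T`. -/
lemma inv_learningRate_le {κ : ℝ} (hκ : 0 < κ) (hκ1 : κ ≤ 1) (hK : 0 < K) {T n : ℕ} (hT : 1 ≤ T)
    (hn : n ≤ T) : (learningRate K κ n)⁻¹ ≤ T / κ := by
  have hT' : (1 : ℝ) ≤ T := by exact_mod_cast hT
  have hK' : (1 : ℝ) ≤ K := by exact_mod_cast hK
  rw [inv_le_comm₀ (learningRate_pos hK hκ n) (by positivity), inv_div]
  unfold learningRate
  split_ifs with h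
  · exact div_le_self hκ.le hT'
  · refine le_min ?_ (div_le_self hκ.le hT')
    have hn1 : (1 : ℝ) ≤ n := by exact_mod_cast Nat.one_le_iff_ne_zero.2 h
    have h1 : (1 : ℝ) ≤ (K : ℝ) ^ (1 / 3 : ℝ) := Real.one_le_rpow hK' (by norm_num)
    have h2 : (n : ℝ) ^ (-1 : ℝ) ≤ (n : ℝ) ^ (-(1 / 3) : ℝ) :=
      Real.rpow_le_rpow_of_exponent_le hn1 (by norm_num)
    rw [Real.rpow_neg_one] at h2
    calc κ / T ≤ 1 / T := by gcongr
      _ ≤ 1 / n := by gcongr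
      _ ≤ (n : ℝ) ^ (-(1 / 3) : ℝ) := by rw [one_div]; exact h2
      _ ≤ _ := le_mul_of_one_le_left (by positivity) h1

/-- The largest index needed for the deviation factors. -/
def maxDeviation (κ β : ℝ) (T : ℕ) : ℕ := ⌈3 * (T : ℝ) ^ 3 / (κ * β)⌉₊

section Good

variable (P : Environment K) {c κ β : ℝ} {T : ℕ} (w : PMF (Fin K)) (H : ℕ → Round K T)

/-- The best `lam` is about `β / M₀`, where `M₀` is the second term of the threshold. It depends on
the run through the learning rates, so the factors are prepared for every integer `N = 1 / lam` in a
deterministic range and the right one is selected afterwards. -/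
lemma concentrates_of_prod_lt (hκ : 0 < κ) (hκ1 : κ ≤ 1) (hβ : 0 < β) (hβ1 : β ≤ 1)
    (hT : 2 ≤ T) (hKT : K ≤ T)
    (h : ∀ s₁ s₂ a a', ∀ N ≤ maxDeviation κ β T, s₁ ≤ T → s₂ ≤ T → ∏ k ∈ Finset.range T,
      deviationFactor P c κ β w s₁ s₂ a a' N (run c κ T w H k) (H k) < (T : ℝ) ^ 8) :
    Concentrates P w (18 / β) T (runLog c κ w H) := by
  intro s₁ s₂ h1 h12 h2 a a' hact
  have hK0 := pos_of_pmf w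
  have hK : (1 : ℝ) ≤ K := by exact_mod_cast hK0
  have hTr : (2 : ℝ) ≤ T := by exact_mod_cast hT
  have hKTr : (K : ℝ) ≤ T := by exact_mod_cast hKT
  set log := runLog c κ w H with hlog
  have htr := isTrace_run c κ w H
  have hrate : ∀ s ∈ Finset.Icc s₁ s₂, 0 < (log s).rate ∧ (log s).rate ≤ 1 ∧
      (log s).rate⁻¹ ≤ T / κ := by
    intro s hs
    rw [Finset.mem_Icc] at hs
    rw [htr.rate_eq s (by omega)]
    exact ⟨learningRate_pos hK0 hκ _, (learningRate_le K κ _).trans hκ1,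
      inv_learningRate_le hκ hκ1 hK0 (by omega) (by omega)⟩
  set S := ∑ s ∈ Finset.Icc s₁ s₂, (log s).rate⁻¹ with hS
  set U := ⨆ s : Set.Icc s₁ s₂, (log s).rate⁻¹ with hU
  have hUs : ∀ s ∈ Finset.Icc s₁ s₂, (log s).rate⁻¹ ≤ U := fun s hs =>
    le_ciSup_Icc (fun s => (log s).rate⁻¹) hs
  have hU1 : 1 ≤ U := by
    have hm : s₁ ∈ Finset.Icc s₁ s₂ := Finset.mem_Icc.2 ⟨le_rfl, h12.le⟩
    exact ((one_le_inv₀ (hrate s₁ hm).1).2 (hrate s₁ hm).2.1).trans (hUs s₁ hm)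
  have hUT : U ≤ T / κ := ciSup_Icc_le (fun s => (log s).rate⁻¹) h12.le fun s hs hs' =>
    (hrate s (Finset.mem_Icc.2 ⟨hs, hs'⟩)).2.2
  have hS0 : 0 ≤ S := Finset.sum_nonneg fun s hs => (inv_pos.2 (hrate s hs).1).le
  have hST : S ≤ T * (T / κ) := by
    calc S ≤ ∑ s ∈ Finset.Icc s₁ s₂, (T : ℝ) / κ := Finset.sum_le_sum fun s hs => (hrate s hs).2.2
      _ = ((s₂ + 1 - s₁ : ℕ) : ℝ) * (T / κ) := by simp
      _ ≤ T * (T / κ) := by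
        have : ((s₂ + 1 - s₁ : ℕ) : ℝ) ≤ T := by exact_mod_cast (by omega)
        gcongr
  set M₀ := Real.sqrt (K * S) + K * U with hM₀
  have hsq0 := Real.sqrt_nonneg (K * S)
  have hsq := Real.sq_sqrt (mul_nonneg (zero_le_one.trans hK) hS0)
  have hKU : 1 ≤ K * U := by nlinarith
  have hM₀1 : 1 ≤ M₀ := by linarith
  have hM₀F : M₀ ≤ threshold log s₁ s₂ := le_max_right _ _
  have hM1 : 1 ≤ M₀ / β := by rw [le_div_iff₀ hβ]; linarith
  have hT3 : M₀ ≤ 2 * T ^ 3 / κ := by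
    have e1 : Real.sqrt (K * S) ≤ T ^ 3 / κ := by
      have hx : K * S ≤ T ^ 3 / κ := by
        calc K * S ≤ T * (T * (T / κ)) := by gcongr
          _ = _ := by ring
      have hx1 : (1 : ℝ) ≤ T ^ 3 / κ := by
        rw [le_div_iff₀ hκ]
        have : (1 : ℝ) ≤ T ^ 3 := one_le_pow₀ (by linarith)
        linarith
      refine Real.sqrt_le_iff.2 ⟨by linarith, by nlinarith⟩
    have e2 : K * U ≤ T ^ 3 / κ := by
      calc K * U ≤ T * (T / κ) := by gcongr
        _ = T ^ 2 / κ := by ring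
        _ ≤ T ^ 3 / κ := by gcongr <;> linarith
    calc M₀ ≤ T ^ 3 / κ + T ^ 3 / κ := by rw [hM₀]; linarith
      _ = _ := by ring
  -- The maximum in `M₀` makes each increment satisfy `lam * V ≤ 1`; the square root in `M₀` makes
  -- the summed variances at most `M₀ ^ 2 / β`.
  set N := ⌈M₀ / β⌉₊ with hN
  have hN1 : M₀ / β ≤ N := Nat.le_ceil _
  have hN2 : (N : ℝ) ≤ 2 * (M₀ / β) := by
    have := Nat.ceil_lt_add_one (zero_le_one.trans hM1)
    linarith
  have hNpos : (0 : ℝ) < N := by linarith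
  have hNmax : N ≤ maxDeviation κ β T := by
    refine Nat.ceil_mono ?_
    calc M₀ / β ≤ (2 * T ^ 3 / κ) / β := by gcongr
      _ = 2 * T ^ 3 / (κ * β) := by rw [div_div]
      _ ≤ _ := by gcongr; norm_num
  set g : ℕ → ℝ := fun s => (N : ℝ)⁻¹ * ((log s).estimate a' - (log s).estimate a
    - (score P w s a' - score P w s a)) - (N : ℝ)⁻¹ ^ 2 * (K / (β * (log s).rate)) with hg
  have hV : ∀ s ∈ Finset.Icc s₁ s₂, K / (β * (log s).rate) ≤ N := by
    intro s hs
    refine le_trans ?_ hN1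
    calc K / (β * (log s).rate) = K * (log s).rate⁻¹ / β := by
          rw [← div_div, div_right_comm, div_eq_mul_inv (K : ℝ)]
      _ ≤ K * U / β := by
          have := hUs s hs
          gcongr
      _ ≤ M₀ / β := by gcongr; linarith
  have hprod : ∏ k ∈ Finset.range T,
      deviationFactor P c κ β w s₁ s₂ a a' N (run c κ T w H k) (H k) =
      Real.exp (∑ s ∈ Finset.Icc s₁ s₂, g s) := by
    rw [← prod_range_ite_exp g h1 h2]
    refine Finset.prod_congr rfl fun k _ => ?_
    unfold deviationFactor
    rw [run_round]
    by_cases hk : s₁ ≤ k + 1 ∧ k + 1 ≤ s₂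
    · have hk' := Finset.mem_Icc.2 hk
      have e1 := hact _ hk'
      have e2 := hV _ hk'
      rw [hlog, runLog_succ] at e1 e2
      rw [if_pos ⟨hk.1, hk.2, e1.1, e1.2, e2⟩, if_pos hk, hg]
      simp only [hlog, runLog_succ]
    · rw [if_neg (fun hh => hk ⟨hh.1, hh.2.1⟩), if_neg hk]
  have hlt := h s₁ s₂ a a' N hNmax (by omega) h2
  rw [hprod, ← Real.lt_log_iff_exp_lt (by positivity), Real.log_pow] at hlt
  push_cast at hlt
  set D := ∑ s ∈ Finset.Icc s₁ s₂, ((log s).estimate a' - (log s).estimate a)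
      - ∑ s ∈ Finset.Icc s₁ s₂, (score P w s a' - score P w s a) with hD
  have hsum : ∑ s ∈ Finset.Icc s₁ s₂, g s = (N : ℝ)⁻¹ * D - (N : ℝ)⁻¹ ^ 2 * (K * S / β) := by
    rw [hg, Finset.sum_sub_distrib, ← Finset.mul_sum, ← Finset.mul_sum, Finset.sum_sub_distrib]
    congr 2
    rw [hS, Finset.mul_sum, Finset.sum_div]
    refine Finset.sum_congr rfl fun s _ => ?_
    rw [← div_div, div_right_comm, div_eq_mul_inv (K : ℝ)]
  rw [hsum] at hlt
  have hlogT := half_le_log hT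
  have hKS : K * S / β ≤ (M₀ / β) * N := by
    have : K * S ≤ M₀ ^ 2 := by rw [hM₀]; nlinarith
    calc K * S / β ≤ M₀ ^ 2 / β := by gcongr
      _ ≤ M₀ ^ 2 / β * (1 / β) := by
        refine le_mul_of_one_le_right (by positivity) ?_
        rw [le_div_iff₀ hβ]; linarith
      _ = (M₀ / β) * (M₀ / β) := by ring
      _ ≤ _ := by gcongr
  have hDlt : D ≤ M₀ / β + N * (8 * Real.log T) := by
    have e1 : (N : ℝ)⁻¹ ^ 2 * (K * S / β) ≤ (N : ℝ)⁻¹ * (M₀ / β) := by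
      calc (N : ℝ)⁻¹ ^ 2 * (K * S / β) ≤ (N : ℝ)⁻¹ ^ 2 * ((M₀ / β) * N) := by gcongr
        _ = _ := by field_simp
    have e2 : (N : ℝ)⁻¹ * D ≤ (N : ℝ)⁻¹ * (M₀ / β) + 8 * Real.log T := by linarith
    calc D = N * ((N : ℝ)⁻¹ * D) := by field_simp
      _ ≤ N * ((N : ℝ)⁻¹ * (M₀ / β) + 8 * Real.log T) := by gcongr
      _ = _ := by field_simp
  -- `18 = 2 + 2 * 8`, from `1 ≤ 2 * log T` and `N ≤ 2 * M₀ / β`.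
  calc D ≤ M₀ / β + N * (8 * Real.log T) := hDlt
    _ ≤ M₀ / β * (2 * Real.log T) + 2 * (M₀ / β) * (8 * Real.log T) := by
      gcongr
      · exact le_mul_of_one_le_right (by positivity) (by linarith)
    _ = 18 / β * Real.log T * M₀ := by ring
    _ ≤ _ := by gcongr

/-! ### Schedulers: counts from above, and total probability when none fires. -/

lemma prod_scheduleFactor (lam : ℝ) {t₀ t₁ : ℕ} (ch : ℕ → Option (Fin (numScales T)))
    (h0 : 1 ≤ t₀) (h1 : t₁ ≤ T) (hep : ∀ u ∈ Finset.Icc t₀ t₁, runEp c κ w H u = t₀) :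
    ∏ k ∈ Finset.range T, scheduleFactor lam t₀ t₁ ch (run c κ T w H k) (H k) =
      Real.exp (∑ u ∈ Finset.Icc t₀ t₁, (ch u).elim 0 fun e =>
        lam * (if (H (u - 1)).1 e then 1 else 0) - (Real.exp lam - 1) * scheduleProb t₀ u e) := by
  rw [← prod_range_ite_exp _ h0 h1]
  refine Finset.prod_congr rfl fun k _ => ?_
  unfold scheduleFactor
  rw [run_round]
  by_cases hk : t₀ ≤ k + 1 ∧ k + 1 ≤ t₁
  · have e1 := hep _ (Finset.mem_Icc.2 hk)
    rw [runEp, Nat.add_sub_cancel] at e1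
    rw [if_pos ⟨e1, hk.2⟩, if_pos hk, Nat.add_sub_cancel]
    cases ch (k + 1) <;> simp
  · rw [if_neg hk, if_neg]
    -- An episode starts no later than the current round, so `epStart = t₀` already excludes rounds
    -- before `t₀`.
    rintro ⟨e1, e2⟩
    have := run_epStart_le c κ w H k
    exact hk ⟨e1 ▸ this, e2⟩

/-- With `lam = 1` the count is below `(e - 1)` times its compensator plus `8 * log T`, and `e - 1 <
2`. -/
lemma count_le_of_prod_lt {t₀ t₁ : ℕ} (h0 : 1 ≤ t₀) (h1 : t₁ ≤ T) (hT : 2 ≤ T)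
    (hep : ∀ u ∈ Finset.Icc t₀ t₁, runEp c κ w H u = t₀) (e : Fin (numScales T))
    (h : ∏ k ∈ Finset.range T, scheduleFactor 1 t₀ t₁ (fun _ => some e)
      (run c κ T w H k) (H k) < (T : ℝ) ^ 8) :
    ∑ u ∈ Finset.Icc t₀ t₁, (if (H (u - 1)).1 e then (1 : ℝ) else 0)
      ≤ 2 * ∑ u ∈ Finset.Icc t₀ t₁, scheduleProb t₀ u e + 8 * Real.log T := by
  have hT' : (0 : ℝ) < T := by exact_mod_cast (by omega)
  rw [prod_scheduleFactor w H 1 _ h0 h1 hep, ← Real.lt_log_iff_exp_lt (by positivity),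
    Real.log_pow] at h
  simp only [Option.elim_some, one_mul, Finset.sum_sub_distrib, ← Finset.mul_sum] at h
  push_cast at h
  have hp : 0 ≤ ∑ u ∈ Finset.Icc t₀ t₁, scheduleProb t₀ u e :=
    Finset.sum_nonneg fun u _ => scheduleProb_nonneg t₀ u e
  nlinarith [Real.exp_one_lt_d9]

/-- With `lam = -1` and no firing, the exponent is `1 - 1 / e ≥ 1 / 2` times the sum of the
probabilities. -/
lemma sum_scheduleProb_le_of_prod_lt {t₀ t₁ : ℕ} (h0 : 1 ≤ t₀) (h1 : t₁ ≤ T) (hT : 2 ≤ T)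
    (hep : ∀ u ∈ Finset.Icc t₀ t₁, runEp c κ w H u = t₀) (ch : ℕ → Option (Fin (numScales T)))
    (h : ∏ k ∈ Finset.range T, scheduleFactor (-1) t₀ t₁ ch
      (run c κ T w H k) (H k) < (T : ℝ) ^ 8)
    (hB : ∀ u ∈ Finset.Icc t₀ t₁, ∀ e, ch u = some e → (H (u - 1)).1 e = false) :
    ∑ u ∈ Finset.Icc t₀ t₁, (ch u).elim 0 (scheduleProb t₀ u) ≤ 16 * Real.log T := by
  have hT' : (0 : ℝ) < T := by exact_mod_cast (by omega)
  rw [prod_scheduleFactor w H (-1) _ h0 h1 hep, ← Real.lt_log_iff_exp_lt (by positivity),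
    Real.log_pow] at h
  have e1 : ∑ u ∈ Finset.Icc t₀ t₁, ((ch u).elim 0 fun e =>
      -1 * (if (H (u - 1)).1 e then (1 : ℝ) else 0) - (Real.exp (-1) - 1) * scheduleProb t₀ u e) =
      (1 - Real.exp (-1)) * ∑ u ∈ Finset.Icc t₀ t₁, (ch u).elim 0 (scheduleProb t₀ u) := by
    rw [Finset.mul_sum]
    refine Finset.sum_congr rfl fun u hu => ?_
    cases hc : ch u with
    | none => simp
    | some e =>
      simp only [Option.elim_some, hB u hu e hc, Bool.false_eq_true, if_false]
      ring
  rw [e1] at h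
  push_cast at h
  have h3 : Real.exp (-1) ≤ 1 / 2 := by
    rw [Real.exp_neg, inv_le_comm₀ (Real.exp_pos _) (by norm_num)]
    linarith [Real.exp_one_gt_d9]
  have hp : 0 ≤ ∑ u ∈ Finset.Icc t₀ t₁, (ch u).elim 0 (scheduleProb t₀ u) :=
    Finset.sum_nonneg fun u _ => elim_scheduleProb_nonneg _ t₀ u
  nlinarith

end Good

/-! ### Phases -/

lemma rpow_sum_le_sum_rpow {ι : Type*} (s : Finset ι) (f : ι → ℝ) (hf : ∀ i ∈ s, 0 ≤ f i) :
    (∑ i ∈ s, f i) ^ (2 / 3 : ℝ) ≤ ∑ i ∈ s, f i ^ (2 / 3 : ℝ) := by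
  classical
  induction s using Finset.induction_on with
  | empty => simp [Real.zero_rpow]
  | insert a s ha ih =>
    rw [Finset.sum_insert ha, Finset.sum_insert ha]
    refine (Real.rpow_add_le_add_rpow (hf a (by simp))
      (Finset.sum_nonneg fun i hi => hf i (by simp [hi])) (by norm_num) (by norm_num)).trans ?_
    gcongr
    exact ih fun i hi => hf i (by simp [hi])

section Phases

variable (P : Environment K) (w : PMF (Fin K)) (T : ℕ)

open Classical in
lemma nextSwitch_le (τ : ℕ) : nextSwitch P w T τ ≤ T + 1 := by
  unfold nextSwitch
  split_ifs with h
  · have := (Nat.find_spec h).2.1; omega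
  · exact le_rfl

open Classical in
lemma lt_nextSwitch {τ : ℕ} (hτ : τ ≤ T) : τ < nextSwitch P w T τ := by
  unfold nextSwitch
  split_ifs with h
  · exact (Nat.find_spec h).1
  · omega

lemma nextSwitch_eq_of_lt {τ : ℕ} (hτ : T < τ) : nextSwitch P w T τ = T + 1 := by
  unfold nextSwitch
  rw [dif_neg]
  rintro ⟨t, h1, h2, -⟩
  omega

open Classical in
lemma nextSwitch_le_of_switch {τ t : ℕ} (h1 : τ < t) (h2 : t ≤ T) (h3 : AllArmsUnsafe P w τ t) :
    nextSwitch P w T τ ≤ t := by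
  have h : ∃ t, τ < t ∧ t ≤ T ∧ AllArmsUnsafe P w τ t := ⟨t, h1, h2, h3⟩
  unfold nextSwitch
  rw [dif_pos h]
  exact Nat.find_min' h ⟨h1, h2, h3⟩

lemma not_allArmsUnsafe_of_lt_nextSwitch {τ t : ℕ} (h1 : τ < t) (h2 : t ≤ T)
    (h3 : t < nextSwitch P w T τ) : ¬ AllArmsUnsafe P w τ t := fun h =>
  absurd (nextSwitch_le_of_switch P w T h1 h2 h) (by omega)

lemma switch_le (i : ℕ) : switch P w T i ≤ T + 1 := by
  cases i with
  | zero => simp [switch]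
  | succ i => exact nextSwitch_le P w T _

lemma switch_lt_succ {i : ℕ} (h : switch P w T i ≤ T) : switch P w T i < switch P w T (i + 1) :=
  lt_nextSwitch P w T h

lemma switch_mono : Monotone (switch P w T) := by
  refine monotone_nat_of_le_succ fun i => ?_
  rcases Nat.lt_or_ge T (switch P w T i) with h | h
  · have := nextSwitch_eq_of_lt P w T h
    have h' := switch_le P w T i
    rw [switch, this]
    exact h'
  · exact (switch_lt_succ P w T h).le

/-- Switches increase strictly until they reach `T + 1`, which justifies searching for a phase index
only up to `T`. -/
lemma min_le_switch (i : ℕ) : min (i + 1) (T + 1) ≤ switch P w T i := by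
  induction i with
  | zero => simp [switch]
  | succ i ih =>
    rcases Nat.lt_or_ge T (switch P w T i) with h | h
    · have := switch_mono P w T (Nat.le_succ i)
      simp only [Nat.succ_eq_add_one] at this
      omega
    · have := switch_lt_succ P w T h
      omega

/-- The index of the phase that contains round `t`. -/
def phase (t : ℕ) : ℕ := Nat.findGreatest (fun i => switch P w T i ≤ t) T

lemma switch_phase_le {t : ℕ} (ht : 1 ≤ t) : switch P w T (phase P w T t) ≤ t :=
  Nat.findGreatest_spec (P := fun i => switch P w T i ≤ t) (Nat.zero_le T) ht

lemma lt_switch_phase_succ {t : ℕ} (ht : t ≤ T) : t < switch P w T (phase P w T t + 1) := by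
  by_contra h
  have h1 : phase P w T t ≤ T := Nat.findGreatest_le T
  rcases Nat.lt_or_ge (phase P w T t) T with h2 | h2
  · exact Nat.findGreatest_is_greatest (P := fun i => switch P w T i ≤ t) (Nat.lt_succ_self _) h2
      (not_lt.1 h)
  · have := min_le_switch P w T (phase P w T t + 1)
    omega

lemma le_phase {i t : ℕ} (ht : t ≤ T) (h : switch P w T i ≤ t) : i ≤ phase P w T t := by
  by_contra hi
  have : switch P w T (phase P w T t + 1) ≤ switch P w T i := switch_mono P w T (not_le.1 hi)
  have := lt_switch_phase_succ P w T ht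
  omega

lemma phase_mono : Monotone (phase P w T) := fun _ _ h =>
  Nat.findGreatest_mono_left (fun _ hi => hi.trans h) T

lemma phase_le_numSwitches {t : ℕ} (h1 : 1 ≤ t) (ht : t ≤ T) :
    phase P w T t ≤ numSwitches P w T := by
  have h : Finset.Icc 1 (phase P w T t) ⊆
      (Finset.Icc 1 T).filter fun i => switch P w T i ≤ T := by
    intro i hi
    rw [Finset.mem_Icc] at hi
    have h2 : phase P w T t ≤ T := Nat.findGreatest_le T
    rw [Finset.mem_filter, Finset.mem_Icc]
    exact ⟨⟨hi.1, hi.2.trans h2⟩,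
      (switch_mono P w T hi.2).trans ((switch_phase_le P w T h1).trans ht)⟩
  have := Finset.card_le_card h
  rwa [Nat.card_Icc, Nat.add_sub_cancel] at this

/-- By minimality of the next switch, not all arms are unsafe at the last round of the phase. A
phase of a single round contains no test interval, and any arm serves. -/
lemma exists_safe_arm {t : ℕ} (h1 : 1 ≤ t) (ht : t ≤ T) :
    ∃ a : Fin K, ∀ s₁ s₂ : ℕ, switch P w T (phase P w T t) ≤ s₁ → s₁ < s₂ →
      s₂ < switch P w T (phase P w T t + 1) → ¬ SignificantRegret P w a s₁ s₂ := by
  set i := phase P w T t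
  have hle : switch P w T i ≤ T := (switch_phase_le P w T h1).trans ht
  have hlt := switch_lt_succ P w T hle
  have hK := pos_of_pmf w
  rcases Nat.lt_or_ge (switch P w T i) (switch P w T (i + 1) - 1) with h | h
  · have hT := switch_le P w T (i + 1)
    have hn := not_allArmsUnsafe_of_lt_nextSwitch P w T h (by omega)
      (show switch P w T (i + 1) - 1 < switch P w T (i + 1) by omega)
    unfold AllArmsUnsafe at hn
    push Not at hn
    obtain ⟨a, ha⟩ := hn
    exact ⟨a, fun s₁ s₂ x1 x2 x3 => ha s₁ s₂ x1 x2 (by omega)⟩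
  · exact ⟨⟨0, hK⟩, fun s₁ s₂ x1 x2 x3 => by omega⟩

/-- The phase of `t₀` starts at or before `t₀`, so the same witnesses show that its next switch
occurs by `t`. -/
lemma phase_lt_phase {t₀ t : ℕ} (h0 : 1 ≤ t₀) (ht : t ≤ T)
    (h : AllArmsUnsafe P w t₀ t) : phase P w T t₀ < phase P w T t := by
  have hK := pos_of_pmf w
  have hle := switch_phase_le P w T h0
  obtain ⟨s₁, s₂, x1, x2, x3, -⟩ := h ⟨0, hK⟩
  refine le_phase P w T ht (nextSwitch_le_of_switch P w T (by omega) ht fun a => ?_)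
  obtain ⟨s₁, s₂, y1, y2, y3, y4⟩ := h a
  exact ⟨s₁, s₂, hle.trans y1, y2, y3, y4⟩

/-- The contribution of a phase to the rate. -/
def rho (i : ℕ) : ℝ :=
  (K : ℝ) ^ (1 / 3 : ℝ) *
    ((switch P w T (i + 1) : ℝ) - (switch P w T i : ℝ)) ^ (2 / 3 : ℝ)

lemma switch_sub_nonneg (i : ℕ) : (0 : ℝ) ≤ (switch P w T (i + 1) : ℝ) - switch P w T i := by
  rw [sub_nonneg]
  exact_mod_cast switch_mono P w T (Nat.le_succ i)

lemma rho_nonneg (i : ℕ) : 0 ≤ rho P w T i := by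
  have := switch_sub_nonneg P w T i
  unfold rho
  positivity

/-- The phases met by the interval cover it, and `x ^ (2 / 3)` is subadditive. -/
lemma rate_le_sum_rho {t₀ t₁ : ℕ} (h0 : 1 ≤ t₀) (h01 : t₀ ≤ t₁) (h1 : t₁ ≤ T) :
    (K : ℝ) ^ (1 / 3 : ℝ) * ((t₁ : ℝ) + 1 - t₀) ^ (2 / 3 : ℝ) ≤
      ∑ i ∈ Finset.Icc (phase P w T t₀) (phase P w T t₁), rho P w T i := by
  have hm := phase_mono P w T h01
  have e1 : ∑ i ∈ Finset.Icc (phase P w T t₀) (phase P w T t₁),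
      ((switch P w T (i + 1) : ℝ) - switch P w T i) =
      (switch P w T (phase P w T t₁ + 1) : ℝ) - switch P w T (phase P w T t₀) := by
    rw [← Finset.Ico_succ_right_eq_Icc, Finset.sum_Ico_eq_sub _ (by simp; omega)]
    rw [Finset.sum_range_sub (fun i => (switch P w T i : ℝ)),
      Finset.sum_range_sub (fun i => (switch P w T i : ℝ))]
    simp
  have e2 : (t₁ : ℝ) + 1 - t₀ ≤ ∑ i ∈ Finset.Icc (phase P w T t₀) (phase P w T t₁),
      ((switch P w T (i + 1) : ℝ) - switch P w T i) := by
    rw [e1]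
    have a1 : ((t₁ + 1 : ℕ) : ℝ) ≤ switch P w T (phase P w T t₁ + 1) := by
      exact_mod_cast lt_switch_phase_succ P w T h1
    have a2 : (switch P w T (phase P w T t₀) : ℝ) ≤ t₀ := by
      exact_mod_cast switch_phase_le P w T h0
    push_cast at a1
    linarith
  have h01' : (t₀ : ℝ) ≤ t₁ := by exact_mod_cast h01
  unfold rho
  rw [← Finset.mul_sum]
  refine mul_le_mul_of_nonneg_left ?_ (by positivity)
  refine (Real.rpow_le_rpow (by linarith) e2 (by norm_num)).trans ?_
  exact rpow_sum_le_sum_rpow _ _ fun i _ => switch_sub_nonneg P w T i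

lemma sum_rho_le_phaseRate {t₀ t₁ : ℕ} (h1 : 1 ≤ t₁) (hT : t₁ ≤ T) :
    ∑ i ∈ Finset.Icc t₀ (phase P w T t₁), rho P w T i ≤ phaseRate P w T := by
  refine Finset.sum_le_sum_of_subset_of_nonneg ?_ fun i _ _ => rho_nonneg P w T i
  intro i hi
  have := phase_le_numSwitches P w T h1 hT
  rw [Finset.mem_Icc] at hi
  rw [Finset.mem_range]
  omega

lemma rate_le_phaseRate (hT : 1 ≤ T) :
    (K : ℝ) ^ (1 / 3 : ℝ) * (T : ℝ) ^ (2 / 3 : ℝ) ≤ phaseRate P w T := by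
  have h := rate_le_sum_rho P w T le_rfl hT le_rfl
  refine le_trans (le_of_eq ?_) (h.trans (sum_rho_le_phaseRate P w T hT le_rfl))
  congr 2
  push_cast
  ring

end Phases

/-! ### Sums of powers -/

lemma rpow_third_pow_three {x : ℝ} (hx : 0 ≤ x) : (x ^ (1 / 3 : ℝ)) ^ 3 = x := by
  rw [← Real.rpow_natCast, ← Real.rpow_mul hx]; norm_num

lemma rpow_two_thirds {x : ℝ} (hx : 0 ≤ x) : x ^ (2 / 3 : ℝ) = (x ^ (1 / 3 : ℝ)) ^ 2 := by
  rw [← Real.rpow_natCast, ← Real.rpow_mul hx]; norm_num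

lemma rpow_neg_third {x : ℝ} (hx : 0 ≤ x) : x ^ (-(1 / 3) : ℝ) = (x ^ (1 / 3 : ℝ))⁻¹ :=
  Real.rpow_neg hx _

lemma rpow_neg_two_thirds {x : ℝ} (hx : 0 ≤ x) :
    x ^ (-(2 / 3) : ℝ) = ((x ^ (1 / 3 : ℝ)) ^ 2)⁻¹ := by
  rw [Real.rpow_neg hx, rpow_two_thirds hx]

lemma sum_rpow_neg_two_thirds_le (n : ℕ) :
    ∑ u ∈ Finset.range n, ((u : ℝ) + 1) ^ (-(2 / 3) : ℝ) ≤ 3 * (n : ℝ) ^ (1 / 3 : ℝ) := by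
  induction n with
  | zero => simp
  | succ n ih =>
    rw [Finset.sum_range_succ]
    have hn : (0 : ℝ) ≤ n := n.cast_nonneg
    have hn1 : (0 : ℝ) < (n : ℝ) + 1 := by positivity
    push_cast
    rw [rpow_neg_two_thirds hn1.le]
    have hx := Real.rpow_pos_of_pos hn1 (1 / 3 : ℝ)
    have hy := Real.rpow_nonneg hn (1 / 3 : ℝ)
    have hx3 := rpow_third_pow_three hn1.le
    have hy3 := rpow_third_pow_three hn
    have hxy : (n : ℝ) ^ (1 / 3 : ℝ) ≤ ((n : ℝ) + 1) ^ (1 / 3 : ℝ) :=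
      Real.rpow_le_rpow hn (by linarith) (by norm_num)
    set x := ((n : ℝ) + 1) ^ (1 / 3 : ℝ)
    set y := (n : ℝ) ^ (1 / 3 : ℝ)
    have : (x ^ 2)⁻¹ ≤ 3 * (x - y) := by
      rw [inv_le_iff_one_le_mul₀ (by positivity)]
      -- This product is `3 x² (x - y) - (x³ - y³)`, and `x³ - y³ = 1`.
      have : 0 ≤ (x - y) * (2 * x ^ 2 - x * y - y ^ 2) := by
        refine mul_nonneg (by linarith) (by nlinarith)
      nlinarith
    linarith

lemma sum_rpow_neg_third_le (n : ℕ) :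
    ∑ u ∈ Finset.range n, ((u : ℝ) + 1) ^ (-(1 / 3) : ℝ) ≤ 2 * (n : ℝ) ^ (2 / 3 : ℝ) := by
  induction n with
  | zero => simp [Real.zero_rpow]
  | succ n ih =>
    rw [Finset.sum_range_succ]
    have hn : (0 : ℝ) ≤ n := n.cast_nonneg
    have hn1 : (0 : ℝ) < (n : ℝ) + 1 := by positivity
    rw [rpow_two_thirds hn] at ih
    push_cast
    rw [rpow_neg_third hn1.le, rpow_two_thirds hn1.le]
    have hx := Real.rpow_pos_of_pos hn1 (1 / 3 : ℝ)
    have hy := Real.rpow_nonneg hn (1 / 3 : ℝ)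
    have hx3 := rpow_third_pow_three hn1.le
    have hy3 := rpow_third_pow_three hn
    have hxy : (n : ℝ) ^ (1 / 3 : ℝ) ≤ ((n : ℝ) + 1) ^ (1 / 3 : ℝ) :=
      Real.rpow_le_rpow hn (by linarith) (by norm_num)
    set x := ((n : ℝ) + 1) ^ (1 / 3 : ℝ)
    set y := (n : ℝ) ^ (1 / 3 : ℝ)
    have : x⁻¹ ≤ 2 * (x ^ 2 - y ^ 2) := by
      rw [inv_le_iff_one_le_mul₀ (by positivity)]
      -- This product is `2 x (x² - y²) - (x³ - y³)`.
      have : 0 ≤ (x - y) * (x ^ 2 + x * y - y ^ 2) := by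
        refine mul_nonneg (by linarith) (by nlinarith)
      nlinarith
    linarith

/-! ### Averages over a shrinking set of arms -/

/-- An element with minimal `τ` contributes `1 / |S|`; removing it only shrinks the other counts, so
induction gives the harmonic number. In the application `τ` is the last round in which an arm is
retained. -/
lemma sum_inv_card_le {α : Type*} [DecidableEq α] (S : Finset α) (τ : α → ℕ) :
    ∑ a ∈ S, ((S.filter fun b => τ a ≤ τ b).card : ℝ)⁻¹ ≤ 1 + Real.log S.card := by
  have h : ∀ n (S : Finset α), S.card = n →
      ∑ a ∈ S, ((S.filter fun b => τ a ≤ τ b).card : ℝ)⁻¹ ≤ (harmonic n : ℝ) := by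
    intro n
    induction n with
    | zero =>
      intro S hS
      rw [Finset.card_eq_zero.1 hS]
      simp
    | succ n ih =>
      intro S hS
      have hne : S.Nonempty := Finset.card_pos.1 (by omega)
      obtain ⟨m, hm, hmin⟩ := Finset.exists_min_image S τ hne
      have hcard : (S.erase m).card = n := by rw [Finset.card_erase_of_mem hm, hS]; simp
      rw [← Finset.add_sum_erase S _ hm, harmonic_succ]
      have e1 : S.filter (fun b => τ m ≤ τ b) = S := Finset.filter_true_of_mem hmin
      rw [e1, hS, add_comm]
      push_cast
      gcongr
      refine le_trans (Finset.sum_le_sum fun a ha => ?_) (ih _ hcard)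
      have ha' := Finset.mem_of_mem_erase ha
      refine inv_anti₀ ?_ ?_
      · exact_mod_cast Finset.card_pos.2 ⟨a, by simp [ha', (Finset.mem_erase.1 ha).1]⟩
      · exact_mod_cast Finset.card_le_card
          (Finset.filter_subset_filter _ (Finset.erase_subset _ _))
  exact (h _ S rfl).trans (harmonic_le_one_add_log _)

/-- Summation by parts: a sum with nondecreasing weights is controlled by its suffix sums. -/
lemma abs_sum_mul_le (v y : ℕ → ℝ) {D : ℝ} {s x : ℕ} (hsx : s ≤ x) (hv0 : 0 ≤ v s)
    (hv : ∀ t, s ≤ t → t < x → v t ≤ v (t + 1))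
    (hy : ∀ j, s ≤ j → j ≤ x → |∑ u ∈ Finset.Icc j x, y u| ≤ D) :
    |∑ t ∈ Finset.Icc s x, v t * y t| ≤ v x * D := by
  have key : ∀ d s, s + d = x → (∀ t, s ≤ t → t < x → v t ≤ v (t + 1)) →
      (∀ j, s ≤ j → j ≤ x → |∑ u ∈ Finset.Icc j x, y u| ≤ D) →
      |∑ t ∈ Finset.Icc s x, v t * y t - v s * ∑ u ∈ Finset.Icc s x, y u|
        ≤ (v x - v s) * D := by
    intro d
    induction d with
    | zero =>
      intro s hs _ _
      obtain rfl : s = x := by omega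
      simp
    | succ d ih =>
      intro s hs hv hy
      have hlt : s < x := by omega
      have h1 := ih (s + 1) (by omega) (fun t ht => hv t (by omega)) fun j hj => hy j (by omega)
      have h2 := hy (s + 1) (by omega) (by omega)
      have h3 := hv s le_rfl hlt
      rw [← Finset.insert_Icc_add_one_left_eq_Icc hlt.le, Finset.sum_insert (by simp),
        Finset.sum_insert (by simp)]
      set A := ∑ t ∈ Finset.Icc (s + 1) x, v t * y t
      set B := ∑ t ∈ Finset.Icc (s + 1) x, y t
      calc |v s * y s + A - v s * (y s + B)|
          = |(A - v (s + 1) * B) + (v (s + 1) - v s) * B| := by ring_nf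
        _ ≤ |A - v (s + 1) * B| + |(v (s + 1) - v s) * B| := abs_add_le _ _
        _ ≤ (v x - v (s + 1)) * D + (v (s + 1) - v s) * D := by
          rw [abs_mul, abs_of_nonneg (sub_nonneg.2 h3)]
          gcongr
        _ = _ := by ring
  have h1 := key (x - s) s (by omega) hv hy
  have h2 := hy s le_rfl hsx
  have h3 : |v s * ∑ u ∈ Finset.Icc s x, y u| ≤ v s * D := by
    rw [abs_mul, abs_of_nonneg hv0]
    gcongr
  rw [abs_le] at *
  constructor <;> linarith [h1.1, h1.2, h3.1, h3.2]

/-- The sum over a block of rounds of averages over a shrinking set of arms. -/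
lemma abs_sum_average_le {R : ℕ → Finset (Fin K)} (hR : Antitone R) (y : ℕ → Fin K → ℝ) {D : ℝ}
    (hD : 0 ≤ D) {s x : ℕ}
    (hy : ∀ a j t, s ≤ j → j ≤ t → t ≤ x → a ∈ R t → |∑ u ∈ Finset.Icc j t, y u a| ≤ D) :
    |∑ t ∈ Finset.Icc s x, ((R t).card : ℝ)⁻¹ * ∑ a ∈ R t, y t a| ≤ D * (1 + Real.log K) := by
  classical
  rcases Nat.lt_or_ge x s with hxs | hsx
  · rw [Finset.Icc_eq_empty (by omega)]
    have : 0 ≤ Real.log K := Real.log_natCast_nonneg K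
    simp only [Finset.sum_empty, abs_zero]
    positivity
  set last : Fin K → ℕ := fun a => Nat.findGreatest (fun t => a ∈ R t) x with hlast
  have hmem : ∀ a ∈ R s, a ∈ R (last a) := fun a ha =>
    Nat.findGreatest_spec (P := fun t => a ∈ R t) hsx ha
  have hle : ∀ a, last a ≤ x := fun a => Nat.findGreatest_le x
  have hge : ∀ a t, t ≤ x → a ∈ R t → t ≤ last a := fun a t ht ha =>
    Nat.le_findGreatest (P := fun t => a ∈ R t) ht ha
  -- Exchange of sums: each arm is followed over its own lifetime, on which the weights `1 / |R t|`
  -- are nondecreasing and summation by parts applies.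
  have e1 : ∑ t ∈ Finset.Icc s x, ((R t).card : ℝ)⁻¹ * ∑ a ∈ R t, y t a =
      ∑ a ∈ R s, ∑ t ∈ Finset.Icc s (last a), ((R t).card : ℝ)⁻¹ * y t a := by
    simp only [Finset.mul_sum]
    refine Finset.sum_comm' fun t a => ?_
    simp only [Finset.mem_Icc]
    constructor
    · rintro ⟨⟨h1, h2⟩, h3⟩
      exact ⟨⟨h1, hge a t h2 h3⟩, hR h1 h3⟩
    · rintro ⟨⟨h1, h2⟩, h3⟩
      exact ⟨⟨h1, h2.trans (hle a)⟩, hR h2 (hmem a h3)⟩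
  rw [e1]
  calc _ ≤ ∑ a ∈ R s, |∑ t ∈ Finset.Icc s (last a), ((R t).card : ℝ)⁻¹ * y t a| :=
        Finset.abs_sum_le_sum_abs _ _
    _ ≤ ∑ a ∈ R s, (((R s).filter fun b => last a ≤ last b).card : ℝ)⁻¹ * D := by
        refine Finset.sum_le_sum fun a ha => ?_
        have h1 := hge a s hsx ha
        refine (abs_sum_mul_le (fun t => ((R t).card : ℝ)⁻¹) (fun t => y t a) h1 (by positivity)
          (fun t _ ht2 => ?_) fun j hj1 hj2 => hy a j (last a) hj1 hj2 (hle a) (hmem a ha)).trans ?_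
        · refine inv_anti₀ ?_ (by exact_mod_cast Finset.card_le_card (hR (Nat.le_succ t)))
          exact_mod_cast Finset.card_pos.2 ⟨a, hR ht2 (hmem a ha)⟩
        · refine mul_le_mul_of_nonneg_right (inv_anti₀ ?_ ?_) hD
          · exact_mod_cast Finset.card_pos.2 ⟨a, by simp [ha]⟩
          -- An arm whose last round is no earlier is still retained at round `last a`.
          · refine Nat.cast_le.2 (Finset.card_le_card fun b hb => ?_)
            rw [Finset.mem_filter] at hb
            exact hR hb.2 (hmem b hb.1)
    _ ≤ D * (1 + Real.log K) := by
        rw [← Finset.sum_mul, mul_comm]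
        refine mul_le_mul_of_nonneg_left ((sum_inv_card_le (R s) last).trans ?_) hD
        rcases (R s).card.eq_zero_or_pos with h | h
        · rw [h]
          have : 0 ≤ Real.log K := Real.log_natCast_nonneg K
          simp [this]
        · have : (R s).card ≤ K := by simpa using Finset.card_le_univ (R s)
          gcongr

/-! ### Bounds on the eviction threshold -/

/-- The condition `K ≤ l` makes `(l / K) ^ (1 / 3)` at least one, so that it also covers the capped
rates. -/
lemma inv_learningRate_le_of_le {κ : ℝ} (hκ : 0 < κ) (hκ1 : κ ≤ 1) (hK : 0 < K) {n l : ℕ}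
    (hn : n ≤ l) (hl : K ≤ l) :
    (learningRate K κ n)⁻¹ ≤ κ⁻¹ * ((l : ℝ) ^ (1 / 3 : ℝ) / (K : ℝ) ^ (1 / 3 : ℝ)) := by
  have hK' : (0 : ℝ) < K := by exact_mod_cast hK
  have hl' : (0 : ℝ) < l := by exact_mod_cast (hK.trans_le hl)
  have hk := Real.rpow_pos_of_pos hK' (1 / 3 : ℝ)
  have hll := Real.rpow_pos_of_pos hl' (1 / 3 : ℝ)
  have hkl : (K : ℝ) ^ (1 / 3 : ℝ) ≤ (l : ℝ) ^ (1 / 3 : ℝ) :=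
    Real.rpow_le_rpow hK'.le (by exact_mod_cast hl) (by norm_num)
  have hq : (K : ℝ) ^ (1 / 3 : ℝ) / (l : ℝ) ^ (1 / 3 : ℝ) ≤ 1 := (div_le_one hll).2 hkl
  rw [inv_le_comm₀ (learningRate_pos hK hκ n) (by positivity), mul_inv, inv_inv, inv_div]
  have hκq : κ * ((K : ℝ) ^ (1 / 3 : ℝ) / (l : ℝ) ^ (1 / 3 : ℝ)) ≤ κ :=
    mul_le_of_le_one_right hκ.le hq
  unfold learningRate
  split_ifs with h
  · exact hκq
  · refine le_min ?_ hκq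
    have hn' : (0 : ℝ) < n := by exact_mod_cast Nat.pos_of_ne_zero h
    rw [rpow_neg_third hn'.le]
    have hnl : (n : ℝ) ^ (1 / 3 : ℝ) ≤ (l : ℝ) ^ (1 / 3 : ℝ) :=
      Real.rpow_le_rpow hn'.le (by exact_mod_cast hn) (by norm_num)
    have hnn := Real.rpow_pos_of_pos hn' (1 / 3 : ℝ)
    calc κ * ((K : ℝ) ^ (1 / 3 : ℝ) / (l : ℝ) ^ (1 / 3 : ℝ))
        ≤ (K : ℝ) ^ (1 / 3 : ℝ) / (l : ℝ) ^ (1 / 3 : ℝ) :=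
          mul_le_of_le_one_left (by positivity) hκ1
      _ = (K : ℝ) ^ (1 / 3 : ℝ) * ((l : ℝ) ^ (1 / 3 : ℝ))⁻¹ := div_eq_mul_inv _ _
      _ ≤ _ := by gcongr

/-- The exponent of the learning rate balances the terms: `K * l * (l / K) ^ (1 / 3)` is the square
of `K ^ (1 / 3) * l ^ (2 / 3)`, and `K * (l / K) ^ (1 / 3)` is at most that rate when `K ≤ l`. The
square root costs `2 / κ`, the maximum `1 / κ`. -/
lemma threshold_le {κ : ℝ} (hκ : 0 < κ) (hκ1 : κ ≤ 1) (hK : 0 < K) {log : ℕ → RoundLog K}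
    {s₁ s₂ l : ℕ} (h12 : s₁ < s₂) (hs : s₂ - s₁ ≤ l) (hl : K ≤ l)
    (hrate : ∀ s, s₁ ≤ s → s ≤ s₂ → ∃ n ≤ l, (log s).rate = learningRate K κ n) :
    threshold log s₁ s₂ ≤ 3 / κ * ((K : ℝ) ^ (1 / 3 : ℝ) * (l : ℝ) ^ (2 / 3 : ℝ)) := by
  have hK' : (0 : ℝ) < K := by exact_mod_cast hK
  have hl' : (0 : ℝ) < l := by exact_mod_cast (hK.trans_le hl)
  have hl1 : (1 : ℝ) ≤ l := by exact_mod_cast (Nat.one_le_iff_ne_zero.2 (by omega))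
  have h12' : (s₁ : ℝ) < s₂ := by exact_mod_cast h12
  have hs' : (s₂ : ℝ) - s₁ ≤ l := by
    have : s₂ ≤ l + s₁ := by omega
    have : (s₂ : ℝ) ≤ l + s₁ := by exact_mod_cast this
    linarith
  have hκi : 1 ≤ κ⁻¹ := (one_le_inv₀ hκ).2 hκ1
  have hkl : (K : ℝ) ^ (1 / 3 : ℝ) ≤ (l : ℝ) ^ (1 / 3 : ℝ) :=
    Real.rpow_le_rpow hK'.le (by exact_mod_cast hl) (by norm_num)
  have hk := Real.rpow_pos_of_pos hK' (1 / 3 : ℝ)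
  have hll := Real.rpow_pos_of_pos hl' (1 / 3 : ℝ)
  have hk3 := rpow_third_pow_three hK'.le
  have hl3 := rpow_third_pow_three hl'.le
  have hr : ∀ s, s₁ ≤ s → s ≤ s₂ →
      (log s).rate⁻¹ ≤ κ⁻¹ * ((l : ℝ) ^ (1 / 3 : ℝ) / (K : ℝ) ^ (1 / 3 : ℝ)) := by
    intro s h1 h2
    obtain ⟨n, hn, e⟩ := hrate s h1 h2
    rw [e]
    exact inv_learningRate_le_of_le hκ hκ1 hK hn hl
  have hfirst : (K : ℝ) ^ (1 / 3 : ℝ) * ((s₂ : ℝ) - s₁) ^ (2 / 3 : ℝ) ≤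
      (K : ℝ) ^ (1 / 3 : ℝ) * (l : ℝ) ^ (2 / 3 : ℝ) := by
    gcongr
  rw [rpow_two_thirds hl'.le] at hfirst ⊢
  set k := (K : ℝ) ^ (1 / 3 : ℝ)
  set m := (l : ℝ) ^ (1 / 3 : ℝ)
  have hkm : 0 < k * m ^ 2 := by positivity
  refine max_le ?_ ?_
  · refine hfirst.trans (le_mul_of_one_le_left hkm.le ?_)
    rw [div_eq_mul_inv]; linarith
  · have e1 : K * (⨆ s : Set.Icc s₁ s₂, (log s).rate⁻¹) ≤ κ⁻¹ * (k * m ^ 2) := by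
      calc (K : ℝ) * (⨆ s : Set.Icc s₁ s₂, (log s).rate⁻¹) ≤ k ^ 3 * (κ⁻¹ * (m / k)) := by
            rw [hk3]
            exact mul_le_mul_of_nonneg_left (ciSup_Icc_le (fun s => (log s).rate⁻¹) h12.le hr)
              hK'.le
        _ = κ⁻¹ * (k * m * k) := by field_simp
        _ ≤ κ⁻¹ * (k * m * m) := by gcongr
        _ = _ := by ring
    have e2 : Real.sqrt (K * ∑ s ∈ Finset.Icc s₁ s₂, (log s).rate⁻¹) ≤ 2 * κ⁻¹ * (k * m ^ 2) := by
      have hsum : ∑ s ∈ Finset.Icc s₁ s₂, (log s).rate⁻¹ ≤ 2 * m ^ 3 * (κ⁻¹ * (m / k)) := by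
        calc _ ≤ ∑ s ∈ Finset.Icc s₁ s₂, κ⁻¹ * (m / k) := Finset.sum_le_sum fun s hs => by
              rw [Finset.mem_Icc] at hs
              exact hr s hs.1 hs.2
          _ = ((s₂ + 1 - s₁ : ℕ) : ℝ) * (κ⁻¹ * (m / k)) := by simp
          _ ≤ _ := by
            have : ((s₂ + 1 - s₁ : ℕ) : ℝ) ≤ 2 * m ^ 3 := by
              rw [Nat.cast_sub (by omega), hl3]
              push_cast
              linarith
            gcongr
      refine Real.sqrt_le_iff.2 ⟨by positivity, ?_⟩
      calc (K : ℝ) * ∑ s ∈ Finset.Icc s₁ s₂, (log s).rate⁻¹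
          ≤ k ^ 3 * (2 * m ^ 3 * (κ⁻¹ * (m / k))) := by
            rw [hk3]; gcongr
        _ = 2 * κ⁻¹ * (k * m ^ 2) ^ 2 := by field_simp
        _ ≤ (4 * κ⁻¹ * κ⁻¹) * (k * m ^ 2) ^ 2 := by
            gcongr
            nlinarith
        _ = _ := by ring
    calc _ ≤ 2 * κ⁻¹ * (k * m ^ 2) + κ⁻¹ * (k * m ^ 2) := add_le_add e2 e1
      _ = _ := by ring

/-! ### Evictions and significant regret -/

section Eviction

variable {P : Environment K} {w : PMF (Fin K)} {c c₁ κ : ℝ} {T : ℕ} {log : ℕ → RoundLog K}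
  {ep cs dur : ℕ → ℕ}

lemma rate_le_threshold (log : ℕ → RoundLog K) (s₁ s₂ : ℕ) :
    (K : ℝ) ^ (1 / 3 : ℝ) * ((s₂ : ℝ) - s₁) ^ (2 / 3 : ℝ) ≤ threshold log s₁ s₂ := le_max_left _ _

lemma threshold_nonneg (log : ℕ → RoundLog K) {s₁ s₂ : ℕ} (h : s₁ < s₂) :
    0 ≤ threshold log s₁ s₂ := by
  have : (0 : ℝ) ≤ (s₂ : ℝ) - s₁ := by
    rw [sub_nonneg]; exact_mod_cast h.le
  exact le_trans (by positivity) (rate_le_threshold log s₁ s₂)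

/-- After subtracting the deviation, a margin `(c - c₁) * log T ≥ 2 * (1 / 2)` times the threshold
remains, and the threshold dominates the rate. -/
lemma significantRegret_of_evicts (hT : 2 ≤ T) (hc : c₁ + 2 ≤ c)
    (hconc : Concentrates P w c₁ T log) {a : Fin K} {s₁ s₂ : ℕ} (h1 : 1 ≤ s₁) (h12 : s₁ < s₂)
    (h2 : s₂ ≤ T) (h : Evicts c T log a s₁ s₂) : SignificantRegret P w a s₁ s₂ := by
  obtain ⟨a', hact, hlt⟩ := h
  have h3 := hconc s₁ s₂ h1 h12 h2 a a' hact
  have h4 := threshold_nonneg log h12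
  have h5 := half_le_log hT
  have h6 := rate_le_threshold log s₁ s₂
  have h7 : ∑ s ∈ Finset.Icc s₁ s₂, (score P w s a' - score P w s a) ≤
      ∑ s ∈ Finset.Icc s₁ s₂, gap P w s a :=
    Finset.sum_le_sum fun s _ => score_sub_le_gap P w s a a'
  have h8 : threshold log s₁ s₂ ≤ (c - c₁) * Real.log T * threshold log s₁ s₂ :=
    le_mul_of_one_le_left h4 (by nlinarith)
  unfold SignificantRegret
  linarith

/-- Concentration with the two arms exchanged bounds the true difference by the estimated one. -/
lemma sum_score_le_of_not_evicts (hconc : Concentrates P w c₁ T log) {a a' : Fin K} {s₁ s₂ : ℕ}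
    (h1 : 1 ≤ s₁) (h12 : s₁ < s₂) (h2 : s₂ ≤ T)
    (hact : ∀ s ∈ Finset.Icc s₁ s₂, a ∈ (log s).active ∧ a' ∈ (log s).active)
    (h : ¬ Evicts c T log a s₁ s₂) :
    ∑ s ∈ Finset.Icc s₁ s₂, (score P w s a' - score P w s a)
      ≤ (c + c₁) * Real.log T * threshold log s₁ s₂ := by
  have h3 := hconc s₁ s₂ h1 h12 h2 a' a fun s hs => (hact s hs).symm
  have h4 : ∑ s ∈ Finset.Icc s₁ s₂, ((log s).estimate a' - (log s).estimate a)
      ≤ c * Real.log T * threshold log s₁ s₂ := by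
    by_contra h5
    exact h ⟨a', hact, not_le.1 h5⟩
  have e1 : ∑ s ∈ Finset.Icc s₁ s₂, ((log s).estimate a - (log s).estimate a') =
      -∑ s ∈ Finset.Icc s₁ s₂, ((log s).estimate a' - (log s).estimate a) := by
    rw [← Finset.sum_neg_distrib]; simp
  have e2 : ∑ s ∈ Finset.Icc s₁ s₂, (score P w s a - score P w s a') =
      -∑ s ∈ Finset.Icc s₁ s₂, (score P w s a' - score P w s a) := by
    rw [← Finset.sum_neg_distrib]; simp
  rw [e1, e2] at h3
  linarith

/-- The coefficient of the rate in the regret of arms that are not evicted. -/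
def evictionCoef (c c₁ κ : ℝ) (T : ℕ) : ℝ := (c + c₁) * Real.log T * (3 / κ) + 2

lemma two_le_evictionCoef (hκ : 0 < κ) (hcc : 0 ≤ c + c₁) : 2 ≤ evictionCoef c c₁ κ T := by
  have : 0 ≤ Real.log T := Real.log_natCast_nonneg T
  unfold evictionCoef
  have : 0 ≤ (c + c₁) * Real.log T * (3 / κ) := by positivity
  linarith

/-- The mean difference of scores of `b` and of the arms retained by the base algorithm that starts
at `r`. -/
def meanDiff (P : Environment K) (w : PMF (Fin K)) (c : ℝ) (T : ℕ)
    (log : ℕ → RoundLog K) (b : Fin K) (r t : ℕ) : ℝ :=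
  ((retained c T log r t).card : ℝ)⁻¹ *
    ∑ a ∈ retained c T log r t, (score P w t b - score P w t a)

lemma abs_meanDiff_le (P : Environment K) (w : PMF (Fin K)) (c : ℝ) (T : ℕ)
    (log : ℕ → RoundLog K) (b : Fin K) (r t : ℕ) : |meanDiff P w c T log b r t| ≤ 1 := by
  unfold meanDiff
  rw [abs_mul, abs_of_nonneg (by positivity)]
  have h : |∑ a ∈ retained c T log r t, (score P w t b - score P w t a)| ≤
      ∑ a ∈ retained c T log r t, (1 : ℝ) := by
    refine (Finset.abs_sum_le_sum_abs _ _).trans (Finset.sum_le_sum fun a _ => ?_)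
    rw [abs_le]
    constructor <;> linarith [abs_le.1 (abs_score_le P w t a), abs_le.1 (abs_score_le P w t b)]
  simp only [Finset.sum_const, nsmul_eq_mul, mul_one] at h
  calc _ ≤ ((retained c T log r t).card : ℝ)⁻¹ * ((retained c T log r t).card : ℝ) := by gcongr
    _ ≤ 1 := inv_mul_le_one

/-- On blocks shorter than `K` the rate exceeds the number of rounds up to a constant, so the
trivial bound suffices where `threshold_le` fails. -/
lemma succ_le_two_mul_rate (hK : 0 < K) {n : ℕ} (hn : n < K) :
    (n : ℝ) + 1 ≤ 2 * ((K : ℝ) ^ (1 / 3 : ℝ) * (max n 1 : ℕ) ^ (2 / 3 : ℝ)) := by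
  set m := max n 1
  have hm0 : (0 : ℝ) ≤ (m : ℕ) := Nat.cast_nonneg _
  have h1 : (m : ℝ) ^ (1 / 3 : ℝ) ≤ (K : ℝ) ^ (1 / 3 : ℝ) :=
    Real.rpow_le_rpow hm0 (by exact_mod_cast (by omega)) (by norm_num)
  have h2 : (n : ℝ) + 1 ≤ 2 * m := by exact_mod_cast (by omega)
  have h3 := rpow_third_pow_three hm0
  rw [rpow_two_thirds hm0]
  have h4 := Real.rpow_nonneg hm0 (1 / 3 : ℝ)
  calc (n : ℝ) + 1 ≤ 2 * ((m : ℝ) ^ (1 / 3 : ℝ)) ^ 3 := by rw [h3]; exact h2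
    _ = 2 * ((m : ℝ) ^ (1 / 3 : ℝ) * ((m : ℝ) ^ (1 / 3 : ℝ)) ^ 2) := by ring
    _ ≤ _ := by gcongr

namespace IsTrace

variable (htr : IsTrace c κ T log ep cs dur)
include htr

lemma ep_le {t : ℕ} (ht : 1 ≤ t) : ep t ≤ t := (htr.le_cs t ht).trans (htr.cs_le t ht)

lemma one_le_ep {t : ℕ} (ht : 1 ≤ t) : 1 ≤ ep t := by
  induction t, ht using Nat.le_induction with
  | base => exact htr.ep_one.ge
  | succ t ht ih =>
    rcases htr.ep_succ t ht with ⟨h, -⟩ | ⟨h, -⟩ <;> omega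

lemma ep_eq_of_mem {t u : ℕ} (ht : 1 ≤ t) (h1 : ep t ≤ u) (h2 : u ≤ t) : ep u = ep t := by
  induction t, ht using Nat.le_induction with
  | base =>
    have := htr.ep_one
    obtain rfl : u = 1 := by omega
    rfl
  | succ t ht ih =>
    rcases Nat.lt_or_ge t u with h | h
    · obtain rfl : u = t + 1 := by omega
      rfl
    · rcases htr.ep_succ t ht with ⟨h3, -⟩ | ⟨h3, -⟩
      · rw [h3] at h1 ⊢
        exact ih h1 h
      · omega

/-- Otherwise the restart rule would already have opened a new episode. -/
lemma retained_nonempty (w : PMF (Fin K)) {t : ℕ} (ht : 1 ≤ t) :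
    (retained c T log (ep t) t).Nonempty := by
  have hK := pos_of_pmf w
  have huniv : ∀ s, (retained c T log s s).Nonempty := fun s =>
    ⟨⟨0, hK⟩, mem_retained.2 fun s₁ s₂ h1 h2 h3 => by omega⟩
  obtain ⟨n, rfl⟩ := Nat.exists_eq_add_of_le' ht
  rcases Nat.eq_zero_or_pos n with rfl | hn
  · simp only [zero_add]
    rw [htr.ep_one]
    exact huniv 1
  · rcases htr.ep_succ n hn with ⟨h1, h2⟩ | ⟨h1, -⟩
    · rw [h1]; exact h2
    · rw [h1]; exact huniv _

/-- A base algorithm that starts later has carried out fewer eviction tests and keeps more arms.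
Hence retained arms stay active through all interruptions, and tests over whole intervals apply to
them. -/
lemma retained_subset_active {r t u : ℕ} (hu : 1 ≤ u) (hr : r ≤ cs u) (hut : u ≤ t) :
    retained c T log r t ⊆ (log u).active := by
  rw [htr.active_eq u hu]
  exact retained_subset c T log hr hut

/-- Over a block of rounds with late base algorithms, retained arms have close total scores. -/
lemma abs_sum_score_sub_le (hκ : 0 < κ) (hκ1 : κ ≤ 1) (hcc : 0 ≤ c + c₁)
    (hconc : Concentrates P w c₁ T log) {r s x : ℕ} (hs : 1 ≤ s) (hrs : r ≤ s) (hx : x ≤ T)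
    (hcs : ∀ t, s ≤ t → t ≤ x → s ≤ cs t) (hKx : K ≤ x - s) {a b : Fin K} {j t : ℕ} (hj : s ≤ j)
    (hjt : j ≤ t) (htx : t ≤ x) (ha : a ∈ retained c T log r t) (hb : b ∈ retained c T log r t) :
    ∑ u ∈ Finset.Icc j t, (score P w u b - score P w u a) ≤
      evictionCoef c c₁ κ T * ((K : ℝ) ^ (1 / 3 : ℝ) * ((x - s : ℕ) : ℝ) ^ (2 / 3 : ℝ)) := by
  have hK := pos_of_pmf w
  have hlog : 0 ≤ Real.log T := Real.log_natCast_nonneg T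
  have hone : 1 ≤ (K : ℝ) ^ (1 / 3 : ℝ) * ((x - s : ℕ) : ℝ) ^ (2 / 3 : ℝ) := by
    have h1 : (1 : ℝ) ≤ K := by exact_mod_cast hK
    have h2 : (1 : ℝ) ≤ ((x - s : ℕ) : ℝ) := by exact_mod_cast hK.trans_le hKx
    exact one_le_mul_of_one_le_of_one_le (Real.one_le_rpow h1 (by norm_num))
      (Real.one_le_rpow h2 (by norm_num))
  have hle1 : ∀ u, score P w u b - score P w u a ≤ 1 := fun u => by
    linarith [abs_le.1 (abs_score_le P w u a), abs_le.1 (abs_score_le P w u b)]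
  set F := (K : ℝ) ^ (1 / 3 : ℝ) * ((x - s : ℕ) : ℝ) ^ (2 / 3 : ℝ)
  have hF : 0 ≤ (c + c₁) * Real.log T * (3 / κ) * F := by positivity
  unfold evictionCoef
  rcases Nat.lt_or_ge (j + 1) t with h | h
  -- Being retained at `t` concerns tests that end before `t`, so the last round is split off at
  -- cost one; blocks of at most two rounds cost two. Both fit in the `+ 2` of `evictionCoef`.
  · obtain ⟨t', rfl⟩ : ∃ t', t = t' + 1 := ⟨t - 1, by omega⟩
    have hact : ∀ u ∈ Finset.Icc j t', a ∈ (log u).active ∧ b ∈ (log u).active := by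
      intro u hu
      rw [Finset.mem_Icc] at hu
      have := htr.retained_subset_active (r := r) (t := t' + 1) (u := u) (by omega)
        (hrs.trans (hcs u (by omega) (by omega))) (by omega)
      exact ⟨this ha, this hb⟩
    have h1 := sum_score_le_of_not_evicts (c := c) hconc (s₁ := j) (s₂ := t') (by omega) (by omega)
      (by omega) hact (mem_retained.1 ha j t' (by omega) (by omega) (by omega))
    have h2 := threshold_le hκ hκ1 hK (log := log) (s₁ := j) (s₂ := t') (l := x - s) (by omega)
      (by omega) hKx fun u h1 h2 =>
        ⟨u - cs u, by have := hcs u (by omega) (by omega); omega, htr.rate_eq u (by omega)⟩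
    have h3 : (c + c₁) * Real.log T * threshold log j t' ≤ (c + c₁) * Real.log T * (3 / κ * F) := by
      gcongr
    rw [Finset.sum_Icc_succ_top (by omega)]
    have := hle1 (t' + 1)
    nlinarith
  · have : ∑ u ∈ Finset.Icc j t, (score P w u b - score P w u a) ≤ ∑ u ∈ Finset.Icc j t, (1 : ℝ) :=
      Finset.sum_le_sum fun u _ => hle1 u
    have hcard : ((t + 1 - j : ℕ) : ℝ) ≤ 2 := by exact_mod_cast (by omega)
    simp only [Finset.sum_const, Nat.card_Icc, nsmul_eq_mul, mul_one] at this
    nlinarith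

/-- The tests bound differences for single arms; averaging over a shrinking retained set costs only
the factor `1 + log K`. The start `r` may precede the block. -/
lemma abs_sum_meanDiff_le (hκ : 0 < κ) (hκ1 : κ ≤ 1) (hcc : 0 ≤ c + c₁)
    (hconc : Concentrates P w c₁ T log) {r s x : ℕ} (hs : 1 ≤ s) (hrs : r ≤ s) (hx : x ≤ T)
    (hcs : ∀ t, s ≤ t → t ≤ x → s ≤ cs t) {b : Fin K} (hb : b ∈ retained c T log r x) :
    |∑ t ∈ Finset.Icc s x, meanDiff P w c T log b r t| ≤
      evictionCoef c c₁ κ T * (1 + Real.log K) *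
        ((K : ℝ) ^ (1 / 3 : ℝ) * (max (x - s) 1 : ℕ) ^ (2 / 3 : ℝ)) := by
  have hK := pos_of_pmf w
  have hE : 2 ≤ evictionCoef c c₁ κ T := two_le_evictionCoef hκ hcc
  have hlogK : 0 ≤ Real.log K := Real.log_natCast_nonneg K
  rcases Nat.lt_or_ge (x - s) K with h | h
  · refine le_trans ?_ (mul_le_mul_of_nonneg_right
      (show 2 ≤ evictionCoef c c₁ κ T * (1 + Real.log K) by nlinarith) (by positivity))
    refine le_trans ?_ (succ_le_two_mul_rate hK h)
    calc _ ≤ ∑ t ∈ Finset.Icc s x, |meanDiff P w c T log b r t| := Finset.abs_sum_le_sum_abs _ _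
      _ ≤ ∑ t ∈ Finset.Icc s x, (1 : ℝ) := Finset.sum_le_sum fun t _ => abs_meanDiff_le ..
      _ = ((x + 1 - s : ℕ) : ℝ) := by simp
      _ ≤ _ := by exact_mod_cast (by omega)
  · have hmax : max (x - s) 1 = x - s := by omega
    rw [hmax]
    set F := (K : ℝ) ^ (1 / 3 : ℝ) * ((x - s : ℕ) : ℝ) ^ (2 / 3 : ℝ) with hF
    have hF0 : 0 ≤ F := by positivity
    have := abs_sum_average_le (R := fun t => retained c T log r t)
      (fun t t' htt => retained_subset c T log le_rfl htt)
      (fun t a => score P w t b - score P w t a) (D := evictionCoef c c₁ κ T * F)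
      (mul_nonneg (by linarith) hF0) (s := s) (x := x) (fun a j t hj hjt htx ha => by
        have hb' := retained_subset c T log le_rfl htx hb
        have h1 := htr.abs_sum_score_sub_le hκ hκ1 hcc hconc hs hrs hx hcs h hj hjt htx ha hb'
        have h2 := htr.abs_sum_score_sub_le hκ hκ1 hcc hconc hs hrs hx hcs h hj hjt htx hb' ha
        rw [abs_le]
        refine ⟨?_, h1⟩
        have e : ∑ u ∈ Finset.Icc j t, (score P w u a - score P w u b) =
            -∑ u ∈ Finset.Icc j t, (score P w u b - score P w u a) := by
          rw [← Finset.sum_neg_distrib]; simp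
        rw [e] at h2
        linarith)
    calc _ ≤ _ := this
      _ = _ := by ring

end IsTrace

end Eviction

lemma sum_learningRate_le (hK : 0 < K) {κ : ℝ} (hκ1 : κ ≤ 1) {s x : ℕ} (hsx : s ≤ x) :
    ∑ t ∈ Finset.Icc s x, learningRate K κ (t - s) ≤
      3 * ((K : ℝ) ^ (1 / 3 : ℝ) * (max (x - s) 1 : ℕ) ^ (2 / 3 : ℝ)) := by
  have hK1 : (1 : ℝ) ≤ K := by exact_mod_cast hK
  have hk : (1 : ℝ) ≤ (K : ℝ) ^ (1 / 3 : ℝ) := Real.one_le_rpow hK1 (by norm_num)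
  have hm : (1 : ℝ) ≤ (max (x - s) 1 : ℕ) := by exact_mod_cast le_max_right _ _
  have hm2 : (1 : ℝ) ≤ ((max (x - s) 1 : ℕ) : ℝ) ^ (2 / 3 : ℝ) :=
    Real.one_le_rpow hm (by norm_num)
  have hle : ((x - s : ℕ) : ℝ) ^ (2 / 3 : ℝ) ≤ ((max (x - s) 1 : ℕ) : ℝ) ^ (2 / 3 : ℝ) := by
    refine Real.rpow_le_rpow (Nat.cast_nonneg _) (by exact_mod_cast le_max_left _ _) (by norm_num)
  have e1 : ∑ t ∈ Finset.Icc s x, learningRate K κ (t - s) =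
      ∑ n ∈ Finset.range (x - s + 1), learningRate K κ n := by
    rw [Finset.range_eq_Ico, ← Finset.Ico_succ_right_eq_Icc, Finset.sum_Ico_eq_sum_range,
      Finset.range_eq_Ico]
    simp only [Nat.succ_eq_succ, Nat.succ_eq_add_one, Nat.add_sub_cancel_left]
    congr 2
    omega
  rw [e1, Finset.sum_range_succ']
  have h0 : learningRate K κ 0 ≤ 1 := by simpa [learningRate] using hκ1
  have h1 : ∑ n ∈ Finset.range (x - s), learningRate K κ (n + 1) ≤
      (K : ℝ) ^ (1 / 3 : ℝ) * (2 * ((x - s : ℕ) : ℝ) ^ (2 / 3 : ℝ)) := by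
    calc _ ≤ ∑ n ∈ Finset.range (x - s), (K : ℝ) ^ (1 / 3 : ℝ) * ((n : ℝ) + 1) ^ (-(1 / 3) : ℝ) := by
          refine Finset.sum_le_sum fun n _ => ?_
          unfold learningRate
          rw [if_neg (by omega)]
          push_cast
          exact min_le_left _ _
      _ ≤ _ := by
          rw [← Finset.mul_sum]
          gcongr
          exact sum_rpow_neg_third_le _
  nlinarith

/-! ### Nested replays -/

section Nested

variable (dur : ℕ → ℕ) (t₀ : ℕ)

/-- The replay launched at `s` is running at round `t`, and it outlasts all replays launched after
it. -/
def Outlasts (s t : ℕ) : Prop :=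
  s ≤ t ∧ 0 < dur s ∧ t ≤ s + dur s ∧ ∀ u, s < u → u ≤ t → 0 < dur u → u + dur u < s + dur s

open Classical in
/-- The start of the latest earlier replay that outlasts the replay launched at `s`, or `t₀`. -/
def parent (s : ℕ) : ℕ :=
  max t₀ (Nat.findGreatest (fun r => t₀ ≤ r ∧ 0 < dur r ∧ s + dur s < r + dur r) (s - 1))

lemma parent_le {s : ℕ} (hs : t₀ ≤ s) : parent dur t₀ s ≤ s := by
  classical
  refine max_le hs ?_
  exact (Nat.findGreatest_le _).trans (Nat.sub_le _ _)

lemma Outlasts.mono {dur : ℕ → ℕ} {s t t' : ℕ} (h : Outlasts dur s t) (h1 : s ≤ t') (h2 : t' ≤ t) :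
    Outlasts dur s t' :=
  ⟨h1, h.2.1, h2.trans h.2.2.1, fun u hu hu' => h.2.2.2 u hu (hu'.trans h2)⟩

-- At a fixed round the outlasting replays form a chain in which each one's predecessor is its
-- `parent`, so the sum telescopes.
open Classical in
lemma sum_outlasts_eq (f : ℕ → ℝ) (t : ℕ) {s : ℕ} (hs : t₀ ≤ s) (h : Outlasts dur s t) :
    ∑ s' ∈ (Finset.Icc t₀ s).filter fun s' => Outlasts dur s' t, (f s' - f (parent dur t₀ s')) =
      f s - f t₀ := by
  induction s using Nat.strong_induction_on with
  | _ s ih =>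
    by_cases hr : ∃ r, r < s ∧ t₀ ≤ r ∧ 0 < dur r ∧ s + dur s < r + dur r
    · obtain ⟨r', hr'⟩ := hr
      set r := Nat.findGreatest (fun r => t₀ ≤ r ∧ 0 < dur r ∧ s + dur s < r + dur r) (s - 1)
        with hrdef
      have hspec : t₀ ≤ r ∧ 0 < dur r ∧ s + dur s < r + dur r :=
        Nat.findGreatest_spec (P := fun r => t₀ ≤ r ∧ 0 < dur r ∧ s + dur s < r + dur r)
          (by omega : r' ≤ s - 1) hr'.2
      have hrs : r ≤ s - 1 := Nat.findGreatest_le _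
      have hmax : ∀ u, r < u → u < s → t₀ ≤ u → 0 < dur u → u + dur u ≤ s + dur s := by
        intro u h1 h2 h3 h4
        by_contra h5
        exact Nat.findGreatest_is_greatest
          (P := fun r => t₀ ≤ r ∧ 0 < dur r ∧ s + dur s < r + dur r) h1 (by omega)
          ⟨h3, h4, not_le.1 h5⟩
      have hpar : parent dur t₀ s = r := by
        unfold parent
        rw [← hrdef]
        exact max_eq_right hspec.1
      have hst := h.2.2.1
      have hst' := h.1
      have hr_out : Outlasts dur r t := by
        refine ⟨by omega, hspec.2.1, by omega, fun u h1 h2 h3 => ?_⟩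
        rcases Nat.lt_trichotomy u s with h4 | rfl | h4
        · have := hmax u h1 h4 (by omega) h3
          omega
        · exact hspec.2.2
        · have := h.2.2.2 u h4 h2 h3
          omega
      -- No replay strictly between `r` and `s` outlasts `s`, by maximality of `r`.
      have hset : (Finset.Icc t₀ s).filter (fun s' => Outlasts dur s' t) =
          insert s ((Finset.Icc t₀ r).filter fun s' => Outlasts dur s' t) := by
        ext u
        simp only [Finset.mem_filter, Finset.mem_Icc, Finset.mem_insert]
        constructor
        · rintro ⟨⟨h1, h2⟩, h3⟩
          rcases Nat.lt_or_ge u s with h4 | h4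
          · right
            refine ⟨⟨h1, ?_⟩, h3⟩
            by_contra h5
            have := hmax u (not_le.1 h5) h4 h1 h3.2.1
            have := h3.2.2.2 s h4 h.1 h.2.1
            omega
          · left; omega
        · rintro (rfl | ⟨⟨h1, h2⟩, h3⟩)
          · exact ⟨⟨hs, le_rfl⟩, h⟩
          · exact ⟨⟨h1, by omega⟩, h3⟩
      rw [hset, Finset.sum_insert, ih r (by omega) hspec.1 hr_out, hpar]
      · ring
      · simp only [Finset.mem_filter, Finset.mem_Icc, not_and]
        omega
    · have hset : (Finset.Icc t₀ s).filter (fun s' => Outlasts dur s' t) = {s} := by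
        ext u
        simp only [Finset.mem_filter, Finset.mem_Icc, Finset.mem_singleton]
        constructor
        · rintro ⟨⟨h1, h2⟩, h3⟩
          by_contra h4
          exact hr ⟨u, by omega, h1, h3.2.1, h3.2.2.2 s (by omega) h.1 h.2.1⟩
        · rintro rfl
          exact ⟨⟨hs, le_rfl⟩, h⟩
      have hpar : parent dur t₀ s = t₀ := by
        unfold parent
        have : Nat.findGreatest (fun r => t₀ ≤ r ∧ 0 < dur r ∧ s + dur s < r + dur r) (s - 1) = 0 := by
          rw [Nat.findGreatest_eq_zero_iff]
          intro k h1 h2 h3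
          exact hr ⟨k, by omega, h3⟩
        rw [this]
        exact max_eq_left (Nat.zero_le _)
      rw [hset, Finset.sum_singleton, hpar]

open Classical in
/-- A function of the active base algorithm telescopes along the nested replays. -/
lemma eq_add_sum_outlasts (f : ℕ → ℝ) {t s : ℕ} (hs : t₀ ≤ s) (hst : s ≤ t)
    (halive : s = t₀ ∨ (t ≤ s + dur s ∧ 0 < dur s))
    (hmax : ∀ u, t₀ ≤ u → u ≤ t → 0 < dur u → t ≤ u + dur u → u ≤ s) :
    f s = f t₀ + ∑ s' ∈ (Finset.Icc t₀ t).filter fun s' => Outlasts dur s' t,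
      (f s' - f (parent dur t₀ s')) := by
  have hset : (Finset.Icc t₀ t).filter (fun s' => Outlasts dur s' t) =
      (Finset.Icc t₀ s).filter fun s' => Outlasts dur s' t := by
    ext u
    simp only [Finset.mem_filter, Finset.mem_Icc]
    constructor
    · rintro ⟨⟨h1, h2⟩, h3⟩
      exact ⟨⟨h1, hmax u h1 h2 h3.2.1 h3.2.2.1⟩, h3⟩
    · rintro ⟨⟨h1, h2⟩, h3⟩
      exact ⟨⟨h1, h2.trans hst⟩, h3⟩
  rw [hset]
  by_cases ha : t ≤ s + dur s ∧ 0 < dur s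
  · rw [sum_outlasts_eq dur t₀ f t hs]
    · ring
    · refine ⟨hst, ha.2, ha.1, fun u h1 h2 h3 => ?_⟩
      by_contra h4
      have := hmax u (by omega) h2 h3 (by omega)
      omega
  · obtain rfl : s = t₀ := halive.resolve_right ha
    rw [Finset.sum_eq_zero, add_zero]
    intro u hu
    simp only [Finset.mem_filter, Finset.mem_Icc] at hu
    obtain rfl : u = s := by omega
    exact absurd ⟨hu.2.2.2.1, hu.2.2.1⟩ ha

/-- The total rate of the base algorithms of an episode with rounds `t₀, …, t₁`. -/
def replayRate (t₁ : ℕ) : ℝ :=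
  ((t₁ + 1 - t₀ : ℕ) : ℝ) ^ (2 / 3 : ℝ) +
    ∑ s ∈ Finset.Icc t₀ t₁, ((min (dur s) (t₁ + 1 - t₀) : ℕ) : ℝ) ^ (2 / 3 : ℝ)

lemma rpow_two_thirds_mono {m n : ℕ} (h : m ≤ n) : (m : ℝ) ^ (2 / 3 : ℝ) ≤ (n : ℝ) ^ (2 / 3 : ℝ) :=
  Real.rpow_le_rpow (Nat.cast_nonneg m) (by exact_mod_cast h) (by norm_num)

end Nested

section Episode

variable {P : Environment K} {w : PMF (Fin K)} {c c₁ κ : ℝ} {T : ℕ} {log : ℕ → RoundLog K}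
  {ep cs dur : ℕ → ℕ}

/-- The total mean score difference of the active arms to an arm that is never evicted in the
episode. -/
lemma IsTrace.sum_meanDiff_cs_le (htr : IsTrace c κ T log ep cs dur) (hκ : 0 < κ) (hκ1 : κ ≤ 1)
    (hcc : 0 ≤ c + c₁) (hconc : Concentrates P w c₁ T log) {t₀ t₁ : ℕ} (h0 : 1 ≤ t₀)
    (h01 : t₀ ≤ t₁) (h1 : t₁ ≤ T) (hep : ∀ t ∈ Finset.Icc t₀ t₁, ep t = t₀) {b : Fin K}
    (hb : b ∈ retained c T log t₀ t₁) :
    ∑ t ∈ Finset.Icc t₀ t₁, meanDiff P w c T log b (cs t) t ≤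
      2 * (evictionCoef c c₁ κ T * (1 + Real.log K)) *
        ((K : ℝ) ^ (1 / 3 : ℝ) * replayRate dur t₀ t₁) := by
  classical
  have hE : 2 ≤ evictionCoef c c₁ κ T := two_le_evictionCoef hκ hcc
  have hlogK : 0 ≤ Real.log K := Real.log_natCast_nonneg K
  set Q := evictionCoef c c₁ κ T * (1 + Real.log K) with hQ
  have hQ0 : 0 ≤ Q := mul_nonneg (by linarith) (by linarith)
  set f : ℕ → ℕ → ℝ := fun t r => meanDiff P w c T log b r t with hf
  have hcs0 : ∀ t ∈ Finset.Icc t₀ t₁, t₀ ≤ cs t := fun t ht => by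
    rw [← hep t ht]
    exact htr.le_cs t (h0.trans (Finset.mem_Icc.1 ht).1)
  -- The rounds played by one base algorithm need not form an interval. Each difference to the
  -- parent, by contrast, lives on an interval of rounds.
  have hexp : ∀ t ∈ Finset.Icc t₀ t₁, f t (cs t) = f t t₀ +
      ∑ s ∈ (Finset.Icc t₀ t).filter (fun s => Outlasts dur s t),
        (f t s - f t (parent dur t₀ s)) := by
    intro t ht
    have ht' := h0.trans (Finset.mem_Icc.1 ht).1
    refine eq_add_sum_outlasts dur t₀ (f t) (hcs0 t ht) (htr.cs_le t ht') ?_ ?_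
    · have := htr.cs_alive t ht'
      rwa [hep t ht] at this
    · have := htr.cs_max t ht'
      rwa [hep t ht] at this
  have hblock : ∀ r s x, t₀ ≤ r → r ≤ s → s ≤ x → x ≤ t₁ → (∀ t, s ≤ t → t ≤ x → s ≤ cs t) →
      |∑ t ∈ Finset.Icc s x, f t r| ≤
        Q * ((K : ℝ) ^ (1 / 3 : ℝ) * (max (x - s) 1 : ℕ) ^ (2 / 3 : ℝ)) := by
    intro r s x hr hrs hsx hx hcs
    exact htr.abs_sum_meanDiff_le hκ hκ1 hcc hconc (by omega) hrs (hx.trans h1) hcs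
      (retained_subset c T log hr hx hb)
  have hroot : ∑ t ∈ Finset.Icc t₀ t₁, f t t₀ ≤
      2 * Q * ((K : ℝ) ^ (1 / 3 : ℝ) * ((t₁ + 1 - t₀ : ℕ) : ℝ) ^ (2 / 3 : ℝ)) := by
    have h := (abs_le.1 (hblock t₀ t₀ t₁ le_rfl le_rfl h01 le_rfl
      fun t h1 h2 => hcs0 t (Finset.mem_Icc.2 ⟨h1, h2⟩))).2
    refine h.trans ?_
    have h2 := rpow_two_thirds_mono (show max (t₁ - t₀) 1 ≤ t₁ + 1 - t₀ by omega)
    have h3 : Q ≤ 2 * Q := by linarith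
    gcongr
  have hnest : ∀ s ∈ Finset.Icc t₀ t₁,
      ∑ t ∈ (Finset.Icc s t₁).filter (fun t => Outlasts dur s t),
        (f t s - f t (parent dur t₀ s)) ≤
      2 * Q * ((K : ℝ) ^ (1 / 3 : ℝ) * ((min (dur s) (t₁ + 1 - t₀) : ℕ) : ℝ) ^ (2 / 3 : ℝ)) := by
    intro s hs
    rw [Finset.mem_Icc] at hs
    by_cases hd : 0 < dur s
    · have hself : Outlasts dur s s := ⟨le_rfl, hd, by omega, fun u _ _ => by omega⟩
      set x := Nat.findGreatest (Outlasts dur s) t₁ with hx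
      have hx_out : Outlasts dur s x := Nat.findGreatest_spec hs.2 hself
      have hxt : x ≤ t₁ := Nat.findGreatest_le _
      -- Outlasting passes to earlier rounds, so these rounds form an interval, and on it the
      -- current base algorithm starts at `s` or later.
      have hset : (Finset.Icc s t₁).filter (fun t => Outlasts dur s t) = Finset.Icc s x := by
        ext t
        simp only [Finset.mem_filter, Finset.mem_Icc]
        constructor
        · rintro ⟨⟨h1, h2⟩, h3⟩
          exact ⟨h1, Nat.le_findGreatest h2 h3⟩
        · rintro ⟨h1, h2⟩
          exact ⟨⟨h1, h2.trans hxt⟩, hx_out.mono h1 h2⟩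
      have hcs : ∀ t, s ≤ t → t ≤ x → s ≤ cs t := by
        intro t h1 h2
        have hx3 := hx_out.2.2.1
        refine htr.cs_max t (by omega) s ?_ h1 hd (by omega)
        rw [hep t (Finset.mem_Icc.2 ⟨by omega, by omega⟩)]
        exact hs.1
      have e1 := (abs_le.1 (hblock s s x hs.1 le_rfl hx_out.1 hxt hcs)).2
      -- The arms retained by the parent are also active throughout `[s, x]`, so its average obeys
      -- the same bound.
      have e2 := (abs_le.1 (hblock (parent dur t₀ s) s x (le_max_left _ _)
        (parent_le dur t₀ hs.1) hx_out.1 hxt hcs)).1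
      rw [hset, Finset.sum_sub_distrib]
      have hx3 := hx_out.2.2.1
      have h2 := rpow_two_thirds_mono
        (show max (x - s) 1 ≤ min (dur s) (t₁ + 1 - t₀) by omega)
      have h3 : Q * ((K : ℝ) ^ (1 / 3 : ℝ) * (max (x - s) 1 : ℕ) ^ (2 / 3 : ℝ)) ≤
          Q * ((K : ℝ) ^ (1 / 3 : ℝ) * ((min (dur s) (t₁ + 1 - t₀) : ℕ) : ℝ) ^ (2 / 3 : ℝ)) := by
        gcongr
      linarith
    · rw [Finset.filter_false_of_mem fun t _ h => hd h.2.1, Finset.sum_empty]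
      positivity
  rw [Finset.sum_congr rfl hexp, Finset.sum_add_distrib]
  have hswap : ∑ t ∈ Finset.Icc t₀ t₁, ∑ s ∈ (Finset.Icc t₀ t).filter (fun s => Outlasts dur s t),
        (f t s - f t (parent dur t₀ s)) =
      ∑ s ∈ Finset.Icc t₀ t₁, ∑ t ∈ (Finset.Icc s t₁).filter (fun t => Outlasts dur s t),
        (f t s - f t (parent dur t₀ s)) := by
    refine Finset.sum_comm' fun t s => ?_
    simp only [Finset.mem_filter, Finset.mem_Icc]
    constructor
    · rintro ⟨⟨a1, a2⟩, ⟨a3, a4⟩, a5⟩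
      exact ⟨⟨⟨a4, a2⟩, a5⟩, a3, a4.trans a2⟩
    · rintro ⟨⟨⟨a1, a2⟩, a3⟩, a4, a5⟩
      exact ⟨⟨a4.trans a1, a2⟩, ⟨a4, a1⟩, a3⟩
  rw [hswap]
  have hsum := Finset.sum_le_sum hnest
  rw [← Finset.mul_sum, ← Finset.mul_sum] at hsum
  unfold replayRate
  calc _ ≤ _ := add_le_add hroot hsum
    _ = _ := by ring

/-- The rates are nonnegative, so every base algorithm may be charged for its whole scheduled range,
interruptions included; no telescoping is needed. -/
lemma IsTrace.sum_rate_le (htr : IsTrace c κ T log ep cs dur) (hK : 0 < K) (hκ : 0 < κ)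
    (hκ1 : κ ≤ 1) {t₀ t₁ : ℕ} (h0 : 1 ≤ t₀) (h01 : t₀ ≤ t₁)
    (hep : ∀ t ∈ Finset.Icc t₀ t₁, ep t = t₀) :
    ∑ t ∈ Finset.Icc t₀ t₁, (log t).rate ≤
      3 * ((K : ℝ) ^ (1 / 3 : ℝ) * replayRate dur t₀ t₁) := by
  have hpos : ∀ n, 0 ≤ learningRate K κ n := fun n => (learningRate_pos hK hκ n).le
  have hexp : ∀ t ∈ Finset.Icc t₀ t₁, (log t).rate ≤ learningRate K κ (t - t₀) +
      ∑ s ∈ (Finset.Icc t₀ t).filter (fun s => 0 < dur s ∧ t ≤ s + dur s),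
        learningRate K κ (t - s) := by
    intro t ht
    have ht' := h0.trans (Finset.mem_Icc.1 ht).1
    rw [htr.rate_eq t ht']
    have hle := htr.le_cs t ht'
    have hal := htr.cs_alive t ht'
    rw [hep t ht] at hle hal
    rcases hal with h | h
    · rw [h]
      exact le_add_of_nonneg_right (Finset.sum_nonneg fun s _ => hpos _)
    · refine le_trans ?_ (le_add_of_nonneg_left (hpos _))
      refine Finset.single_le_sum (f := fun s => learningRate K κ (t - s)) (fun s _ => hpos _) ?_
      simp only [Finset.mem_filter, Finset.mem_Icc]
      exact ⟨⟨hle, htr.cs_le t ht'⟩, h.2, h.1⟩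
  refine (Finset.sum_le_sum hexp).trans ?_
  rw [Finset.sum_add_distrib]
  have hroot : ∑ t ∈ Finset.Icc t₀ t₁, learningRate K κ (t - t₀) ≤
      3 * ((K : ℝ) ^ (1 / 3 : ℝ) * ((t₁ + 1 - t₀ : ℕ) : ℝ) ^ (2 / 3 : ℝ)) := by
    refine (sum_learningRate_le hK hκ1 h01).trans ?_
    have h2 := rpow_two_thirds_mono (show max (t₁ - t₀) 1 ≤ t₁ + 1 - t₀ by omega)
    gcongr
  have hnest : ∀ s ∈ Finset.Icc t₀ t₁,
      ∑ t ∈ (Finset.Icc s t₁).filter (fun t => 0 < dur s ∧ t ≤ s + dur s),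
        learningRate K κ (t - s) ≤
      3 * ((K : ℝ) ^ (1 / 3 : ℝ) * ((min (dur s) (t₁ + 1 - t₀) : ℕ) : ℝ) ^ (2 / 3 : ℝ)) := by
    intro s hs
    rw [Finset.mem_Icc] at hs
    by_cases hd : 0 < dur s
    · refine (Finset.sum_le_sum_of_subset_of_nonneg (t := Finset.Icc s (min t₁ (s + dur s))) ?_
        fun t _ _ => hpos _).trans ?_
      · intro t
        simp only [Finset.mem_filter, Finset.mem_Icc]
        omega
      · refine (sum_learningRate_le hK hκ1 (by omega)).trans ?_
        have h2 := rpow_two_thirds_mono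
          (show max (min t₁ (s + dur s) - s) 1 ≤ min (dur s) (t₁ + 1 - t₀) by omega)
        gcongr
    · rw [Finset.filter_false_of_mem fun t _ h => hd h.1, Finset.sum_empty]
      positivity
  have hswap : ∑ t ∈ Finset.Icc t₀ t₁,
        ∑ s ∈ (Finset.Icc t₀ t).filter (fun s => 0 < dur s ∧ t ≤ s + dur s),
        learningRate K κ (t - s) =
      ∑ s ∈ Finset.Icc t₀ t₁,
        ∑ t ∈ (Finset.Icc s t₁).filter (fun t => 0 < dur s ∧ t ≤ s + dur s),
        learningRate K κ (t - s) := by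
    refine Finset.sum_comm' fun t s => ?_
    simp only [Finset.mem_filter, Finset.mem_Icc]
    constructor
    · rintro ⟨⟨a1, a2⟩, ⟨a3, a4⟩, a5⟩
      exact ⟨⟨⟨a4, a2⟩, a5⟩, a3, a4.trans a2⟩
    · rintro ⟨⟨⟨a1, a2⟩, a3⟩, a4, a5⟩
      exact ⟨⟨a4.trans a1, a2⟩, ⟨a4, a1⟩, a3⟩
  rw [hswap]
  have hsum := Finset.sum_le_sum hnest
  rw [← Finset.mul_sum, ← Finset.mul_sum] at hsum
  unfold replayRate
  calc _ ≤ _ := add_le_add hroot hsum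
    _ = _ := by ring

/-! ### The number of replays -/

lemma sum_scheduleProb_le {N : ℕ} (e : Fin N) {t₀ t₁ : ℕ} (h01 : t₀ ≤ t₁) :
    ∑ u ∈ Finset.Icc t₀ t₁, scheduleProb t₀ u e ≤
      3 * ((duration e : ℝ) ^ (-(1 / 3) : ℝ) * ((t₁ + 1 - t₀ : ℕ) : ℝ) ^ (1 / 3 : ℝ)) := by
  have e1 : ∑ u ∈ Finset.Icc t₀ t₁, scheduleProb t₀ u e =
      ∑ n ∈ Finset.range (t₁ - t₀ + 1), scheduleProb t₀ (t₀ + n) e := by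
    rw [← Finset.Ico_succ_right_eq_Icc, Finset.sum_Ico_eq_sum_range]
    congr 2
    simp only [Nat.succ_eq_succ, Nat.succ_eq_add_one]
    omega
  rw [e1, Finset.sum_range_succ']
  have h0 : scheduleProb t₀ (t₀ + 0) e = 0 := by simp [scheduleProb]
  rw [h0, add_zero]
  have hd : (0 : ℝ) ≤ (duration e : ℝ) ^ (-(1 / 3) : ℝ) := by positivity
  calc _ ≤ ∑ n ∈ Finset.range (t₁ - t₀),
        (duration e : ℝ) ^ (-(1 / 3) : ℝ) * ((n : ℝ) + 1) ^ (-(2 / 3) : ℝ) := by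
        refine Finset.sum_le_sum fun n _ => (min_le_left _ _).trans ?_
        rw [if_neg (by omega)]
        push_cast
        rw [add_sub_cancel_left]
    _ ≤ (duration e : ℝ) ^ (-(1 / 3) : ℝ) * (3 * ((t₁ - t₀ : ℕ) : ℝ) ^ (1 / 3 : ℝ)) := by
        rw [← Finset.mul_sum]
        gcongr
        exact sum_rpow_neg_two_thirds_le _
    _ ≤ (duration e : ℝ) ^ (-(1 / 3) : ℝ) * (3 * ((t₁ + 1 - t₀ : ℕ) : ℝ) ^ (1 / 3 : ℝ)) := by
        gcongr
        omega
    _ = _ := by ring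

/-- In an episode of `n` rounds about `(n / m) ^ (1 / 3)` replays of duration `m` are scheduled,
each costing `min m n ^ (2 / 3)`. This is at most `n ^ (2 / 3)` per scale, and the logarithmic
fluctuation of the count costs no more. -/
lemma replayRate_le {t₀ t₁ : ℕ} (h01 : t₀ ≤ t₁) {B : ℕ → Fin (numScales T) → Bool}
    (hdur : ∀ u, dur u = 0 ∨ ∃ e, dur u = duration e ∧ B u e = true)
    (hcount : ∀ e, ∑ u ∈ Finset.Icc t₀ t₁, (if B u e then (1 : ℝ) else 0)
      ≤ 2 * ∑ u ∈ Finset.Icc t₀ t₁, scheduleProb t₀ u e + 8 * Real.log T) :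
    replayRate dur t₀ t₁ ≤ (1 + numScales T * (6 + 8 * Real.log T)) *
      ((t₁ + 1 - t₀ : ℕ) : ℝ) ^ (2 / 3 : ℝ) := by
  set n := t₁ + 1 - t₀ with hn
  have hn0 : (0 : ℝ) ≤ n := Nat.cast_nonneg n
  have hlog : 0 ≤ Real.log T := Real.log_natCast_nonneg T
  have h1 : ∀ s, ((min (dur s) n : ℕ) : ℝ) ^ (2 / 3 : ℝ) ≤
      ∑ e : Fin (numScales T), (if B s e then (1 : ℝ) else 0) *
        ((min (duration e) n : ℕ) : ℝ) ^ (2 / 3 : ℝ) := by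
    intro s
    rcases hdur s with h | ⟨e, h, hB⟩
    · rw [h]
      simp only [Nat.zero_min, Nat.cast_zero]
      rw [Real.zero_rpow (by norm_num)]
      refine Finset.sum_nonneg fun e _ => mul_nonneg ?_ (by positivity)
      split_ifs <;> norm_num
    · refine le_trans (le_of_eq ?_) (Finset.single_le_sum (f := fun e => (if B s e then (1 : ℝ) else 0)
        * ((min (duration e) n : ℕ) : ℝ) ^ (2 / 3 : ℝ)) (fun e _ => mul_nonneg ?_ (by positivity))
        (Finset.mem_univ e))
      · simp only [h, hB, if_true, one_mul]
      · split_ifs <;> norm_num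
  have h2 : ∑ s ∈ Finset.Icc t₀ t₁, ((min (dur s) n : ℕ) : ℝ) ^ (2 / 3 : ℝ) ≤
      ∑ e : Fin (numScales T), (6 + 8 * Real.log T) * (n : ℝ) ^ (2 / 3 : ℝ) := by
    refine (Finset.sum_le_sum fun s _ => h1 s).trans ?_
    rw [Finset.sum_comm]
    refine Finset.sum_le_sum fun e _ => ?_
    rw [← Finset.sum_mul]
    have hm : (0 : ℝ) < duration e := by unfold duration; positivity
    have hc := hcount e
    have hp := sum_scheduleProb_le e h01
    rw [← hn] at hp
    have hle : ((min (duration e) n : ℕ) : ℝ) ^ (2 / 3 : ℝ) ≤ (n : ℝ) ^ (2 / 3 : ℝ) :=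
      rpow_two_thirds_mono (min_le_right _ _)
    have hmix : (duration e : ℝ) ^ (-(1 / 3) : ℝ) * (n : ℝ) ^ (1 / 3 : ℝ) *
        ((min (duration e) n : ℕ) : ℝ) ^ (2 / 3 : ℝ) ≤ (n : ℝ) ^ (2 / 3 : ℝ) := by
      have hk0 : (0 : ℝ) ≤ (min (duration e) n : ℕ) := Nat.cast_nonneg _
      have hkm : ((min (duration e) n : ℕ) : ℝ) ^ (1 / 3 : ℝ) ≤ (duration e : ℝ) ^ (1 / 3 : ℝ) :=
        Real.rpow_le_rpow hk0 (by exact_mod_cast min_le_left _ _) (by norm_num)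
      have hkn : ((min (duration e) n : ℕ) : ℝ) ^ (1 / 3 : ℝ) ≤ (n : ℝ) ^ (1 / 3 : ℝ) :=
        Real.rpow_le_rpow hk0 (by exact_mod_cast min_le_right _ _) (by norm_num)
      rw [rpow_neg_third hm.le, rpow_two_thirds hk0, rpow_two_thirds hn0]
      have hmp := Real.rpow_pos_of_pos hm (1 / 3 : ℝ)
      have hkp := Real.rpow_nonneg hk0 (1 / 3 : ℝ)
      have hnp := Real.rpow_nonneg hn0 (1 / 3 : ℝ)
      set m := (duration e : ℝ) ^ (1 / 3 : ℝ)
      set k := ((min (duration e) n : ℕ) : ℝ) ^ (1 / 3 : ℝ)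
      set y := (n : ℝ) ^ (1 / 3 : ℝ)
      calc m⁻¹ * y * k ^ 2 = (m⁻¹ * k) * (y * k) := by ring
        _ ≤ 1 * (y * y) := by
          gcongr
          rw [inv_mul_le_iff₀ hmp]
          linarith
        _ = _ := by ring
    calc _ ≤ (2 * (3 * ((duration e : ℝ) ^ (-(1 / 3) : ℝ) * (n : ℝ) ^ (1 / 3 : ℝ)))
          + 8 * Real.log T) * ((min (duration e) n : ℕ) : ℝ) ^ (2 / 3 : ℝ) := by
          gcongr
          linarith
      _ = 6 * ((duration e : ℝ) ^ (-(1 / 3) : ℝ) * (n : ℝ) ^ (1 / 3 : ℝ) *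
            ((min (duration e) n : ℕ) : ℝ) ^ (2 / 3 : ℝ))
          + 8 * Real.log T * ((min (duration e) n : ℕ) : ℝ) ^ (2 / 3 : ℝ) := by ring
      _ ≤ 6 * (n : ℝ) ^ (2 / 3 : ℝ) + 8 * Real.log T * (n : ℝ) ^ (2 / 3 : ℝ) := by gcongr
      _ = _ := by ring
  unfold replayRate
  rw [← hn]
  simp only [Finset.sum_const, Finset.card_univ, Fintype.card_fin, nsmul_eq_mul] at h2
  linarith

end Episode

/-! ### Segments of large regret of a fixed arm -/

section Segments

variable (P : Environment K) (w : PMF (Fin K)) (T : ℕ) (A : ℝ) (a : Fin K)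

/-- The regret of arm `a` over `[s, t]` exceeds `A` times the rate. -/
def LargeRegret (s t : ℕ) : Prop :=
  s < t ∧ A * ((K : ℝ) ^ (1 / 3 : ℝ) * ((t - s : ℕ) : ℝ) ^ (2 / 3 : ℝ)) ≤
    ∑ u ∈ Finset.Icc s t, gap P w u a

open Classical in
/-- The first round of the segment that contains round `t₀ + n`: a new segment starts after the
regret over the current one became large, and with each phase. -/
def segmentAux (t₀ : ℕ) : ℕ → ℕ
  | 0 => t₀
  | n + 1 => if LargeRegret P w A a (segmentAux t₀ n) (t₀ + n) ∨
      phase P w T (t₀ + n) < phase P w T (t₀ + n + 1) then t₀ + n + 1 else segmentAux t₀ n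

/-- The first round of the segment that contains round `r`. -/
def segment (t₀ r : ℕ) : ℕ := segmentAux P w T A a t₀ (r - t₀)

lemma segment_self (t₀ : ℕ) : segment P w T A a t₀ t₀ = t₀ := by
  simp [segment, segmentAux]

open Classical in
lemma segment_succ {t₀ r : ℕ} (h : t₀ ≤ r) : segment P w T A a t₀ (r + 1) =
    if LargeRegret P w A a (segment P w T A a t₀ r) r ∨ phase P w T r < phase P w T (r + 1) then
      r + 1 else segment P w T A a t₀ r := by
  obtain ⟨n, rfl⟩ := Nat.exists_eq_add_of_le h
  unfold segment
  rw [show t₀ + n + 1 - t₀ = n + 1 by omega, show t₀ + n - t₀ = n by omega]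
  rfl

/-- Invariants of the greedy construction: until it closes, a segment has no large regret and stays
within one phase. -/
lemma segment_spec {t₀ r : ℕ} (h : t₀ ≤ r) :
    t₀ ≤ segment P w T A a t₀ r ∧ segment P w T A a t₀ r ≤ r ∧
    (∀ t, t < r → ¬ LargeRegret P w A a (segment P w T A a t₀ r) t) ∧
    phase P w T r = phase P w T (segment P w T A a t₀ r) ∧
    ∀ u, segment P w T A a t₀ r ≤ u → u ≤ r → segment P w T A a t₀ u = segment P w T A a t₀ r := by
  induction r, h using Nat.le_induction with
  | base =>
    rw [segment_self]
    refine ⟨le_rfl, le_rfl, fun t ht h => by have := h.1; omega, rfl, fun u h1 h2 => ?_⟩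
    obtain rfl : u = t₀ := by omega
    exact segment_self ..
  | succ r hr ih =>
    obtain ⟨h1, h2, h3, h4, h5⟩ := ih
    have hs := segment_succ P w T A a hr
    split_ifs at hs with hc
    · rw [hs]
      refine ⟨by omega, le_rfl, fun t ht h => by have := h.1; omega, rfl, fun u hu1 hu2 => ?_⟩
      obtain rfl : u = r + 1 := by omega
      exact hs
    · push Not at hc
      rw [hs]
      refine ⟨h1, by omega, fun t ht => ?_, ?_, fun u hu1 hu2 => ?_⟩
      · rcases Nat.lt_or_ge t r with h | h
        · exact h3 t h
        · obtain rfl : t = r := by omega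
          exact hc.1
      · rw [← h4]
        exact le_antisymm hc.2 (phase_mono P w T (Nat.le_succ r))
      · rcases Nat.lt_or_ge r u with h | h
        · obtain rfl : u = r + 1 := by omega
          exact hs
        · exact h5 u hu1 h

/-- Round `u` lies in the first half of a segment of large regret, and a replay of duration index
`e` launched there lasts until the end of the segment. -/
def Critical (t₀ u : ℕ) (e : Fin (numScales T)) : Prop :=
  ∃ t, t ≤ T ∧ LargeRegret P w A a (segment P w T A a t₀ u) t ∧
    (∀ t' < t, ¬ LargeRegret P w A a (segment P w T A a t₀ u) t') ∧
    phase P w T t = phase P w T (segment P w T A a t₀ u) ∧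
    segment P w T A a t₀ u < u ∧
    2 * (u - segment P w T A a t₀ u) ≤ t - segment P w T A a t₀ u ∧
    t - segment P w T A a t₀ u ≤ duration e ∧
    duration e < 2 * (t - segment P w T A a t₀ u)

open Classical in
/-- The duration index of the replays to look for at round `u`. -/
def criticalScale (t₀ u : ℕ) : Option (Fin (numScales T)) :=
  -- The choice depends only on the environment, `A`, `a` and `t₀`, so it is fixed before the run,
  -- as `scheduleFactor` requires.
  if h : ∃ e, Critical P w T A a t₀ u e then some h.choose else none

lemma critical_of_criticalScale {t₀ u : ℕ} {e : Fin (numScales T)}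
    (h : criticalScale P w T A a t₀ u = some e) : Critical P w T A a t₀ u e := by
  unfold criticalScale at h
  split_ifs at h with hc
  rw [← Option.some_injective _ h]
  exact hc.choose_spec

lemma exists_criticalScale {t₀ u : ℕ} {e : Fin (numScales T)} (h : Critical P w T A a t₀ u e) :
    ∃ e', criticalScale P w T A a t₀ u = some e' := by
  unfold criticalScale
  rw [dif_pos ⟨e, h⟩]
  exact ⟨_, rfl⟩

/-- The next power of two; `d ≤ T` keeps it among the available scales. -/
lemma exists_duration {d T : ℕ} (h2 : 2 ≤ d) (hT : d ≤ T) :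
    ∃ e : Fin (numScales T), d ≤ duration e ∧ duration e < 2 * d := by
  have h1 : 0 < Nat.clog 2 d := Nat.clog_pos (by norm_num) h2
  have h3 : Nat.clog 2 d ≤ Nat.clog 2 T := Nat.clog_mono_right 2 hT
  refine ⟨⟨Nat.clog 2 d - 1, by unfold numScales; omega⟩, ?_, ?_⟩
  · unfold duration
    simp only
    rw [Nat.sub_add_cancel h1]
    exact Nat.le_pow_clog (by norm_num) d
  · unfold duration
    simp only
    rw [pow_succ, mul_comm]
    have := Nat.pow_pred_clog_lt_self (b := 2) (by norm_num) (by omega : 1 < d)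
    rw [Nat.pred_eq_sub_one] at this
    omega

/-- The end of the segment of a critical round precedes all later segments. -/
lemma lt_segment_of_first {t₀ t₁ u t : ℕ} (h0u : t₀ ≤ u)
    (hu : u < segment P w T A a t₀ t₁) (ht₁ : t₀ ≤ t₁)
    (hfirst : ∀ t' < t, ¬ LargeRegret P w A a (segment P w T A a t₀ u) t')
    (hph : phase P w T t = phase P w T (segment P w T A a t₀ u)) :
    t < segment P w T A a t₀ t₁ := by
  by_contra hcon
  rw [not_lt] at hcon
  obtain ⟨-, h2, -, -, -⟩ := segment_spec P w T A a h0u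
  have key : ∀ v, u ≤ v → v ≤ t → segment P w T A a t₀ v = segment P w T A a t₀ u := by
    intro v hv
    induction v, hv using Nat.le_induction with
    | base => exact fun _ => rfl
    | succ v hv ih =>
      intro hvt
      have e := ih (by omega)
      rw [segment_succ P w T A a (h0u.trans hv), if_neg, e]
      rintro (h | h)
      · rw [e] at h
        exact hfirst v (by omega) h
      · have a1 := phase_mono P w T (h2.trans hv)
        have a2 := phase_mono P w T hvt
        omega
  have e1 := key _ hu.le hcon
  obtain ⟨-, g2, -, -, g5⟩ := segment_spec P w T A a ht₁
  have e2 := g5 _ le_rfl g2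
  omega

/-! ### Length, cost and firing probability of segments. -/

variable {A}

/-- Gaps are at most one, so `6 * K ^ (1 / 3) * d ^ (2 / 3) ≤ 2 * d` for the length `d = t - s`,
which forces `d ^ (1 / 3) ≥ 3 * K ^ (1 / 3)`. -/
lemma rate_le_of_largeRegret (hK : 0 < K) (hA : 6 ≤ A) {s t : ℕ} (h : LargeRegret P w A a s t) :
    27 * K ≤ t - s := by
  obtain ⟨hst, hle⟩ := h
  have h1 : ∑ u ∈ Finset.Icc s t, gap P w u a ≤ ((t + 1 - s : ℕ) : ℝ) := by
    calc _ ≤ ∑ u ∈ Finset.Icc s t, (1 : ℝ) := Finset.sum_le_sum fun u _ => gap_le_one P w u a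
      _ = _ := by simp
  have h2 : ((t + 1 - s : ℕ) : ℝ) ≤ 2 * ((t - s : ℕ) : ℝ) := by exact_mod_cast (by omega)
  have hd : (0 : ℝ) < ((t - s : ℕ) : ℝ) := by exact_mod_cast (by omega)
  have hK' : (0 : ℝ) < K := by exact_mod_cast hK
  have hy3 := rpow_third_pow_three hd.le
  have hk3 := rpow_third_pow_three hK'.le
  have hy := Real.rpow_pos_of_pos hd (1 / 3 : ℝ)
  have hk := Real.rpow_pos_of_pos hK' (1 / 3 : ℝ)
  rw [rpow_two_thirds hd.le] at hle
  set d := ((t - s : ℕ) : ℝ) with hdd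
  set y := d ^ (1 / 3 : ℝ)
  set k := (K : ℝ) ^ (1 / 3 : ℝ)
  have h3 : 6 * (k * y ^ 2) ≤ 2 * y ^ 3 := by
    calc 6 * (k * y ^ 2) ≤ A * (k * y ^ 2) := by gcongr
      _ ≤ 2 * y ^ 3 := by rw [hy3]; linarith
  have h4 : 3 * k ≤ y := by
    by_contra hc
    have : y * y ^ 2 < 3 * k * y ^ 2 := mul_lt_mul_of_pos_right (not_le.1 hc) (by positivity)
    nlinarith
  have h5 : (3 * k) ^ 3 ≤ y ^ 3 := pow_le_pow_left₀ (by positivity) h4 3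
  have h6 : 27 * (K : ℝ) ≤ d := by
    rw [← hk3, ← hy3]; linarith
  rw [hdd] at h6
  exact_mod_cast h6

/-- The regret of a segment without its last round being large. -/
lemma sum_gap_le (hK : 0 < K) (hA : 6 ≤ A) {s r n : ℕ} (hsr : s ≤ r) (hn : r - s < n)
    (hnot : ∀ t, t < r → ¬ LargeRegret P w A a s t) :
    ∑ u ∈ Finset.Icc s r, gap P w u a ≤
      (A + 1) * ((K : ℝ) ^ (1 / 3 : ℝ) * ((n : ℕ) : ℝ) ^ (2 / 3 : ℝ)) := by
  have hK1 : (1 : ℝ) ≤ K := by exact_mod_cast hK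
  have hk : (1 : ℝ) ≤ (K : ℝ) ^ (1 / 3 : ℝ) := Real.one_le_rpow hK1 (by norm_num)
  have hn1 : (1 : ℝ) ≤ n := by exact_mod_cast (by omega : 1 ≤ n)
  have hF : 1 ≤ (K : ℝ) ^ (1 / 3 : ℝ) * (n : ℝ) ^ (2 / 3 : ℝ) :=
    one_le_mul_of_one_le_of_one_le hk (Real.one_le_rpow hn1 (by norm_num))
  rcases Nat.lt_or_ge (s + 1) r with h | h
  · obtain ⟨r', rfl⟩ : ∃ r', r = r' + 1 := ⟨r - 1, by omega⟩
    have h1 := hnot r' (by omega)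
    unfold LargeRegret at h1
    push Not at h1
    have h2 := h1 (by omega)
    rw [Finset.sum_Icc_succ_top (by omega)]
    have h3 := gap_le_one P w (r' + 1) a
    have h4 : A * ((K : ℝ) ^ (1 / 3 : ℝ) * ((r' - s : ℕ) : ℝ) ^ (2 / 3 : ℝ)) ≤
        A * ((K : ℝ) ^ (1 / 3 : ℝ) * ((n : ℕ) : ℝ) ^ (2 / 3 : ℝ)) := by
      have := rpow_two_thirds_mono (show r' - s ≤ n by omega)
      gcongr
    linarith
  · have h1 : ∑ u ∈ Finset.Icc s r, gap P w u a ≤ ((r + 1 - s : ℕ) : ℝ) := by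
      calc _ ≤ ∑ u ∈ Finset.Icc s r, (1 : ℝ) := Finset.sum_le_sum fun u _ => gap_le_one P w u a
        _ = _ := by simp
    have h2 : ((r + 1 - s : ℕ) : ℝ) ≤ 2 := by exact_mod_cast (by omega)
    nlinarith

/-- The scheduler probabilities at the critical rounds of a segment of large regret. -/
lemma rate_le_sum_criticalProb (hK : 0 < K) (hA : 6 ≤ A) {t₀ t₁ r : ℕ} (h0 : t₀ ≤ r)
    (hr : r ≤ t₁) (h1 : t₁ ≤ T) (hbad : LargeRegret P w A a (segment P w T A a t₀ r) r) :
    ((r - segment P w T A a t₀ r : ℕ) : ℝ) ^ (2 / 3 : ℝ) ≤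
      4 * ((t₁ + 1 - t₀ : ℕ) : ℝ) ^ (2 / 3 : ℝ) *
        ∑ u ∈ Finset.Icc (segment P w T A a t₀ r) r,
          (criticalScale P w T A a t₀ u).elim 0 (scheduleProb t₀ u) := by
  obtain ⟨hs1, hs2, hs3, hs4, hs5⟩ := segment_spec P w T A a h0
  set s := segment P w T A a t₀ r with hs
  set d := r - s with hd
  have hd27 : 27 * K ≤ d := rate_le_of_largeRegret P w a hK hA hbad
  set n := t₁ + 1 - t₀ with hn
  have hd0 : (0 : ℝ) < d := by exact_mod_cast (by omega)
  have hn0 : (0 : ℝ) < n := by exact_mod_cast (by omega)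
  have hy := Real.rpow_pos_of_pos hd0 (1 / 3 : ℝ)
  have hx := Real.rpow_pos_of_pos hn0 (1 / 3 : ℝ)
  have hy3 := rpow_third_pow_three hd0.le
  have hx3 := rpow_third_pow_three hn0.le
  have hn1 : (1 : ℝ) ≤ (n : ℝ) ^ (1 / 3 : ℝ) := Real.one_le_rpow (by
    exact_mod_cast (by omega : 1 ≤ n)) (by norm_num)
  have hd1 : (1 : ℝ) ≤ (d : ℝ) ^ (1 / 3 : ℝ) := Real.one_le_rpow (by
    exact_mod_cast (by omega : 1 ≤ d)) (by norm_num)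
  rw [rpow_two_thirds hd0.le, rpow_two_thirds hn0.le]
  have hprob : ∀ u ∈ Finset.Icc (s + 1) (s + d / 2),
      3 / 4 * ((d : ℝ) ^ (1 / 3 : ℝ))⁻¹ * (((n : ℝ) ^ (1 / 3 : ℝ)) ^ 2)⁻¹ ≤
        (criticalScale P w T A a t₀ u).elim 0 (scheduleProb t₀ u) := by
    intro u hu
    rw [Finset.mem_Icc] at hu
    have hsu : segment P w T A a t₀ u = s := hs5 u (by omega) (by omega)
    obtain ⟨e₀, he1, he2⟩ := exists_duration (d := d) (T := T) (by omega) (by omega)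
    have hcrit : Critical P w T A a t₀ u e₀ := by
      refine ⟨r, hr.trans h1, ?_⟩
      rw [hsu]
      exact ⟨hbad, hs3, hs4, by omega, by omega, by omega, by omega⟩
    obtain ⟨e, he⟩ := exists_criticalScale P w T A a hcrit
    obtain ⟨t, -, hc2, hc3, -, -, -, -, hc8⟩ := critical_of_criticalScale P w T A a he
    rw [hsu] at hc2 hc3 hc8
    -- Both rounds are the first at which this segment has large regret, so the chosen duration is
    -- tied to `d`.
    have htr : t = r := by
      rcases Nat.lt_trichotomy t r with h | h | h
      · exact absurd hc2 (hs3 t h)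
      · exact h
      · exact absurd hbad (hc3 r h)
    rw [htr] at hc8
    rw [he, Option.elim_some, scheduleProb, if_neg (by omega)]
    have hu0 : (0 : ℝ) < (u : ℝ) - t₀ := by
      rw [sub_pos]; exact_mod_cast (by omega)
    have hun : (u : ℝ) - t₀ ≤ n := by
      have : u ≤ n + t₀ := by omega
      have : (u : ℝ) ≤ n + t₀ := by exact_mod_cast this
      linarith
    have hm0 : (0 : ℝ) < duration e := by unfold duration; positivity
    have hm : (duration e : ℝ) ≤ 2 * d := by exact_mod_cast hc8.le
    refine le_min ?_ ?_
    · rw [rpow_neg_third hm0.le, rpow_neg_two_thirds hu0.le]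
      have a1 : ((u : ℝ) - t₀) ^ (1 / 3 : ℝ) ≤ (n : ℝ) ^ (1 / 3 : ℝ) :=
        Real.rpow_le_rpow hu0.le hun (by norm_num)
      have a2 := Real.rpow_pos_of_pos hu0 (1 / 3 : ℝ)
      have a3 := Real.rpow_pos_of_pos hm0 (1 / 3 : ℝ)
      -- From `duration e ≤ 2 * d` and `2 ≤ (4 / 3) ^ 3`.
      have a4 : (duration e : ℝ) ^ (1 / 3 : ℝ) ≤ 4 / 3 * (d : ℝ) ^ (1 / 3 : ℝ) := by
        refine le_of_pow_le_pow_left₀ (n := 3) (by norm_num) (by positivity) ?_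
        rw [rpow_third_pow_three hm0.le, mul_pow, hy3]
        linarith
      calc 3 / 4 * ((d : ℝ) ^ (1 / 3 : ℝ))⁻¹ * (((n : ℝ) ^ (1 / 3 : ℝ)) ^ 2)⁻¹
          = (4 / 3 * (d : ℝ) ^ (1 / 3 : ℝ))⁻¹ * (((n : ℝ) ^ (1 / 3 : ℝ)) ^ 2)⁻¹ := by
            rw [mul_inv]; norm_num
        _ ≤ _ := by gcongr
    · have b1 : ((d : ℝ) ^ (1 / 3 : ℝ))⁻¹ ≤ 1 := inv_le_one_of_one_le₀ hd1
      have b2 : (((n : ℝ) ^ (1 / 3 : ℝ)) ^ 2)⁻¹ ≤ 1 := inv_le_one_of_one_le₀ (one_le_pow₀ hn1)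
      calc _ ≤ 3 / 4 * (1 : ℝ) * 1 := by gcongr
        _ ≤ 1 := by norm_num
  have hnn : ∀ u, 0 ≤ (criticalScale P w T A a t₀ u).elim 0 (scheduleProb t₀ u) := fun u =>
    elim_scheduleProb_nonneg _ t₀ u
  -- The first half provides at least `d / 3` critical rounds despite rounding.
  have hsum : (d : ℝ) / 3 * (3 / 4 * ((d : ℝ) ^ (1 / 3 : ℝ))⁻¹ * (((n : ℝ) ^ (1 / 3 : ℝ)) ^ 2)⁻¹) ≤
      ∑ u ∈ Finset.Icc s r, (criticalScale P w T A a t₀ u).elim 0 (scheduleProb t₀ u) := by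
    calc _ ≤ ((s + d / 2 + 1 - (s + 1) : ℕ) : ℝ) *
          (3 / 4 * ((d : ℝ) ^ (1 / 3 : ℝ))⁻¹ * (((n : ℝ) ^ (1 / 3 : ℝ)) ^ 2)⁻¹) := by
          have : (d : ℝ) ≤ 3 * ((s + d / 2 + 1 - (s + 1) : ℕ) : ℝ) := by exact_mod_cast (by omega)
          gcongr
          linarith
      _ = ∑ u ∈ Finset.Icc (s + 1) (s + d / 2),
          3 / 4 * ((d : ℝ) ^ (1 / 3 : ℝ))⁻¹ * (((n : ℝ) ^ (1 / 3 : ℝ)) ^ 2)⁻¹ := by simp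
      _ ≤ ∑ u ∈ Finset.Icc (s + 1) (s + d / 2),
          (criticalScale P w T A a t₀ u).elim 0 (scheduleProb t₀ u) := Finset.sum_le_sum hprob
      _ ≤ _ := Finset.sum_le_sum_of_subset_of_nonneg
          (Finset.Icc_subset_Icc (by omega) (by omega)) fun u _ _ => hnn u
  calc ((d : ℝ) ^ (1 / 3 : ℝ)) ^ 2 = 4 * ((n : ℝ) ^ (1 / 3 : ℝ)) ^ 2 * ((d : ℝ) / 3 *
        (3 / 4 * ((d : ℝ) ^ (1 / 3 : ℝ))⁻¹ * (((n : ℝ) ^ (1 / 3 : ℝ)) ^ 2)⁻¹)) := by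
        have e : ((d : ℝ) ^ (1 / 3 : ℝ)) ^ 2 = 4 * ((n : ℝ) ^ (1 / 3 : ℝ)) ^ 2 *
            (((d : ℝ) ^ (1 / 3 : ℝ)) ^ 3 / 3 *
            (3 / 4 * ((d : ℝ) ^ (1 / 3 : ℝ))⁻¹ * (((n : ℝ) ^ (1 / 3 : ℝ)) ^ 2)⁻¹)) := by
          field_simp
        rwa [hy3] at e
    _ ≤ _ := by gcongr

/-- The regret of a fixed arm up to the current segment. -/
lemma sum_gap_segments_le (hA : 6 ≤ A) {t₀ t₁ r : ℕ} (h00 : 1 ≤ t₀) (h0 : t₀ ≤ r)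
    (hr : r ≤ t₁) (h1 : t₁ ≤ T) :
    ∑ u ∈ Finset.Ico t₀ (segment P w T A a t₀ r), gap P w u a ≤
      (A + 1) * 4 * ((K : ℝ) ^ (1 / 3 : ℝ) * ((t₁ + 1 - t₀ : ℕ) : ℝ) ^ (2 / 3 : ℝ)) *
        ∑ u ∈ Finset.Ico t₀ (segment P w T A a t₀ r),
          (criticalScale P w T A a t₀ u).elim 0 (scheduleProb t₀ u) +
      (A + 1) * ∑ i ∈ Finset.Ico (phase P w T t₀) (phase P w T (segment P w T A a t₀ r)),
        rho P w T i := by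
  have hK := pos_of_pmf w
  have hk := Real.rpow_pos_of_pos (show (0 : ℝ) < K by exact_mod_cast hK) (1 / 3 : ℝ)
  induction r, h0 using Nat.le_induction with
  | base => simp [segment_self]
  | succ r h0 ih =>
    have ih := ih (by omega)
    rw [segment_succ P w T A a h0]
    by_cases hend : LargeRegret P w A a (segment P w T A a t₀ r) r ∨
        phase P w T r < phase P w T (r + 1)
    · rw [if_pos hend]
      obtain ⟨hs1, hs2, hs3, hs4, hs5⟩ := segment_spec P w T A a h0
      have hcrit := rate_le_sum_criticalProb P w T a hK hA h0 (show r ≤ t₁ by omega) h1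
      have hlen := sum_gap_le P w a hK hA (n := r + 1 - segment P w T A a t₀ r) hs2 (by omega) hs3
      set s := segment P w T A a t₀ r with hs
      have hph1 : phase P w T t₀ ≤ phase P w T s := phase_mono P w T hs1
      have hph2 : phase P w T s ≤ phase P w T (r + 1) := phase_mono P w T (by omega)
      have hsplit : ∀ f : ℕ → ℝ, ∑ u ∈ Finset.Ico t₀ (r + 1), f u =
          ∑ u ∈ Finset.Ico t₀ s, f u + ∑ u ∈ Finset.Icc s r, f u := by
        intro f
        rw [← Finset.Ico_succ_right_eq_Icc]
        exact (Finset.sum_Ico_consecutive f hs1 (Nat.le_succ_of_le hs2)).symm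
      have hsplit2 : ∑ i ∈ Finset.Ico (phase P w T t₀) (phase P w T (r + 1)), rho P w T i =
          ∑ i ∈ Finset.Ico (phase P w T t₀) (phase P w T s), rho P w T i +
          ∑ i ∈ Finset.Ico (phase P w T s) (phase P w T (r + 1)), rho P w T i :=
        (Finset.sum_Ico_consecutive _ hph1 hph2).symm
      have hrho : 0 ≤ ∑ i ∈ Finset.Ico (phase P w T s) (phase P w T (r + 1)), rho P w T i :=
        Finset.sum_nonneg fun i _ => rho_nonneg P w T i
      have hnn : 0 ≤ ∑ u ∈ Finset.Icc s r,
          (criticalScale P w T A a t₀ u).elim 0 (scheduleProb t₀ u) :=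
        Finset.sum_nonneg fun u _ => elim_scheduleProb_nonneg _ t₀ u
      rw [hsplit, hsplit, hsplit2]
      set F := (K : ℝ) ^ (1 / 3 : ℝ) * ((t₁ + 1 - t₀ : ℕ) : ℝ) ^ (2 / 3 : ℝ) with hF
      have hF0 : 0 ≤ F := by positivity
      set p := ∑ u ∈ Finset.Icc s r, (criticalScale P w T A a t₀ u).elim 0 (scheduleProb t₀ u)
      have hA1 : 0 ≤ A + 1 := by linarith
      suffices h : ∑ u ∈ Finset.Icc s r, gap P w u a ≤ (A + 1) * 4 * F * p +
          (A + 1) * ∑ i ∈ Finset.Ico (phase P w T s) (phase P w T (r + 1)), rho P w T i by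
        linarith
      -- A segment closed by large regret is paid by the firing probability of its critical rounds.
      -- One closed only by a phase change lies in its phase and is paid by the `rho` of that phase.
      by_cases hbad : LargeRegret P w A a s r
      · have h27 := rate_le_of_largeRegret P w a hK hA hbad
        have h2 : ∑ u ∈ Finset.Icc s r, gap P w u a ≤
            (A + 1) * ((K : ℝ) ^ (1 / 3 : ℝ) * ((r - s : ℕ) : ℝ) ^ (2 / 3 : ℝ)) := by
          obtain ⟨r', rfl⟩ : ∃ r', r = r' + 1 := ⟨r - 1, by omega⟩
          have a1 := hs3 r' (by omega)
          unfold LargeRegret at a1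
          push Not at a1
          have a2 := a1 (by omega)
          rw [Finset.sum_Icc_succ_top (by omega)]
          have a3 := gap_le_one P w (r' + 1) a
          have a4 := rpow_two_thirds_mono (show r' - s ≤ r' + 1 - s by omega)
          have a5 : A * ((K : ℝ) ^ (1 / 3 : ℝ) * ((r' - s : ℕ) : ℝ) ^ (2 / 3 : ℝ)) ≤
            A * ((K : ℝ) ^ (1 / 3 : ℝ) * ((r' + 1 - s : ℕ) : ℝ) ^ (2 / 3 : ℝ)) := by gcongr
          have a6 : 1 ≤ (K : ℝ) ^ (1 / 3 : ℝ) * ((r' + 1 - s : ℕ) : ℝ) ^ (2 / 3 : ℝ) :=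
            one_le_mul_of_one_le_of_one_le
              (Real.one_le_rpow (by exact_mod_cast hK) (by norm_num))
              (Real.one_le_rpow (by exact_mod_cast (by omega : 1 ≤ r' + 1 - s)) (by norm_num))
          linarith
        have h3 : (A + 1) * ((K : ℝ) ^ (1 / 3 : ℝ) * ((r - s : ℕ) : ℝ) ^ (2 / 3 : ℝ)) ≤
            (A + 1) * ((K : ℝ) ^ (1 / 3 : ℝ) *
              (4 * ((t₁ + 1 - t₀ : ℕ) : ℝ) ^ (2 / 3 : ℝ) * p)) := by
          have := hcrit hbad
          gcongr
        have h4 : (A + 1) * ((K : ℝ) ^ (1 / 3 : ℝ) *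
              (4 * ((t₁ + 1 - t₀ : ℕ) : ℝ) ^ (2 / 3 : ℝ) * p)) = (A + 1) * 4 * F * p := by
          rw [hF]; ring
        have h5 : 0 ≤ (A + 1) *
            ∑ i ∈ Finset.Ico (phase P w T s) (phase P w T (r + 1)), rho P w T i := by positivity
        linarith
      · have hlt : phase P w T s < phase P w T (r + 1) := hs4 ▸ hend.resolve_left hbad
        have h2 : (K : ℝ) ^ (1 / 3 : ℝ) * ((r + 1 - s : ℕ) : ℝ) ^ (2 / 3 : ℝ) ≤
            rho P w T (phase P w T s) := by
          have := rate_le_sum_rho P w T (t₀ := s) (t₁ := r) (by omega) hs2 (by omega)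
          rw [hs4, Finset.Icc_self, Finset.sum_singleton] at this
          refine le_trans (le_of_eq ?_) this
          rw [Nat.cast_sub (by omega)]
          push_cast
          ring_nf
        have h3 : rho P w T (phase P w T s) ≤
            ∑ i ∈ Finset.Ico (phase P w T s) (phase P w T (r + 1)), rho P w T i :=
          Finset.single_le_sum (f := rho P w T) (fun i _ => rho_nonneg P w T i)
            (Finset.mem_Ico.2 ⟨le_rfl, hlt⟩)
        have h4 : 0 ≤ (A + 1) * 4 * F * p := by positivity
        have h5 := mul_le_mul_of_nonneg_left (h2.trans h3) hA1
        linarith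
    · rw [if_neg hend]
      exact ih

end Segments

/-! ### The regret of an episode -/

/-- `1 / 2 ≤ (4 / 5) ^ 3` and `(4 / 5) ^ 2 ≤ 2 / 3`. A factor below one leaves substantial regret
for the second half of a segment. -/
lemma half_rpow_two_thirds_le {x d : ℝ} (hx : 0 ≤ x) (hxd : x ≤ d / 2) :
    x ^ (2 / 3 : ℝ) ≤ 2 / 3 * d ^ (2 / 3 : ℝ) := by
  have hd : 0 ≤ d := by linarith
  rw [rpow_two_thirds hx, rpow_two_thirds hd]
  have h1 : x ^ (1 / 3 : ℝ) ≤ 4 / 5 * d ^ (1 / 3 : ℝ) := by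
    refine le_of_pow_le_pow_left₀ (n := 3) (by norm_num) (by positivity) ?_
    rw [rpow_third_pow_three hx, mul_pow, rpow_third_pow_three hd]
    linarith
  have h2 := Real.rpow_nonneg hx (1 / 3 : ℝ)
  have h3 := Real.rpow_nonneg hd (1 / 3 : ℝ)
  nlinarith

section EpisodeRegret

variable {P : Environment K} {w : PMF (Fin K)} {c c₁ κ : ℝ} {T : ℕ} {log : ℕ → RoundLog K}
  {ep cs dur : ℕ → ℕ}

/-- A long replay launched in the first half of a segment of large regret evicts the arm. -/
lemma IsTrace.not_long_replay (htr : IsTrace c κ T log ep cs dur) (hκ : 0 < κ) (hκ1 : κ ≤ 1)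
    (hT : 2 ≤ T) (hc1 : 0 ≤ c₁) (hc : c₁ + 2 ≤ c) (hconc : Concentrates P w c₁ T log)
    {t₀ t₁ : ℕ} (h0 : 1 ≤ t₀) (h1 : t₁ ≤ T) (hep : ∀ t ∈ Finset.Icc t₀ t₁, ep t = t₀) {a : Fin K}
    (ha : a ∈ retained c T log t₀ t₁) {s t r : ℕ} (hs : t₀ ≤ s) (ht : t < t₁)
    (hbad : LargeRegret P w (3 * evictionCoef c c₁ κ T) a s t)
    (hnot : ∀ t' < t, ¬ LargeRegret P w (3 * evictionCoef c c₁ κ T) a s t')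
    (hph : phase P w T t = phase P w T s) (hsr : s < r) (hr : 2 * (r - s) ≤ t - s)
    (hdur : t - s ≤ dur r) : False := by
  have hK := pos_of_pmf w
  have hlog : 0 ≤ Real.log T := Real.log_natCast_nonneg T
  have hE : 2 ≤ evictionCoef c c₁ κ T := two_le_evictionCoef hκ (by linarith)
  have hKd := rate_le_of_largeRegret P w a hK (by linarith) hbad
  -- The competitor is the safe arm of the phase: an eviction since round `r` would certify
  -- significant regret within the phase.
  obtain ⟨b, hb⟩ := exists_safe_arm P w T (show 1 ≤ t by omega) (show t ≤ T by omega)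
  have hsw1 : switch P w T (phase P w T t) ≤ s := hph ▸ switch_phase_le P w T (h0.trans hs)
  have hsw2 : t < switch P w T (phase P w T t + 1) :=
    lt_switch_phase_succ P w T (show t ≤ T by omega)
  -- The replay has started by the midpoint, so the second half is entirely available for the test
  -- against `b`.
  set m := s + (t - s) / 2 with hm
  have hcs : ∀ u, r ≤ u → u ≤ t → r ≤ cs u := fun u hu1 hu2 =>
    htr.cs_max u (by omega) r (by rw [hep u (Finset.mem_Icc.2 ⟨by omega, by omega⟩)]; omega) hu1
      (by omega) (by omega)
  have hact : ∀ u ∈ Finset.Icc (m + 1) t, a ∈ (log u).active ∧ b ∈ (log u).active := by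
    intro u hu
    rw [Finset.mem_Icc] at hu
    have hru := hcs u (by omega) hu.2
    refine ⟨htr.retained_subset_active (by omega) (by omega) (by omega) ha, ?_⟩
    rw [htr.active_eq u (by omega), mem_retained]
    intro s₁ s₂ x1 x2 x3 hev
    exact hb s₁ s₂ (by omega) x2 (by omega)
      (significantRegret_of_evicts hT hc hconc (by omega) x2 (by omega) hev)
  have hup := sum_score_le_of_not_evicts (c := c) hconc (s₁ := m + 1) (s₂ := t) (by omega) (by omega)
    (by omega) hact (mem_retained.1 ha (m + 1) t (by omega) (by omega) ht)
  have hth := threshold_le hκ hκ1 hK (log := log) (s₁ := m + 1) (s₂ := t) (l := t - s) (by omega)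
    (by omega) (by omega) fun u hu1 hu2 =>
      ⟨u - cs u, by have := hcs u (by omega) hu2; omega, htr.rate_eq u (by omega)⟩
  have hgapb := hb (m + 1) t (by omega) (by omega) hsw2
  unfold SignificantRegret at hgapb
  rw [not_le] at hgapb
  have hfirst := hnot m (by omega)
  unfold LargeRegret at hfirst
  push Not at hfirst
  have hfirst := hfirst (by omega)
  have hsplit : ∑ u ∈ Finset.Icc s t, gap P w u a =
      ∑ u ∈ Finset.Icc s m, gap P w u a + ∑ u ∈ Finset.Icc (m + 1) t, gap P w u a := by
    rw [← Finset.Ico_succ_right_eq_Icc, ← Finset.Ico_succ_right_eq_Icc,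
      ← Finset.Ico_succ_right_eq_Icc]
    simp only [Nat.succ_eq_succ, Nat.succ_eq_add_one]
    exact (Finset.sum_Ico_consecutive (fun u => gap P w u a) (by omega) (by omega)).symm
  have hdiff : ∑ u ∈ Finset.Icc (m + 1) t, (score P w u b - score P w u a) =
      ∑ u ∈ Finset.Icc (m + 1) t, gap P w u a - ∑ u ∈ Finset.Icc (m + 1) t, gap P w u b := by
    rw [← Finset.sum_sub_distrib]
    exact Finset.sum_congr rfl fun u _ => (gap_sub_gap P w u a b).symm
  have hhalf : ((m - s : ℕ) : ℝ) ^ (2 / 3 : ℝ) ≤ 2 / 3 * ((t - s : ℕ) : ℝ) ^ (2 / 3 : ℝ) := by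
    refine half_rpow_two_thirds_le (Nat.cast_nonneg _) ?_
    have : 2 * (m - s) ≤ t - s := by omega
    have : 2 * ((m - s : ℕ) : ℝ) ≤ ((t - s : ℕ) : ℝ) := by exact_mod_cast this
    linarith
  have hbd : ((t : ℝ) - (m + 1 : ℕ)) ^ (2 / 3 : ℝ) ≤ ((t - s : ℕ) : ℝ) ^ (2 / 3 : ℝ) := by
    rw [← Nat.cast_sub (by omega)]
    exact rpow_two_thirds_mono (by omega)
  have hlarge := hbad.2
  have hk := Real.rpow_pos_of_pos (show (0 : ℝ) < K by exact_mod_cast hK) (1 / 3 : ℝ)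
  set k := (K : ℝ) ^ (1 / 3 : ℝ)
  set D := ((t - s : ℕ) : ℝ) ^ (2 / 3 : ℝ)
  have hkD : 0 < k * D := by
    have : (0 : ℝ) < ((t - s : ℕ) : ℝ) := by exact_mod_cast (by omega)
    positivity
  have i1 : (c + c₁) * Real.log T * threshold log (m + 1) t ≤
      (c + c₁) * Real.log T * (3 / κ * (k * D)) :=
    mul_le_mul_of_nonneg_left hth (mul_nonneg (by linarith) hlog)
  have i2 : k * ((t : ℝ) - (m + 1 : ℕ)) ^ (2 / 3 : ℝ) ≤ k * D := by gcongr
  have i3 : 3 * evictionCoef c c₁ κ T * (k * ((m - s : ℕ) : ℝ) ^ (2 / 3 : ℝ)) ≤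
      3 * evictionCoef c c₁ κ T * (k * (2 / 3 * D)) := by gcongr
  have i4 : (c + c₁) * Real.log T * (3 / κ * (k * D)) = (evictionCoef c c₁ κ T - 2) * (k * D) := by
    unfold evictionCoef; ring
  -- With `E = evictionCoef` the total regret is at least `3 E k D`. The first half contributes less
  -- than `2 E k D`, the second less than `(E - 2) k D` relative to `b` plus `k D` for `b` itself:
  -- together less than `(3 E - 1) k D`.
  nlinarith

/-- The regret of an arm that is never evicted from the episode. -/
lemma IsTrace.sum_gap_retained_le (htr : IsTrace c κ T log ep cs dur) (hκ : 0 < κ) (hκ1 : κ ≤ 1)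
    (hT : 2 ≤ T) (hc1 : 0 ≤ c₁) (hc : c₁ + 2 ≤ c) (hconc : Concentrates P w c₁ T log)
    {t₀ t₁ : ℕ} (h0 : 1 ≤ t₀) (h01 : t₀ ≤ t₁) (h1 : t₁ ≤ T)
    (hep : ∀ t ∈ Finset.Icc t₀ t₁, ep t = t₀) {a : Fin K} (ha : a ∈ retained c T log t₀ t₁)
    {B : ℕ → Fin (numScales T) → Bool} (hB : ∀ u e, B u e = true → duration e ≤ dur u)
    (hlucky : ∀ t₂, t₂ ≤ t₁ → (∀ u ∈ Finset.Icc t₀ t₂, ∀ e,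
        criticalScale P w T (3 * evictionCoef c c₁ κ T) a t₀ u = some e → B u e = false) →
      ∑ u ∈ Finset.Icc t₀ t₂, (criticalScale P w T (3 * evictionCoef c c₁ κ T) a t₀ u).elim 0
        (scheduleProb t₀ u) ≤ 16 * Real.log T) :
    ∑ u ∈ Finset.Icc t₀ t₁, gap P w u a ≤
      (3 * evictionCoef c c₁ κ T + 1) * (64 * Real.log T + 2) *
        ∑ i ∈ Finset.Icc (phase P w T t₀) (phase P w T t₁), rho P w T i := by
  have hK := pos_of_pmf w
  have hlog : 0 ≤ Real.log T := Real.log_natCast_nonneg T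
  have hE : 2 ≤ evictionCoef c c₁ κ T := two_le_evictionCoef hκ (by linarith)
  set A := 3 * evictionCoef c c₁ κ T with hA
  have hA6 : 6 ≤ A := by linarith
  obtain ⟨hs1, hs2, hs3, hs4, -⟩ := segment_spec P w T A a h01
  have hmain := sum_gap_segments_le P w T a hA6 h0 h01 le_rfl h1
  have hlast := sum_gap_le P w a hK hA6 (n := t₁ + 1 - t₀) hs2 (by omega) hs3
  -- A critical replay before the last segment would have evicted `a`; the last segment may still be
  -- open and is bounded directly.
  have hno : ∀ u ∈ Finset.Ico t₀ (segment P w T A a t₀ t₁), ∀ e,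
      criticalScale P w T A a t₀ u = some e → B u e = false := by
    intro u hu e he
    rw [Finset.mem_Ico] at hu
    by_contra hcon
    rw [Bool.not_eq_false] at hcon
    obtain ⟨t, -, c2, c3, c4, c5, c6, c7, -⟩ := critical_of_criticalScale P w T A a he
    have hlt := lt_segment_of_first P w T A a hu.1 hu.2 h01 c3 c4
    exact htr.not_long_replay hκ hκ1 hT hc1 hc hconc h0 h1 hep ha
      (segment_spec P w T A a hu.1).1 (by omega) c2 c3 c4 c5 c6 (c7.trans (hB u e hcon))
  have hprob : ∑ u ∈ Finset.Ico t₀ (segment P w T A a t₀ t₁),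
      (criticalScale P w T A a t₀ u).elim 0 (scheduleProb t₀ u) ≤ 16 * Real.log T := by
    obtain ⟨t₂, ht₂⟩ : ∃ t₂, segment P w T A a t₀ t₁ = t₂ + 1 :=
      ⟨segment P w T A a t₀ t₁ - 1, by omega⟩
    have e : Finset.Ico t₀ (segment P w T A a t₀ t₁) = Finset.Icc t₀ t₂ := by
      ext u
      simp only [Finset.mem_Ico, Finset.mem_Icc]
      omega
    rw [e] at hno ⊢
    exact hlucky t₂ (by omega) hno
  set s := segment P w T A a t₀ t₁ with hs
  have hsplit : ∑ u ∈ Finset.Icc t₀ t₁, gap P w u a =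
      ∑ u ∈ Finset.Ico t₀ s, gap P w u a + ∑ u ∈ Finset.Icc s t₁, gap P w u a := by
    rw [← Finset.Ico_succ_right_eq_Icc, ← Finset.Ico_succ_right_eq_Icc]
    exact (Finset.sum_Ico_consecutive (fun u => gap P w u a) hs1 (Nat.le_succ_of_le hs2)).symm
  have hrate := rate_le_sum_rho P w T h0 h01 h1
  have hcast : ((t₁ + 1 - t₀ : ℕ) : ℝ) = (t₁ : ℝ) + 1 - t₀ := by
    rw [Nat.cast_sub (by omega)]
    push_cast
    ring
  rw [← hcast] at hrate
  have hsub : ∑ i ∈ Finset.Ico (phase P w T t₀) (phase P w T s), rho P w T i ≤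
      ∑ i ∈ Finset.Icc (phase P w T t₀) (phase P w T t₁), rho P w T i := by
    refine Finset.sum_le_sum_of_subset_of_nonneg ?_ fun i _ _ => rho_nonneg P w T i
    intro i hi
    rw [Finset.mem_Ico] at hi
    rw [Finset.mem_Icc]
    omega
  set S := ∑ i ∈ Finset.Icc (phase P w T t₀) (phase P w T t₁), rho P w T i
  set F := (K : ℝ) ^ (1 / 3 : ℝ) * ((t₁ + 1 - t₀ : ℕ) : ℝ) ^ (2 / 3 : ℝ) with hF
  have hF0 : 0 ≤ F := by positivity
  rw [hsplit]
  calc _ ≤ ((A + 1) * 4 * F * (16 * Real.log T) + (A + 1) * S) + (A + 1) * F := by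
        refine add_le_add (hmain.trans (add_le_add ?_ ?_)) hlast
        · gcongr
        · gcongr
    _ ≤ ((A + 1) * 4 * S * (16 * Real.log T) + (A + 1) * S) + (A + 1) * S := by gcongr
    _ = _ := by ring

/-- Exploration costs at most `η` because gaps are at most one; the uniform part is compared with
the reference arm `b`. -/
lemma ev_playLaw_gap_le (P : Environment K) (w : PMF (Fin K)) {η : ℝ} (h0 : 0 ≤ η) (h1 : η ≤ 1)
    (t : ℕ) {A : Finset (Fin K)} {b : Fin K} (hb : b ∈ A) :
    ev (playLaw w η A) (gap P w t) ≤
      η + (A.card : ℝ)⁻¹ * ∑ a ∈ A, (score P w t b - score P w t a) + gap P w t b := by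
  rw [ev_playLaw w h0 h1 ⟨b, hb⟩]
  have hcard : (0 : ℝ) < A.card := by exact_mod_cast Finset.card_pos.2 ⟨b, hb⟩
  have e1 : (A.card : ℝ)⁻¹ * ∑ a ∈ A, gap P w t a =
      (A.card : ℝ)⁻¹ * ∑ a ∈ A, (score P w t b - score P w t a) + gap P w t b := by
    have : ∀ a, gap P w t a = (score P w t b - score P w t a) + gap P w t b := fun a => by
      rw [← gap_sub_gap]; ring
    rw [Finset.sum_congr rfl fun a _ => this a, Finset.sum_add_distrib, Finset.sum_const,
      nsmul_eq_mul, mul_add]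
    congr 1
    field_simp
  have e2 : 0 ≤ (A.card : ℝ)⁻¹ * ∑ a ∈ A, gap P w t a :=
    mul_nonneg (by positivity) (Finset.sum_nonneg fun a _ => gap_nonneg P w t a)
  have e3 : ev w (gap P w t) ≤ 1 :=
    (ev_mono w fun a => gap_le_one P w t a).trans (ev_const w 1).le
  rw [add_assoc, ← e1]
  set y := (A.card : ℝ)⁻¹ * ∑ a ∈ A, gap P w t a
  nlinarith

/-- What is required of the schedulers and of the estimates of a run. -/
structure IsGood (P : Environment K) (w : PMF (Fin K)) (c c₁ κ : ℝ) (T : ℕ)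
    (log : ℕ → RoundLog K) (ep dur : ℕ → ℕ) (B : ℕ → Fin (numScales T) → Bool) : Prop where
  conc : Concentrates P w c₁ T log
  dur_eq : ∀ u, dur u = 0 ∨ ∃ e, dur u = duration e ∧ B u e = true
  le_dur : ∀ u e, B u e = true → duration e ≤ dur u
  count : ∀ t₀ t₁, 1 ≤ t₀ → t₁ ≤ T → (∀ t ∈ Finset.Icc t₀ t₁, ep t = t₀) → ∀ e,
    ∑ u ∈ Finset.Icc t₀ t₁, (if B u e then (1 : ℝ) else 0)
      ≤ 2 * ∑ u ∈ Finset.Icc t₀ t₁, scheduleProb t₀ u e + 8 * Real.log T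
  lucky : ∀ a t₀ t₁, 1 ≤ t₀ → t₁ ≤ T → (∀ t ∈ Finset.Icc t₀ t₁, ep t = t₀) →
    (∀ u ∈ Finset.Icc t₀ t₁, ∀ e,
      criticalScale P w T (3 * evictionCoef c c₁ κ T) a t₀ u = some e → B u e = false) →
    ∑ u ∈ Finset.Icc t₀ t₁, (criticalScale P w T (3 * evictionCoef c c₁ κ T) a t₀ u).elim 0
      (scheduleProb t₀ u) ≤ 16 * Real.log T

/-- The coefficient of the rate in the regret of an episode. -/
def episodeCoef (c c₁ κ : ℝ) (T : ℕ) : ℝ :=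
  (3 + 2 * (evictionCoef c c₁ κ T * (1 + Real.log T))) *
      (1 + numScales T * (6 + 8 * Real.log T)) +
    (3 * evictionCoef c c₁ κ T + 1) * (64 * Real.log T + 2)

/-- The reference arm is one still retained at the start of round `t₁`. The coefficient adds
exploration, differences to this arm along nested replays, and the gap of the arm itself. -/
lemma IsTrace.episode_regret_le (htr : IsTrace c κ T log ep cs dur) (hκ : 0 < κ) (hκ1 : κ ≤ 1)
    (hT : 2 ≤ T) (hKT : K ≤ T) (hc1 : 0 ≤ c₁) (hc : c₁ + 2 ≤ c)
    {B : ℕ → Fin (numScales T) → Bool} (hgood : IsGood P w c c₁ κ T log ep dur B)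
    {t₁ : ℕ} (ht : 1 ≤ t₁) (h1 : t₁ ≤ T) :
    ∑ t ∈ Finset.Icc (ep t₁) t₁, ev (playLaw w (log t).rate (log t).active) (gap P w t) ≤
      episodeCoef c c₁ κ T *
        ∑ i ∈ Finset.Icc (phase P w T (ep t₁)) (phase P w T t₁), rho P w T i := by
  have hK := pos_of_pmf w
  have hlog : 0 ≤ Real.log T := Real.log_natCast_nonneg T
  have hlogK : 0 ≤ Real.log K := Real.log_natCast_nonneg K
  have hlogKT : Real.log K ≤ Real.log T :=
    Real.log_le_log (by exact_mod_cast hK) (by exact_mod_cast hKT)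
  have hE : 2 ≤ evictionCoef c c₁ κ T := two_le_evictionCoef hκ (by linarith)
  obtain ⟨b, hb⟩ := htr.retained_nonempty w ht
  have h0 := htr.one_le_ep ht
  have h01 := htr.ep_le ht
  have hep : ∀ t ∈ Finset.Icc (ep t₁) t₁, ep t = ep t₁ := fun t h =>
    htr.ep_eq_of_mem ht (Finset.mem_Icc.1 h).1 (Finset.mem_Icc.1 h).2
  set t₀ := ep t₁ with ht₀
  have hround : ∀ t ∈ Finset.Icc t₀ t₁, ev (playLaw w (log t).rate (log t).active) (gap P w t) ≤
      (log t).rate + meanDiff P w c T log b (cs t) t + gap P w t b := by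
    intro t h
    have hh := Finset.mem_Icc.1 h
    have ht1 : 1 ≤ t := h0.trans hh.1
    have hbt : b ∈ (log t).active := htr.retained_subset_active ht1
      ((hep t h) ▸ htr.le_cs t ht1) hh.2 hb
    have hr := htr.rate_eq t ht1
    have := ev_playLaw_gap_le P w (η := (log t).rate)
      (hr ▸ (learningRate_pos hK hκ _).le) (hr ▸ (learningRate_le K κ _).trans hκ1) t hbt
    rw [meanDiff, ← htr.active_eq t ht1]
    exact this
  have g1 := htr.sum_rate_le hK hκ hκ1 h0 h01 hep
  have g2 := htr.sum_meanDiff_cs_le hκ hκ1 (by linarith) hgood.conc h0 h01 h1 hep hb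
  have g3 := htr.sum_gap_retained_le hκ hκ1 hT hc1 hc hgood.conc h0 h01 h1 hep hb hgood.le_dur
    fun t₂ ht₂ => hgood.lucky b t₀ t₂ h0 (ht₂.trans h1) fun t h =>
      hep t (Finset.Icc_subset_Icc_right ht₂ h)
  have g4 := replayRate_le h01 hgood.dur_eq (hgood.count t₀ t₁ h0 h1 hep)
  have hrate := rate_le_sum_rho P w T h0 h01 h1
  have hcast : ((t₁ + 1 - t₀ : ℕ) : ℝ) = (t₁ : ℝ) + 1 - t₀ := by
    rw [Nat.cast_sub (by omega)]
    push_cast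
    ring
  rw [← hcast] at hrate
  set S := ∑ i ∈ Finset.Icc (phase P w T t₀) (phase P w T t₁), rho P w T i
  have hG0 : 0 ≤ replayRate dur t₀ t₁ := by unfold replayRate; positivity
  set G := replayRate dur t₀ t₁
  set E := evictionCoef c c₁ κ T
  set L := 1 + numScales T * (6 + 8 * Real.log T) with hL
  have hL0 : 0 ≤ L := by positivity
  have hkG : (K : ℝ) ^ (1 / 3 : ℝ) * G ≤ L * S := by
    calc (K : ℝ) ^ (1 / 3 : ℝ) * G
        ≤ (K : ℝ) ^ (1 / 3 : ℝ) * (L * ((t₁ + 1 - t₀ : ℕ) : ℝ) ^ (2 / 3 : ℝ)) := by gcongr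
      _ = L * ((K : ℝ) ^ (1 / 3 : ℝ) * ((t₁ + 1 - t₀ : ℕ) : ℝ) ^ (2 / 3 : ℝ)) := by ring
      _ ≤ L * S := by gcongr
  calc _ ≤ ∑ t ∈ Finset.Icc t₀ t₁,
        ((log t).rate + meanDiff P w c T log b (cs t) t + gap P w t b) := Finset.sum_le_sum hround
    _ = ∑ t ∈ Finset.Icc t₀ t₁, (log t).rate +
        ∑ t ∈ Finset.Icc t₀ t₁, meanDiff P w c T log b (cs t) t +
        ∑ t ∈ Finset.Icc t₀ t₁, gap P w t b := by
        rw [Finset.sum_add_distrib, Finset.sum_add_distrib]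
    _ ≤ 3 * ((K : ℝ) ^ (1 / 3 : ℝ) * G) +
        2 * (E * (1 + Real.log K)) * ((K : ℝ) ^ (1 / 3 : ℝ) * G) +
        (3 * E + 1) * (64 * Real.log T + 2) * S := add_le_add (add_le_add g1 g2) g3
    _ ≤ 3 * (L * S) + 2 * (E * (1 + Real.log T)) * (L * S) +
        (3 * E + 1) * (64 * Real.log T + 2) * S := by gcongr
    _ = _ := by
        unfold episodeCoef
        ring

lemma episodeCoef_nonneg (hκ : 0 < κ) (hcc : 0 ≤ c + c₁) : 0 ≤ episodeCoef c c₁ κ T := by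
  have hlog : 0 ≤ Real.log T := Real.log_natCast_nonneg T
  have hE : 2 ≤ evictionCoef c c₁ κ T := two_le_evictionCoef hκ hcc
  unfold episodeCoef
  generalize evictionCoef c c₁ κ T = E at hE
  have hE0 : 0 ≤ E := by linarith
  positivity

/-! ### The regret of a run -/

/-- A completed episode cannot lie within one phase, so consecutive episodes share at most one phase
and a phase meets at most two episodes. Phases before the current one are counted twice, the current
one once so far. -/
lemma IsTrace.regret_before_le (htr : IsTrace c κ T log ep cs dur) (hκ : 0 < κ) (hκ1 : κ ≤ 1)
    (hT : 2 ≤ T) (hKT : K ≤ T) (hc1 : 0 ≤ c₁) (hc : c₁ + 2 ≤ c)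
    {B : ℕ → Fin (numScales T) → Bool} (hgood : IsGood P w c c₁ κ T log ep dur B)
    {t : ℕ} (ht : 1 ≤ t) (htT : t ≤ T) :
    ∑ u ∈ Finset.Ico 1 (ep t), ev (playLaw w (log u).rate (log u).active) (gap P w u) ≤
      episodeCoef c c₁ κ T * (2 * ∑ i ∈ Finset.range (phase P w T (ep t)), rho P w T i
        + rho P w T (phase P w T (ep t))) := by
  have hQ : 0 ≤ episodeCoef c c₁ κ T := episodeCoef_nonneg hκ (by linarith)
  have hrho := rho_nonneg P w T
  induction t, ht using Nat.le_induction with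
  | base =>
    rw [htr.ep_one, Finset.Ico_self, Finset.sum_empty]
    have : 0 ≤ ∑ i ∈ Finset.range (phase P w T 1), rho P w T i :=
      Finset.sum_nonneg fun i _ => hrho i
    have := hrho (phase P w T 1)
    exact mul_nonneg hQ (by linarith)
  | succ t ht ih =>
    have ih := ih (by omega)
    rcases htr.ep_succ t ht with ⟨h, -⟩ | ⟨h, hempty⟩
    · rw [h]; exact ih
    · rw [h]
      have h0 := htr.one_le_ep ht
      have h01 := htr.ep_le ht
      have hepi := htr.episode_regret_le hκ hκ1 hT hKT hc1 hc hgood ht (by omega : t ≤ T)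
      -- The restart means that every arm was evicted over an interval of the episode, hence had
      -- significant regret there.
      have hall : AllArmsUnsafe P w (ep t) t := by
        intro a
        have ha : a ∉ retained c T log (ep t) (t + 1) := by rw [hempty]; simp
        rw [mem_retained] at ha
        push Not at ha
        obtain ⟨s₁, s₂, x1, x2, x3, x4⟩ := ha
        exact ⟨s₁, s₂, x1, x2, by omega,
          significantRegret_of_evicts hT hc hgood.conc (by omega) x2 (by omega) x4⟩
      have hlt := phase_lt_phase P w T h0 (by omega : t ≤ T) hall
      have hle := phase_mono P w T (Nat.le_succ t)
      simp only [Nat.succ_eq_add_one] at hle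
      set p := phase P w T (ep t)
      set q := phase P w T (t + 1)
      have hsplit : ∑ u ∈ Finset.Ico 1 (t + 1),
          ev (playLaw w (log u).rate (log u).active) (gap P w u) =
          ∑ u ∈ Finset.Ico 1 (ep t), ev (playLaw w (log u).rate (log u).active) (gap P w u) +
          ∑ u ∈ Finset.Icc (ep t) t,
            ev (playLaw w (log u).rate (log u).active) (gap P w u) := by
        rw [← Finset.Ico_succ_right_eq_Icc]
        exact (Finset.sum_Ico_consecutive
          (fun u => ev (playLaw w (log u).rate (log u).active) (gap P w u)) h0
          (Nat.le_succ_of_le h01)).symm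
      have e1 : ∑ i ∈ Finset.Icc p (phase P w T t), rho P w T i ≤
          ∑ i ∈ Finset.Ico p q, rho P w T i + rho P w T q := by
        rw [← Finset.sum_Ico_succ_top (by omega : p ≤ q)]
        refine Finset.sum_le_sum_of_subset_of_nonneg ?_ fun i _ _ => hrho i
        intro i hi
        rw [Finset.mem_Icc] at hi
        rw [Finset.mem_Ico]
        omega
      have e2 : rho P w T p ≤ ∑ i ∈ Finset.Ico p q, rho P w T i :=
        Finset.single_le_sum (f := rho P w T) (fun i _ => hrho i)
          (Finset.mem_Ico.2 ⟨le_rfl, by omega⟩)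
      have e3 : ∑ i ∈ Finset.range q, rho P w T i =
          ∑ i ∈ Finset.range p, rho P w T i + ∑ i ∈ Finset.Ico p q, rho P w T i :=
        (Finset.sum_range_add_sum_Ico _ (by omega : p ≤ q)).symm
      rw [hsplit]
      refine (add_le_add ih hepi).trans ?_
      rw [← mul_add]
      refine mul_le_mul_of_nonneg_left ?_ hQ
      linarith

lemma IsTrace.regret_le (htr : IsTrace c κ T log ep cs dur) (hκ : 0 < κ) (hκ1 : κ ≤ 1)
    (hT : 2 ≤ T) (hKT : K ≤ T) (hc1 : 0 ≤ c₁) (hc : c₁ + 2 ≤ c)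
    {B : ℕ → Fin (numScales T) → Bool} (hgood : IsGood P w c c₁ κ T log ep dur B) :
    ∑ u ∈ Finset.Icc 1 T, ev (playLaw w (log u).rate (log u).active) (gap P w u) ≤
      2 * episodeCoef c c₁ κ T * phaseRate P w T := by
  have hQ : 0 ≤ episodeCoef c c₁ κ T := episodeCoef_nonneg hκ (by linarith)
  have hrho := rho_nonneg P w T
  have hT1 : 1 ≤ T := by omega
  have h0 := htr.one_le_ep hT1
  have h01 := htr.ep_le hT1
  have h1 := htr.regret_before_le hκ hκ1 hT hKT hc1 hc hgood hT1 le_rfl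
  have h2 := htr.episode_regret_le hκ hκ1 hT hKT hc1 hc hgood hT1 le_rfl
  have h3 := sum_rho_le_phaseRate P w T (t₀ := 0) hT1 le_rfl
  have hle := phase_mono P w T h01
  set p := phase P w T (ep T)
  set q := phase P w T T
  have hsplit : ∑ u ∈ Finset.Icc 1 T, ev (playLaw w (log u).rate (log u).active) (gap P w u) =
      ∑ u ∈ Finset.Ico 1 (ep T), ev (playLaw w (log u).rate (log u).active) (gap P w u) +
      ∑ u ∈ Finset.Icc (ep T) T, ev (playLaw w (log u).rate (log u).active) (gap P w u) := by
    rw [← Finset.Ico_succ_right_eq_Icc, ← Finset.Ico_succ_right_eq_Icc]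
    exact (Finset.sum_Ico_consecutive
      (fun u => ev (playLaw w (log u).rate (log u).active) (gap P w u)) h0
      (Nat.le_succ_of_le h01)).symm
  have e0 : Finset.Icc 0 q = Finset.range (q + 1) := by
    ext i; simp
  have e1 : Finset.Icc p q = Finset.Ico p (q + 1) := by
    ext i; simp
  rw [e0] at h3
  rw [e1] at h2
  have e2 : rho P w T p ≤ ∑ i ∈ Finset.Ico p (q + 1), rho P w T i :=
    Finset.single_le_sum (f := rho P w T) (fun i _ => hrho i)
      (Finset.mem_Ico.2 ⟨le_rfl, by omega⟩)
  have e3 : ∑ i ∈ Finset.range (q + 1), rho P w T i =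
      ∑ i ∈ Finset.range p, rho P w T i + ∑ i ∈ Finset.Ico p (q + 1), rho P w T i :=
    (Finset.sum_range_add_sum_Ico _ (by omega : p ≤ q + 1)).symm
  rw [hsplit]
  calc _ ≤ _ := add_le_add h1 h2
    _ = episodeCoef c c₁ κ T * (2 * ∑ i ∈ Finset.range p, rho P w T i + rho P w T p +
        ∑ i ∈ Finset.Ico p (q + 1), rho P w T i) := by ring
    _ ≤ episodeCoef c c₁ κ T * (2 * phaseRate P w T) :=
        mul_le_mul_of_nonneg_left (by linarith) hQ
    _ = _ := by ring

end EpisodeRegret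

/-! ### Good runs and the expected regret -/

lemma runDur_cases {T : ℕ} (H : ℕ → Round K T) (u : ℕ) :
    runDur H u = 0 ∨ ∃ e, runDur H u = duration e ∧ (H (u - 1)).1 e = true := by
  unfold runDur
  rcases (Finset.univ.filter fun e => (H (u - 1)).1 e = true).eq_empty_or_nonempty with h | h
  · left
    rw [h, Finset.sup_empty]
    rfl
  · right
    obtain ⟨e, he, h'⟩ := Finset.exists_mem_eq_sup _ h duration
    exact ⟨e, h', (Finset.mem_filter.1 he).2⟩

lemma duration_le_runDur {T : ℕ} (H : ℕ → Round K T) (u : ℕ) (e : Fin (numScales T))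
    (h : (H (u - 1)).1 e = true) : duration e ≤ runDur H u :=
  Finset.le_sup (f := duration) (by simpa using h)

/-- The indices of the exponential factors that control a run. -/
abbrev FactorIndex (K T N : ℕ) : Type :=
  (Fin (T + 1) × Fin (T + 1) × Fin K × Fin K × Fin (N + 1)) ⊕
    ((Fin (T + 1) × Fin (T + 1) × Fin (numScales T)) ⊕ (Fin (T + 1) × Fin (T + 1) × Fin K))

/-- The exponential factors that control a run. -/
def controlFactor (P : Environment K) (c c₁ κ β : ℝ) {T : ℕ} (w : PMF (Fin K)) (N : ℕ) :
    FactorIndex K T N → State K → Round K T → ℝ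
  | .inl (s₁, s₂, a, a', n) => deviationFactor P c κ β w s₁ s₂ a a' n
  | .inr (.inl (t₀, t₁, e)) => scheduleFactor 1 t₀ t₁ fun _ => some e
  | .inr (.inr (t₀, t₁, a)) => scheduleFactor (-1) t₀ t₁
      (criticalScale P w T (3 * evictionCoef c c₁ κ T) a t₀)

lemma controlFactor_nonneg (P : Environment K) (c c₁ κ β : ℝ) {T : ℕ} (w : PMF (Fin K)) (N : ℕ)
    (i : FactorIndex K T N) (σ : State K) (r : Round K T) :
    0 ≤ controlFactor P c c₁ κ β w N i σ r := by
  rcases i with ⟨s₁, s₂, a, a', n⟩ | ⟨t₀, t₁, e⟩ | ⟨t₀, t₁, a⟩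
  · exact deviationFactor_nonneg ..
  · exact scheduleFactor_nonneg 1 (t₀ : ℕ) (t₁ : ℕ) (fun _ => some e) σ r
  · exact scheduleFactor_nonneg ..

section Main

variable (P : Environment K) {c κ β : ℝ} {T : ℕ} (w : PMF (Fin K))

lemma ev_controlFactor_le_one (c₁ : ℝ) (hκ : 0 < κ) (hκ1 : κ ≤ 1) (hβ : 0 < β)
    (hq : PlaysActive w κ β) (N : ℕ) (i : FactorIndex K T N) (σ : State K) :
    ev (roundLaw P c κ T w σ) (controlFactor P c c₁ κ β w N i σ) ≤ 1 := by
  rcases i with ⟨s₁, s₂, a, a', n⟩ | ⟨t₀, t₁, e⟩ | ⟨t₀, t₁, a⟩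
  · exact ev_deviationFactor_le_one P c w hκ hκ1 hβ hq ..
  · exact ev_scheduleFactor_le_one P c κ w 1 (t₀ : ℕ) (t₁ : ℕ) (fun _ => some e) σ
  · exact ev_scheduleFactor_le_one ..

/-- All randomness is disposed of here: below the level `T ^ 8`, the three families give
concentration, counts and lucky schedulers respectively. -/
lemma isGood_of_prod_lt (hκ : 0 < κ) (hκ1 : κ ≤ 1) (hβ : 0 < β) (hβ1 : β ≤ 1) (hT : 2 ≤ T)
    (hKT : K ≤ T) (H : ℕ → Round K T)
    (h : ∀ i : FactorIndex K T (maxDeviation κ β T), ∏ k ∈ Finset.range T,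
      controlFactor P c (18 / β) κ β w (maxDeviation κ β T) i (run c κ T w H k) (H k)
        < (T : ℝ) ^ 8) :
    IsGood P w c (18 / β) κ T (runLog c κ w H) (runEp c κ w H) (runDur H)
      fun u => (H (u - 1)).1 where
  conc := concentrates_of_prod_lt P w H hκ hκ1 hβ hβ1 hT hKT fun s₁ s₂ a a' N hN h1 h2 =>
    h (.inl (⟨s₁, by omega⟩, ⟨s₂, by omega⟩, a, a', ⟨N, by omega⟩))
  dur_eq := runDur_cases H
  le_dur := duration_le_runDur H
  count := fun t₀ t₁ h0 h1 hep e => by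
    -- The factors are indexed by rounds up to `T`; a later `t₀` leaves an empty interval.
    rcases Nat.lt_or_ge T t₀ with hlt | hle
    · rw [Finset.Icc_eq_empty (by omega)]
      have : 0 ≤ Real.log T := Real.log_natCast_nonneg T
      simp [this]
    · exact count_le_of_prod_lt w H h0 h1 hT hep e
        (h (.inr (.inl (⟨t₀, by omega⟩, ⟨t₁, by omega⟩, e))))
  lucky := fun a t₀ t₁ h0 h1 hep hB => by
    rcases Nat.lt_or_ge T t₀ with hlt | hle
    · rw [Finset.Icc_eq_empty (by omega)]
      have : 0 ≤ Real.log T := Real.log_natCast_nonneg T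
      simp [this]
    · exact sum_scheduleProb_le_of_prod_lt w H h0 h1 hT hep _
        (h (.inr (.inr (⟨t₀, by omega⟩, ⟨t₁, by omega⟩, a)))) hB

lemma sum_meanGap_eq (H : ℕ → Round K T) :
    ∑ k ∈ Finset.range T, meanGap P c κ w (run c κ T w H k) (H k) =
      ∑ u ∈ Finset.Icc 1 T, ev (playLaw w (runLog c κ w H u).rate (runLog c κ w H u).active)
        (gap P w u) := by
  rw [← Finset.Ico_succ_right_eq_Icc, Finset.sum_Ico_eq_sum_range]
  refine Finset.sum_congr (by simp) fun k _ => ?_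
  rw [add_comm 1 k, runLog_succ, meanGap, run_round]

/-! ### Size of the union bound and of the coefficients. -/

lemma numScales_le (hT : 2 ≤ T) : (numScales T : ℝ) ≤ 2 * (1 + Real.log T) := by
  have h1 : 0 < Nat.clog 2 T := Nat.clog_pos (by norm_num) hT
  have h2 := Nat.pow_pred_clog_lt_self (b := 2) (by norm_num) (by omega : 1 < T)
  rw [Nat.pred_eq_sub_one] at h2
  have h3 : (2 : ℝ) ^ (Nat.clog 2 T - 1) ≤ T := by exact_mod_cast h2.le
  have h4 := Real.log_le_log (by positivity) h3
  rw [Real.log_pow, Nat.cast_sub h1] at h4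
  push_cast at h4
  have h5 := Real.log_two_gt_d9
  have h6 : (1 : ℝ) ≤ Nat.clog 2 T := by exact_mod_cast h1
  change (Nat.clog 2 T : ℝ) ≤ _
  nlinarith

lemma numScales_le_self : numScales T ≤ T := by
  refine Nat.clog_le_of_le_pow ?_
  exact Nat.lt_two_pow_self.le

/-- The deviation factors dominate: two rounds, two arms and `O(T ^ 3)` values of `N` give the power
seven, one below the level `T ^ 8`. -/
lemma card_factorIndex_le (hκ : 0 < κ) (hκ1 : κ ≤ 1) (hβ : 0 < β) (hβ1 : β ≤ 1) (hT : 2 ≤ T)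
    (hKT : K ≤ T) :
    (Fintype.card (FactorIndex K T (maxDeviation κ β T)) : ℝ) ≤ 28 / (κ * β) * (T : ℝ) ^ 7 := by
  have hTr : (2 : ℝ) ≤ T := by exact_mod_cast hT
  have hKTr : (K : ℝ) ≤ T := by exact_mod_cast hKT
  have hS : (numScales T : ℝ) ≤ T := by exact_mod_cast numScales_le_self
  have hκβ : 0 < κ * β := mul_pos hκ hβ
  have hκβ1 : κ * β ≤ 1 := mul_le_one₀ hκ1 hβ.le hβ1
  have hinv : 1 ≤ 1 / (κ * β) := by rw [le_div_iff₀ hκβ]; linarith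
  have hT3 : (1 : ℝ) ≤ (T : ℝ) ^ 3 := one_le_pow₀ (by linarith)
  have hN : (maxDeviation κ β T : ℝ) + 1 ≤ 5 * (1 / (κ * β)) * (T : ℝ) ^ 3 := by
    have := Nat.ceil_lt_add_one (show 0 ≤ 3 * (T : ℝ) ^ 3 / (κ * β) by positivity)
    have e : 3 * (T : ℝ) ^ 3 / (κ * β) = 3 * (1 / (κ * β)) * (T : ℝ) ^ 3 := by ring
    have h1 : 1 ≤ 1 / (κ * β) * (T : ℝ) ^ 3 := one_le_mul_of_one_le_of_one_le hinv hT3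
    unfold maxDeviation
    rw [e] at this ⊢
    linarith
  have hT1 : (T : ℝ) + 1 ≤ 2 * T := by linarith
  simp only [FactorIndex, Fintype.card_sum, Fintype.card_prod, Fintype.card_fin]
  push_cast
  have b1 : ((T : ℝ) + 1) * ((T + 1) * (K * (K * (maxDeviation κ β T + 1)))) ≤
      (2 * T) * ((2 * T) * (T * (T * (5 * (1 / (κ * β)) * (T : ℝ) ^ 3)))) := by gcongr
  have b2 : ((T : ℝ) + 1) * ((T + 1) * numScales T) ≤ (2 * T) * ((2 * T) * T) := by gcongr
  have b3 : ((T : ℝ) + 1) * ((T + 1) * K) ≤ (2 * T) * ((2 * T) * T) := by gcongr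
  have b4 : 8 * (T : ℝ) ^ 3 ≤ 8 * (1 / (κ * β) * (T : ℝ) ^ 7) := by
    have h1 : (T : ℝ) ^ 3 ≤ (T : ℝ) ^ 7 := pow_le_pow_right₀ (by linarith) (by norm_num)
    have h2 : (T : ℝ) ^ 7 ≤ 1 / (κ * β) * (T : ℝ) ^ 7 := le_mul_of_one_le_left (by positivity) hinv
    linarith
  calc _ ≤ _ := add_le_add b1 (add_le_add b2 b3)
    _ = 20 * (1 / (κ * β) * (T : ℝ) ^ 7) + 8 * (T : ℝ) ^ 3 := by ring
    _ ≤ 28 * (1 / (κ * β) * (T : ℝ) ^ 7) := by linarith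
    _ = _ := by ring

lemma phaseRate_nonneg : 0 ≤ phaseRate P w T :=
  Finset.sum_nonneg fun i _ => rho_nonneg P w T i

lemma expectedRegret_le_horizon : expectedRegret P c κ T w ≤ T := by
  have hK := pos_of_pmf w
  rw [expectedRegret_eq P c κ T w (fun _ => false, ⟨0, hK⟩, ⟨0, hK⟩, false)]
  refine (ev_mono _ fun h => ?_).trans (ev_const _ (T : ℝ)).le
  refine (Finset.sum_le_sum fun k _ => meanGap_le_one P c κ w _ _).trans ?_
  simp

lemma horizon_le_phaseRate (hKT : T ≤ K) : (T : ℝ) ≤ phaseRate P w T := by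
  rcases Nat.eq_zero_or_pos T with h | h
  · rw [h]
    simpa using phaseRate_nonneg P (T := 0) w
  · refine le_trans ?_ (rate_le_phaseRate P w T h)
    have hT0 : (0 : ℝ) ≤ T := Nat.cast_nonneg T
    calc (T : ℝ) = (T : ℝ) ^ (1 / 3 : ℝ) * (T : ℝ) ^ (2 / 3 : ℝ) := by
          rw [rpow_two_thirds hT0, ← pow_succ', rpow_third_pow_three hT0]
      _ ≤ _ := by
          have : (T : ℝ) ≤ K := by exact_mod_cast hKT
          gcongr

/-- One power of the logarithm comes from each of the eviction coefficient, the average over arms,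
the number of scales and the replay counts. -/
lemma episodeCoef_le {c₁ : ℝ} (hκ : 0 < κ) (hcc : 0 ≤ c + c₁) (hT : 2 ≤ T) :
    episodeCoef c c₁ κ T ≤
      (17 * (3 + 2 * ((c + c₁) * (3 / κ) + 2)) + 64 * (3 * ((c + c₁) * (3 / κ) + 2) + 1)) *
        (1 + Real.log T) ^ 4 := by
  have hlog : 0 ≤ Real.log T := Real.log_natCast_nonneg T
  have hS := numScales_le hT
  have hS0 : (0 : ℝ) ≤ numScales T := Nat.cast_nonneg _
  have hD : 0 ≤ (c + c₁) * (3 / κ) := by positivity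
  have hE2 : 2 ≤ evictionCoef c c₁ κ T := two_le_evictionCoef hκ hcc
  have hE : evictionCoef c c₁ κ T ≤ ((c + c₁) * (3 / κ) + 2) * (1 + Real.log T) := by
    unfold evictionCoef
    nlinarith
  have hL : 64 * Real.log T + 2 ≤ 64 * (1 + Real.log T) := by linarith
  have hL8 : 6 + 8 * Real.log T ≤ 8 * (1 + Real.log T) := by linarith
  unfold episodeCoef
  have hΛ1 : 1 ≤ 1 + Real.log T := by linarith
  generalize 1 + Real.log T = Λ at *
  generalize (numScales T : ℝ) = S at *
  generalize evictionCoef c c₁ κ T = E at *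
  generalize (c + c₁) * (3 / κ) + 2 = D at *
  have hD0 : 0 ≤ D := by nlinarith
  have hΛ2 : 1 ≤ Λ ^ 2 := one_le_pow₀ hΛ1
  have hE0 : 0 ≤ E := by linarith
  have a1 : 3 + 2 * (E * Λ) ≤ (3 + 2 * D) * Λ ^ 2 := by
    have : E * Λ ≤ D * Λ * Λ := by gcongr
    nlinarith
  have a2 : 1 + S * (6 + 8 * Real.log T) ≤ 17 * Λ ^ 2 := by
    have : S * (6 + 8 * Real.log T) ≤ 2 * Λ * (8 * Λ) := by gcongr
    nlinarith
  have a3 : 3 * E + 1 ≤ (3 * D + 1) * Λ := by nlinarith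
  have a4 : Λ ^ 2 ≤ Λ ^ 4 := pow_le_pow_right₀ hΛ1 (by norm_num)
  calc _ ≤ (3 + 2 * D) * Λ ^ 2 * (17 * Λ ^ 2) + (3 * D + 1) * Λ * (64 * Λ) := by gcongr
    _ = 17 * (3 + 2 * D) * Λ ^ 4 + 64 * (3 * D + 1) * Λ ^ 2 := by ring
    _ ≤ 17 * (3 + 2 * D) * Λ ^ 4 + 64 * (3 * D + 1) * Λ ^ 4 := by gcongr
    _ = _ := by ring

/-- Markov's inequality inside the expectation: the sum of the products is added to the good bound
pointwise, with the weight `T ^ (-7)` that makes it cover the trivial regret `T` on bad runs. -/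
lemma expectedRegret_le_episodeCoef (hκ : 0 < κ) (hκ1 : κ ≤ 1) (hβ : 0 < β) (hβ1 : β ≤ 1)
    (hq : PlaysActive w κ β) (hc : 18 / β + 2 ≤ c) (hT : 2 ≤ T) (hKT : K ≤ T) :
    expectedRegret P c κ T w ≤
      2 * episodeCoef c (18 / β) κ T * phaseRate P w T + 28 / (κ * β) := by
  have hK := pos_of_pmf w
  have hTr : (0 : ℝ) < T := by exact_mod_cast (by omega)
  set r₀ : Round K T := (fun _ => false, ⟨0, hK⟩, ⟨0, hK⟩, false)
  set N := maxDeviation κ β T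
  set Z : FactorIndex K T N → (Fin T → Round K T) → ℝ := fun i h => ∏ k ∈ Finset.range T,
    controlFactor P c (18 / β) κ β w N i (run c κ T w (extend r₀ h) k) (extend r₀ h k) with hZ
  have hZ0 : ∀ i h, 0 ≤ Z i h := fun i h =>
    Finset.prod_nonneg fun k _ => controlFactor_nonneg ..
  have hZ1 : ∀ i, ev (historyLaw P c κ T w T) (Z i) ≤ 1 := fun i =>
    ev_prod_le_one P c κ T w r₀ _ (controlFactor_nonneg P c (18 / β) κ β w N i)
      (ev_controlFactor_le_one P w (18 / β) hκ hκ1 hβ hq N i) T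
  have hQ : 0 ≤ episodeCoef c (18 / β) κ T :=
    episodeCoef_nonneg hκ (by have : 0 < 18 / β := by positivity
                              linarith)
  have hbound0 : 0 ≤ 2 * episodeCoef c (18 / β) κ T * phaseRate P w T :=
    mul_nonneg (by linarith) (phaseRate_nonneg P w)
  rw [expectedRegret_eq P c κ T w r₀]
  calc _ ≤ ev (historyLaw P c κ T w T) (fun h =>
        2 * episodeCoef c (18 / β) κ T * phaseRate P w T + ((T : ℝ) ^ 7)⁻¹ * ∑ i, Z i h) := by
        refine ev_mono _ fun h => ?_
        by_cases hgood : ∀ i, Z i h < (T : ℝ) ^ 8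
        · rw [sum_meanGap_eq]
          refine le_add_of_le_of_nonneg ?_
            (mul_nonneg (by positivity) (Finset.sum_nonneg fun i _ => hZ0 i h))
          exact (isTrace_run c κ w (extend r₀ h)).regret_le hκ hκ1 hT hKT (by positivity) hc
            (isGood_of_prod_lt P w hκ hκ1 hβ hβ1 hT hKT _ hgood)
        · push Not at hgood
          obtain ⟨i, hi⟩ := hgood
          have h1 : ∑ k ∈ Finset.range T,
              meanGap P c κ w (run c κ T w (extend r₀ h) k) (extend r₀ h k) ≤ T := by
            refine (Finset.sum_le_sum fun k _ => meanGap_le_one P c κ w _ _).trans ?_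
            simp
          have h2 : (T : ℝ) ^ 8 ≤ ∑ i, Z i h :=
            hi.trans (Finset.single_le_sum (f := fun i => Z i h) (fun i _ => hZ0 i h)
              (Finset.mem_univ i))
          have h3 : (T : ℝ) ≤ ((T : ℝ) ^ 7)⁻¹ * ∑ i, Z i h := by
            calc (T : ℝ) = ((T : ℝ) ^ 7)⁻¹ * (T : ℝ) ^ 8 := by field_simp
              _ ≤ _ := by gcongr
          linarith
    _ = 2 * episodeCoef c (18 / β) κ T * phaseRate P w T +
        ((T : ℝ) ^ 7)⁻¹ * ∑ i, ev (historyLaw P c κ T w T) (Z i) := by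
        rw [ev_add, ev_const, ev_mul_left, ev_finset_sum]
    _ ≤ 2 * episodeCoef c (18 / β) κ T * phaseRate P w T +
        ((T : ℝ) ^ 7)⁻¹ * (28 / (κ * β) * (T : ℝ) ^ 7) := by
        gcongr
        calc _ ≤ ∑ i : FactorIndex K T N, (1 : ℝ) := Finset.sum_le_sum fun i _ => hZ1 i
          _ = Fintype.card (FactorIndex K T N) := by simp
          _ ≤ _ := card_factorIndex_le hκ hκ1 hβ hβ1 hT hKT
    _ = _ := by field_simp

end Main

/-- The regret bound for all weights under which active arms are played often enough. -/
theorem exists_expectedRegret_le {κ β : ℝ} (hκ : 0 < κ) (hκ1 : κ ≤ 1) (hβ : 0 < β) (hβ1 : β ≤ 1)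
    {c : ℝ} (hc : 18 / β + 2 ≤ c) : ∃ C : ℝ, 0 < C ∧
      ∀ (K T : ℕ) (P : Environment K) (w : PMF (Fin K)), PlaysActive w κ β →
        expectedRegret P c κ T w ≤ C * (1 + Real.log T) ^ 4 * phaseRate P w T := by
  have hβ18 : 0 < 18 / β := by positivity
  have hcc : 0 ≤ c + 18 / β := by linarith
  set Q := 17 * (3 + 2 * ((c + 18 / β) * (3 / κ) + 2)) +
    64 * (3 * ((c + 18 / β) * (3 / κ) + 2) + 1) with hQ
  have hQ0 : 0 < Q := by positivity
  refine ⟨2 * Q + 28 / (κ * β) + 1, by positivity, fun K T P w hq => ?_⟩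
  have hlog : 0 ≤ Real.log T := Real.log_natCast_nonneg T
  have hΛ : 1 ≤ (1 + Real.log T) ^ 4 := one_le_pow₀ (by linarith)
  have hph := phaseRate_nonneg P (T := T) w
  have hΛph : phaseRate P w T ≤ (1 + Real.log T) ^ 4 * phaseRate P w T :=
    le_mul_of_one_le_left hph hΛ
  have hκβ : 0 < 28 / (κ * β) := by positivity
  -- For `T ≤ K` already the trivial regret `T` is below `K ^ (1 / 3) * T ^ (2 / 3)`.
  rcases Nat.lt_or_ge K T with hKT | hKT
  · have hK := pos_of_pmf w
    have hT : 2 ≤ T := by omega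
    have h1 := expectedRegret_le_episodeCoef P w hκ hκ1 hβ hβ1 hq hc hT hKT.le
    have h2 := episodeCoef_le (c := c) (c₁ := 18 / β) hκ hcc hT
    have h3 : 1 ≤ phaseRate P w T := by
      refine le_trans ?_ (rate_le_phaseRate P w T (by omega))
      exact one_le_mul_of_one_le_of_one_le
        (Real.one_le_rpow (by exact_mod_cast hK) (by norm_num))
        (Real.one_le_rpow (by exact_mod_cast (by omega : 1 ≤ T)) (by norm_num))
    have h4 := mul_le_mul_of_nonneg_right h2 hph
    have h5 : 28 / (κ * β) ≤ 28 / (κ * β) * ((1 + Real.log T) ^ 4 * phaseRate P w T) :=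
      le_mul_of_one_le_right hκβ.le (h3.trans hΛph)
    have h6 : 0 ≤ (1 + Real.log T) ^ 4 * phaseRate P w T := hph.trans hΛph
    calc _ ≤ _ := h1
      _ ≤ 2 * (Q * (1 + Real.log T) ^ 4 * phaseRate P w T) +
          28 / (κ * β) * ((1 + Real.log T) ^ 4 * phaseRate P w T) +
          (1 + Real.log T) ^ 4 * phaseRate P w T := by linarith
      _ = _ := by ring
  · have h1 := (expectedRegret_le_horizon P (c := c) (κ := κ) (T := T) w).trans
      (horizon_le_phaseRate P w hKT)
    calc _ ≤ _ := h1.trans hΛph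
      _ = 1 * ((1 + Real.log T) ^ 4 * phaseRate P w T) := by ring
      _ ≤ (2 * Q + 28 / (κ * β) + 1) * ((1 + Real.log T) ^ 4 * phaseRate P w T) := by
          refine mul_le_mul_of_nonneg_right ?_ (hph.trans hΛph)
          linarith
      _ = _ := by ring

/-! ### When active arms are played often enough. -/

lemma inv_le_inv_card {A : Finset (Fin K)} {a : Fin K} (ha : a ∈ A) :
    (K : ℝ)⁻¹ ≤ (A.card : ℝ)⁻¹ := by
  refine inv_anti₀ ?_ ?_
  · exact_mod_cast Finset.card_pos.2 ⟨a, ha⟩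
  · exact_mod_cast (by simpa using Finset.card_le_univ A : A.card ≤ K)

/-- The uniform part keeps mass at least `1 - κ`, whatever the weight. -/
lemma playsActive_of_cap_lt_one (w : PMF (Fin K)) {κ : ℝ} (hκ1 : κ < 1) :
    PlaysActive w κ (1 - κ) := by
  intro η h0 h1 A a ha
  rw [playLaw_toReal w h0.le (by linarith) ⟨a, ha⟩, if_pos ha, div_eq_mul_inv]
  have hw : 0 ≤ η * (w a).toReal := mul_nonneg h0.le ENNReal.toReal_nonneg
  have : (1 - κ) * (K : ℝ)⁻¹ ≤ (1 - η) * (A.card : ℝ)⁻¹ :=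
    mul_le_mul (by linarith) (inv_le_inv_card ha) (by positivity) (by linarith)
  linarith

/-- Both `w a` and the uniform probability are at least `min α 1 / K`, hence so is any mixture, even
at `η = 1`. The factor `1 / 2` is slack. -/
lemma playsActive_of_weight (w : PMF (Fin K)) {α : ℝ} (hα : 0 < α)
    (hw : ∀ a, α / K ≤ (w a).toReal) : PlaysActive w 1 (min α 1 / 2) := by
  intro η h0 h1 A a ha
  rw [playLaw_toReal w h0.le h1 ⟨a, ha⟩, if_pos ha]
  have hK : (0 : ℝ) ≤ (K : ℝ)⁻¹ := by positivity
  have hA := inv_le_inv_card ha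
  have ha' := hw a
  rw [div_eq_mul_inv] at ha' ⊢
  set m := min α 1
  have hm0 : 0 ≤ m := le_min hα.le zero_le_one
  have b1 : m * (K : ℝ)⁻¹ ≤ (w a).toReal :=
    (mul_le_mul_of_nonneg_right (min_le_left α 1) hK).trans ha'
  have b2 : m * (K : ℝ)⁻¹ ≤ (A.card : ℝ)⁻¹ := by
    refine le_trans ?_ hA
    exact mul_le_of_le_one_left hK (min_le_right α 1)
  have b3 := mul_le_mul_of_nonneg_left b1 h0.le
  have b4 := mul_le_mul_of_nonneg_left b2 (show 0 ≤ 1 - η by linarith)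
  have b5 : 0 ≤ m * (K : ℝ)⁻¹ := mul_nonneg hm0 hK
  linarith

end WeightedBorda

end

theorem mainTheorem3 :
    ∃ p : ℕ,
      (∀ κ : ℝ, 0 < κ → κ < 1 →
        ∃ c₀ : ℝ, 0 < c₀ ∧ ∀ c : ℝ, c₀ ≤ c → ∃ C : ℝ, 0 < C ∧
          ∀ (K T : ℕ) (P : WeightedBorda.Environment K) (w : PMF (Fin K)),
            WeightedBorda.expectedRegret P c κ T w
              ≤ C * (1 + Real.log T) ^ p * WeightedBorda.phaseRate P w T) ∧
      (∀ α : ℝ, 0 < α →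
        ∃ c₀ : ℝ, 0 < c₀ ∧ ∀ c : ℝ, c₀ ≤ c → ∃ C : ℝ, 0 < C ∧
          ∀ (K T : ℕ) (P : WeightedBorda.Environment K) (w : PMF (Fin K)),
            (∀ a, α / K ≤ (w a).toReal) →
              WeightedBorda.expectedRegret P c 1 T w
                ≤ C * (1 + Real.log T) ^ p * WeightedBorda.phaseRate P w T) := by
  -- In both cases `c₀ = 18 / β + 2`: the concentration constant plus the margin needed for
  -- evictions to certify significant regret.
  refine ⟨4, fun κ hκ hκ1 => ?_, fun α hα => ?_⟩
  · have hβ : 0 < 1 - κ := by linarith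
    refine ⟨18 / (1 - κ) + 2, by positivity, fun c hc => ?_⟩
    obtain ⟨C, hC, h⟩ := WeightedBorda.exists_expectedRegret_le hκ hκ1.le hβ (by linarith) hc
    exact ⟨C, hC, fun K T P w => h K T P w (WeightedBorda.playsActive_of_cap_lt_one w hκ1)⟩
  · have hβ : 0 < min α 1 / 2 := by positivity
    have hβ1 : min α 1 / 2 ≤ 1 := by linarith [min_le_right α 1]
    refine ⟨18 / (min α 1 / 2) + 2, by positivity, fun c hc => ?_⟩
    obtain ⟨C, hC, h⟩ := WeightedBorda.exists_expectedRegret_le one_pos le_rfl hβ hβ1 hc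
    exact ⟨C, hC, fun K T P w hw => h K T P w (WeightedBorda.playsActive_of_weight w hα hw)⟩
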